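/- **Setting.** Let $SE(2)=\mathbb{R}^2\rtimes SO(2)$ with $(\mathbf x,\mathbf R)\circ(\mathbf x',\mathbf R')=(\mathbf x+\mathbf R\mathbf x',\mathbf R\mathbf R')$, let $\mathbf R_\theta$ be the rotation by $\theta$, let $g(a,\phi,\theta)=((a\cos\phi,a\sin\phi),\mathbf R_\theta)$, and let $dg=\frac1{4\pi^2}\,dx_1\,dx_2\,d\theta$. Let $\Gamma=\mathbb{Z}^2$ be the subgroup of integral translations, and let $\mu$ be the finite $SE(2)$-invariant measure on $\Gamma\backslash SE(2)$ normalized by Weil's formula $\int_{\Gamma\backslash SE(2)}\widetilde f\,d\mu=\int_{SE(2)}f(g)\,dg$, where $\widetilde f(\Gamma g)=\sum_{\gamma\in\Gamma}f(\gamma\circ g)$. For $\psi\in L^1(\Gamma\backslash SE(2),\mu)$ and $f\in L^1(SE(2))$ put $$(\psi\oslash f)(\Gamma g)=\int_{SE(2)}\psi(\Gamma h)f(h^{-1}\circ g)\,dh .$$ For $f\in L^1(SE(2))$ and $k\in\mathbb{Z}$ let $\widehat f[k]=\int f(g)e^{-ik\theta}\,dg$, where $g=(\mathbf t,\mathbf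 R_\theta)$. For $p>0$ let $\widehat f(p)=\int f(g)U_p(g^{-1})\,dg$ (strong integral on $L^2(\mathbb{S}^1)$), where $[U_p(g)\varphi](\mathbf u)=e^{-ip\langle\mathbf u,\mathbf t\rangle}\varphi(\mathbf R_\theta^T\mathbf u)$. Let $\widehat f(p)_{nm}=\langle\widehat f(p)\mathbf e_n,\mathbf e_m\rangle$, where $\mathbf e_k(\cos\beta,\sin\beta)=e^{ik\beta}$ and $\langle u,v\rangle=\frac1{2\pi}\int_0^{2\pi}u\,\overline v\,d\beta$. For $(k_1,k_2)\in\mathbb{Z}^2\setminus\{0\}$ let $\rho(k_1,k_2)=\sqrt{k_1^2+k_2^2}$ and let $\Phi(k_1,k_2)\in[0,2\pi)$ be the polar angle of $(k_1,k_2)$. Let $\mathcal R_+$ be the set of all values $\rho(k_1,k_2)$, $(k_1,k_2)\neq0$. For $\rho\in\mathcal R_+$ let $\Theta_\rho=\{\Phi(k_1,k_2):\rho(k_1,k_2)=\rho\}$ (a finite set), and for $q\in\mathbb{Z}$ let $$K_\rho^q(a,\phi)=\sum_{\theta\in\Theta_\rho}e^{2\pi i a\rho\cos(\phi-\theta)}e^{iq\theta}.$$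 **Theorem.** Let $f_1,f_2\in L^1(SE(2))$ with $\widetilde{|f_1|}\in L^2(\Gamma\backslash SE(2),\mu)$. Then the integral defining $(\widetilde{f_1}\oslash f_2)(\Gamma g)$ converges absolutely for almost every $g$, $\widetilde{f_1}\oslash f_2\in L^2(\Gamma\backslash SE(2),\mu)$, and, with $h=g(a,\phi,\alpha)$, $$(\widetilde{f_1}\oslash f_2)(\Gamma h)=2\pi\Bigg[\sum_{k\in\mathbb{Z}}\widehat{f_1}[k]\,\widehat{f_2}[k]\,e^{ik\alpha}+\sum_{\rho\in\mathcal R_+}\sum_{k\in\mathbb{Z}}\sum_{n\in\mathbb{Z}}\sum_{m\in\mathbb{Z}}(-1)^{k-n}K_\rho^{k-n}(a,\phi)\,\widehat{f_1}(2\pi\rho)_{nm}\,\widehat{f_2}(2\pi\rho)_{mk}\,e^{-ik\alpha}\Bigg]$$ in the following sense. For fixed $\rho,n,k$ the series over $m$ converges absolutely. For fixed $\rho,k$ the series over $n$ converges, as the limit of the symmetric partial sums over $|n|\le N$, for all real $a,\phi,\alpha$, and its sum depends only on the coset $\Gamma h$. The series over $k$ of the functions $\Gamma h\mapsto\widehat{f_1}[k]\widehat{f_2}[k]e^{ik\alpha}$,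 and the series over $(\rho,k)\in\mathcal R_+\times\mathbb{Z}$ of the functions just obtained, converge unconditionally in $L^2(\Gamma\backslash SE(2),\mu)$, and the equality holds in $L^2(\Gamma\backslash SE(2),\mu)$, i.e. for $\mu$-almost every $\Gamma h$. -/

import Mathlib

open MeasureTheory Filter Topology
open scoped ENNReal

noncomputable section

/-- The interval length `2π` is positive; this makes `AddCircle (2π)` available as the circle. -/
instance instFactTwoPiPos : Fact ((0 : ℝ) < 2 * Real.pi) := ⟨Real.two_pi_pos⟩

/-- The circle `ℝ / 2πℤ`. It parametrizes both the rotations `R_θ ∈ SO(2)` and the points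
`u_β = (cos β, sin β)` of the unit circle `𝕊¹`. -/
abbrev Ang : Type := AddCircle (2 * Real.pi)

/-- The group `SE(2) = ℝ² ⋊ SO(2)` of pairs `((x, y), R_θ)`. -/
@[ext] structure SE2 where
  x : ℝ
  y : ℝ
  θ : Ang

namespace SE2

/-- `(x, R) ∘ (x', R') = (x + R x', R R')`. -/
instance : Mul SE2 where
  mul g h :=
    ⟨g.x + (Real.Angle.cos g.θ * h.x - Real.Angle.sin g.θ * h.y),
     g.y + (Real.Angle.sin g.θ * h.x + Real.Angle.cos g.θ * h.y), g.θ + h.θ⟩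

instance : One SE2 := ⟨⟨0, 0, 0⟩⟩

/-- `(x, R)⁻¹ = (-Rᵀ x, Rᵀ)`. -/
instance : Inv SE2 where
  inv g :=
    ⟨-(Real.Angle.cos g.θ * g.x + Real.Angle.sin g.θ * g.y),
     -(-Real.Angle.sin g.θ * g.x + Real.Angle.cos g.θ * g.y), -g.θ⟩

theorem mul_def (g h : SE2) : g * h =
    ⟨g.x + (Real.Angle.cos g.θ * h.x - Real.Angle.sin g.θ * h.y),
     g.y + (Real.Angle.sin g.θ * h.x + Real.Angle.cos g.θ * h.y), g.θ + h.θ⟩ := rfl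

theorem one_def : (1 : SE2) = ⟨0, 0, 0⟩ := rfl

theorem inv_def (g : SE2) : g⁻¹ =
    ⟨-(Real.Angle.cos g.θ * g.x + Real.Angle.sin g.θ * g.y),
     -(-Real.Angle.sin g.θ * g.x + Real.Angle.cos g.θ * g.y), -g.θ⟩ := rfl

theorem cos_add' (a b : Ang) : Real.Angle.cos (a + b) =
    Real.Angle.cos a * Real.Angle.cos b - Real.Angle.sin a * Real.Angle.sin b :=
  Real.Angle.cos_add a b

theorem sin_add' (a b : Ang) : Real.Angle.sin (a + b) =
    Real.Angle.sin a * Real.Angle.cos b + Real.Angle.cos a * Real.Angle.sin b :=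
  Real.Angle.sin_add a b

theorem cos_zero' : Real.Angle.cos (0 : Ang) = 1 := Real.Angle.cos_zero

theorem sin_zero' : Real.Angle.sin (0 : Ang) = 0 := Real.Angle.sin_zero

theorem cos_neg' (a : Ang) : Real.Angle.cos (-a) = Real.Angle.cos a := Real.Angle.cos_neg a

theorem sin_neg' (a : Ang) : Real.Angle.sin (-a) = -Real.Angle.sin a := Real.Angle.sin_neg a

instance : Group SE2 where
  mul_assoc a b c := by
    ext
    · simp only [mul_def, cos_add', sin_add']; ring
    · simp only [mul_def, cos_add', sin_add']; ring
    · simp only [mul_def, add_assoc]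
  one_mul a := by
    ext <;> simp [mul_def, one_def, cos_zero', sin_zero']
  mul_one a := by
    ext <;> simp [mul_def, one_def]
  inv_mul_cancel a := by
    ext <;> simp [mul_def, one_def, inv_def, cos_neg', sin_neg']

/-- The homogeneous matrix representing a group element. -/
def toMatrix (g : SE2) : Matrix (Fin 3) (Fin 3) ℝ :=
  !![Real.Angle.cos g.θ, -Real.Angle.sin g.θ, g.x;
     Real.Angle.sin g.θ, Real.Angle.cos g.θ, g.y;
     0, 0, 1]

theorem toMatrix_mul (g h : SE2) : (g * h).toMatrix = g.toMatrix * h.toMatrix := by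
  ext i j
  fin_cases i <;> fin_cases j <;>
    simp [toMatrix, Matrix.mul_apply, Fin.sum_univ_succ, mul_def, cos_add', sin_add'] <;> ring

/-- The coordinates `(x, y, θ)`. -/
def equivProd : SE2 ≃ ℝ × ℝ × Ang where
  toFun g := (g.x, g.y, g.θ)
  invFun q := ⟨q.1, q.2.1, q.2.2⟩
  left_inv _ := rfl
  right_inv _ := rfl

instance : TopologicalSpace SE2 := TopologicalSpace.induced equivProd inferInstance

instance : MeasurableSpace SE2 := MeasurableSpace.comap equivProd inferInstance

/-- The coordinates `(x, y, θ)` as an isomorphism of measurable spaces. -/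
def measurableEquivProd : SE2 ≃ᵐ ℝ × ℝ × Ang where
  toEquiv := equivProd
  measurable_toFun := comap_measurable _
  measurable_invFun := by
    rintro _ ⟨s, hs, rfl⟩
    exact hs

/-- The Haar measure `dg = (4π²)⁻¹ dx dy dθ`. -/
def haar : Measure SE2 :=
  ENNReal.ofReal (1 / (4 * Real.pi ^ 2)) •
    Measure.map measurableEquivProd.symm (volume : Measure (ℝ × ℝ × Ang))

/-- The element `g(a, φ, θ)` with translation part `(a cos φ, a sin φ)` and rotation `R_θ`. -/
def polar (a φ θ : ℝ) : SE2 := ⟨a * Real.cos φ, a * Real.sin φ, (θ : Ang)⟩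

/-- The lattice `Γ = ℤ²` of integral translations. -/
def latticeΓ : Subgroup SE2 where
  carrier := {g | ∃ i j : ℤ, g = ⟨i, j, 0⟩}
  mul_mem' := by
    rintro _ _ ⟨i, j, rfl⟩ ⟨i', j', rfl⟩
    exact ⟨i + i', j + j', by simp [mul_def, cos_zero', sin_zero']⟩
  one_mem' := ⟨0, 0, by simp [one_def]⟩
  inv_mem' := by
    rintro _ ⟨i, j, rfl⟩
    exact ⟨-i, -j, by simp [inv_def, cos_zero', sin_zero']⟩

/-- The space `Γ \ SE(2)` of right cosets `Γ g`. -/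
abbrev CosetSpace : Type := Quotient (QuotientGroup.rightRel latticeΓ)

/-- The coset `Γ g`. -/
def coset (g : SE2) : CosetSpace := Quotient.mk _ g

/-- The fundamental domain `[0,1)² × [0,2π)` of `Γ` in `SE(2)`. -/
def fundDomain : Set SE2 := {g | g.x ∈ Set.Ico (0 : ℝ) 1 ∧ g.y ∈ Set.Ico (0 : ℝ) 1}

/-- The finite invariant measure `μ` on `Γ \ SE(2)` that is normalized by Weil's formula
`∫ ∑_γ f(γ g) dμ(Γ g) = ∫ f(g) dg`. -/
def cosetMeasure : Measure CosetSpace := Measure.map coset (haar.restrict fundDomain)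

theorem measurePreserving_lattice_mul (γ : latticeΓ) :
    MeasurePreserving (fun h : SE2 => (γ : SE2) * h) haar haar := by
  obtain ⟨_, i, j, rfl⟩ := γ
  have e : MeasurePreserving measurableEquivProd haar
      (ENNReal.ofReal (1 / (4 * Real.pi ^ 2)) • (volume : Measure (ℝ × ℝ × Ang))) := by
    refine ⟨measurableEquivProd.measurable, ?_⟩
    rw [haar, Measure.map_smul, measurableEquivProd.map_map_symm]
  have t : MeasurePreserving (fun q : ℝ × ℝ × Ang => ((i : ℝ) + q.1, (j : ℝ) + q.2.1, q.2.2))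
      (ENNReal.ofReal (1 / (4 * Real.pi ^ 2)) • (volume : Measure (ℝ × ℝ × Ang)))
      (ENNReal.ofReal (1 / (4 * Real.pi ^ 2)) • (volume : Measure (ℝ × ℝ × Ang))) :=
    ((measurePreserving_add_left volume (i : ℝ)).prod
      ((measurePreserving_add_left volume (j : ℝ)).prod
        (MeasurePreserving.id (volume : Measure Ang)))).smul_measure _
  have h := (e.symm measurableEquivProd).comp (t.comp e)
  convert h using 1
  funext g
  simp [mul_def, cos_zero', sin_zero', measurableEquivProd, equivProd]

/-- The periodization `f̃(Γ g) = ∑_{γ ∈ Γ} f(γ ∘ g)`. -/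
def periodization {E : Type*} [AddCommMonoid E] [TopologicalSpace E] (f : SE2 → E) :
    CosetSpace → E :=
  Quotient.lift (fun g => ∑' γ : latticeΓ, f ((γ : SE2) * g)) (by
    intro a b hab
    have hab' : b * a⁻¹ ∈ latticeΓ := QuotientGroup.rightRel_apply.mp hab
    rw [← (Equiv.mulRight (⟨b * a⁻¹, hab'⟩ : latticeΓ)).tsum_eq]
    simp [mul_assoc])

/-- The convolution `(ψ ⊘ f)(Γ g) = ∫ ψ(Γ h) f(h⁻¹ ∘ g) dh`. -/
def cosetConv (ψ : CosetSpace → ℂ) (f : SE2 → ℂ) : CosetSpace → ℂ :=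
  Quotient.lift (fun g => ∫ h, ψ (coset h) * f (h⁻¹ * g) ∂haar) (by
    intro a b hab
    have hab' : b * a⁻¹ ∈ latticeΓ := QuotientGroup.rightRel_apply.mp hab
    have hm := measurePreserving_lattice_mul ⟨b * a⁻¹, hab'⟩
    have hme : MeasurableEmbedding (fun h : SE2 => (b * a⁻¹) * h) := by
      have h1 : Measurable (fun h : SE2 => (b * a⁻¹) * h) := hm.measurable
      have h2 : Measurable (fun h : SE2 => (b * a⁻¹)⁻¹ * h) :=
        (measurePreserving_lattice_mul ⟨(b * a⁻¹)⁻¹, inv_mem hab'⟩).measurable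
      exact (MeasurableEquiv.mk (Equiv.mulLeft (b * a⁻¹)) h1 h2).measurableEmbedding
    have key := hm.integral_comp hme (fun h => ψ (coset h) * f (h⁻¹ * b))
    refine Eq.trans ?_ key
    refine integral_congr_ae (Eventually.of_forall fun h => ?_)
    have hc : coset (b * a⁻¹ * h) = coset h := by
      refine Quotient.sound ?_
      refine QuotientGroup.rightRel_apply.mpr ?_
      have h1 := inv_mem hab'
      simpa [mul_assoc] using h1
    have hg : (b * a⁻¹ * h)⁻¹ * b = h⁻¹ * a := by group
    simp only [hc, hg])

/-! ### The irreducible representations and the Fourier transform -/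

/-- `L²(𝕊¹)`, with inner product `(2π)⁻¹ ∫ u(β) conj(v(β)) dβ`. -/
abbrev L2Circle : Type := Lp ℂ 2 (AddCircle.haarAddCircle : Measure Ang)

/-- The orthonormal basis functions `e_k(u_β) = e^{ikβ}`. -/
abbrev e (k : ℤ) : L2Circle := fourierLp 2 k

/-- `e^{-ip⟨u_β, t⟩}`, where `t` is the translation part of `g`. -/
def phase (p : ℝ) (g : SE2) (β : Ang) : ℂ :=
  Complex.exp (-(Complex.I * p *
    ((Real.Angle.cos β * g.x + Real.Angle.sin β * g.y : ℝ) : ℂ)))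

theorem norm_phase (p : ℝ) (g : SE2) (β : Ang) : ‖phase p g β‖ = 1 := by
  rw [phase, Complex.norm_exp]
  simp

theorem continuous_phase (p : ℝ) (g : SE2) : Continuous (phase p g) := by
  have hc : Continuous (fun β : Ang => Real.Angle.cos β) := Real.Angle.continuous_cos
  have hs : Continuous (fun β : Ang => Real.Angle.sin β) := Real.Angle.continuous_sin
  unfold phase
  fun_prop

theorem memLp_U (p : ℝ) (g : SE2) (φ : L2Circle) :
    MemLp (fun β : Ang => phase p g β * φ (β - g.θ)) 2 AddCircle.haarAddCircle := by
  have h : MemLp (fun β : Ang => φ (β - g.θ)) 2 AddCircle.haarAddCircle :=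
    (Lp.memLp φ).comp_measurePreserving
      (measurePreserving_sub_right AddCircle.haarAddCircle g.θ)
  refine h.of_le ((continuous_phase p g).aestronglyMeasurable.mul h.1) ?_
  refine Eventually.of_forall fun β => ?_
  simp [norm_phase]

/-- The representation operator `[U_p(g) φ](u) = e^{-ip⟨u, t⟩} φ(R_θᵀ u)`, `g = (t, R_θ)`,
on `L²(𝕊¹)`. In the angular coordinate, `R_θᵀ u_β = u_{β - θ}`. -/
def U (p : ℝ) (g : SE2) (φ : L2Circle) : L2Circle := (memLp_U p g φ).toLp _

/-- The operator `f̂(p) = ∫ f(g) U_p(g⁻¹) dg` on `L²(𝕊¹)`, as a strong integral. -/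
def fourierOp (f : SE2 → ℂ) (p : ℝ) (φ : L2Circle) : L2Circle :=
  ∫ g, f g • U p g⁻¹ φ ∂haar

/-- The matrix elements `f̂(p)_{nm} = ⟨f̂(p) e_n, e_m⟩` (Mathlib's inner product is linear in
the second argument). -/
def fourierCoef (f : SE2 → ℂ) (p : ℝ) (n m : ℤ) : ℂ :=
  inner ℂ (e m) (fourierOp f p (e n))

/-- The character `χ_n(g) = e^{inθ}`. -/
def χ (n : ℤ) (g : SE2) : ℂ := fourier n g.θ

/-- `f̂[n] = ∫ f(g) conj(χ_n(g)) dg`. -/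
def charCoef (f : SE2 → ℂ) (n : ℤ) : ℂ :=
  ∫ g, f g * (starRingEnd ℂ) (χ n g) ∂haar

/-! ### Lattice radii and the kernels `K_ρ^q` -/

/-- `ρ(i, j) = √(i² + j²)`. -/
def radius (i j : ℤ) : ℝ := Real.sqrt ((i : ℝ) ^ 2 + (j : ℝ) ^ 2)

/-- The polar angle `Φ(i, j) ∈ [0, 2π)` of `(i, j)`. -/
def polarAngle (i j : ℤ) : ℝ :=
  toIcoMod Real.two_pi_pos 0 (Complex.arg ((i : ℂ) + (j : ℂ) * Complex.I))

/-- The nonzero lattice radii. -/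
abbrev PosRadius : Type := {ρ : ℝ // 0 < ρ ∧ ∃ i j : ℤ, ρ = radius i j}

/-- `Θ_r = {Φ(i, j) : r = ρ(i, j), i, j ∈ ℤ}`. -/
def anglesAt (r : ℝ) : Set ℝ := {θ | ∃ i j : ℤ, r = radius i j ∧ θ = polarAngle i j}

theorem anglesAt_finite (r : ℝ) : (anglesAt r).Finite := by
  have hfin : (Set.Icc (-⌈r⌉) ⌈r⌉ ×ˢ Set.Icc (-⌈r⌉) ⌈r⌉ : Set (ℤ × ℤ)).Finite :=
    (Set.finite_Icc _ _).prod (Set.finite_Icc _ _)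
  refine (hfin.image fun q : ℤ × ℤ => polarAngle q.1 q.2).subset ?_
  rintro θ ⟨i, j, hr, rfl⟩
  have hi : |(i : ℝ)| ≤ r := by
    rw [hr, radius]; exact Real.abs_le_sqrt (by nlinarith [sq_nonneg (j : ℝ)])
  have hj : |(j : ℝ)| ≤ r := by
    rw [hr, radius]; exact Real.abs_le_sqrt (by nlinarith [sq_nonneg (i : ℝ)])
  have bd : ∀ k : ℤ, |(k : ℝ)| ≤ r → k ∈ Set.Icc (-⌈r⌉) ⌈r⌉ := by
    intro k hk
    have h := abs_le.mp (hk.trans (Int.le_ceil r))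
    exact ⟨by exact_mod_cast h.1, by exact_mod_cast h.2⟩
  exact ⟨(i, j), ⟨bd i hi, bd j hj⟩, rfl⟩

/-- `K_ρ^q(a, φ) = ∑_{θ ∈ Θ_ρ} e^{2πiaρ cos(φ - θ)} e^{iqθ}`. -/
def kernelK (ρ : ℝ) (q : ℤ) (a φ : ℝ) : ℂ :=
  ∑ θ ∈ (anglesAt_finite ρ).toFinset,
    Complex.exp (2 * Real.pi * Complex.I * a * ρ * Real.cos (φ - θ)) *
      Complex.exp (Complex.I * q * θ)

/-- `F` is a family of square-integrable functions whose series converges unconditionally to the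
square-integrable function `S` in `L²(μ)`. -/
def HasSumL2 {X ι : Type*} [MeasurableSpace X] (μ : Measure X) (F : ι → X → ℂ) (S : X → ℂ) :
    Prop :=
  MemLp S 2 μ ∧ (∀ i, MemLp (F i) 2 μ) ∧
    Tendsto (fun s : Finset ι => eLpNorm (fun q => (∑ i ∈ s, F i q) - S q) 2 μ) atTop (𝓝 0)

end SE2

end

noncomputable section

/-! ### Oscillatory integrals -/

namespace Oscillatory

/-! The convolution F of the periodization of f₁ with f₂ lies in L² of the quotient, by Young's
inequality for an L² function and an L¹ function. As a measure space the quotient is a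
three-dimensional torus of total mass 1/(2π), so F has an unconditionally convergent Fourier series
in the lattice characters χ(g) = e^{2πi(ix+jy)} e^{ilθ}. Unfolding over the lattice and
right-translation invariance identify its coefficients with ∬ f₁(g) f₂(u) conj χ(gu) dg du
(`setIntegral_cosetConv_latticeChar`, `exists_hasSumL2`). Characters with i = j = 0 are
multiplicative and give the first series. The others are grouped by their radius and angular
frequency into the terms of the second.

It remains to express a coefficient through matrix elements. Up to the factor e^{ikθ}, the conjugate
of χ at g is the value of a plane wave on the circle at the angle opposite to (i, j), which is the
source of the sign (-1)^{k-n}. The Fourier coefficients of this wave are, up to the same factor, the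
matrix elements of U_p(g⁻¹) with p = 2πρ. Their multiplicativity in g, an instance of Parseval,
turns the integral of one matrix element at gu into the series over m (`hasSum_fourierCoef_mul`).

The delicate point is to exchange the sum over n with the integral. For fixed g the Fourier series
of the plane wave converges, but f₁ and f₂ are merely integrable, so a bound uniform in the
translation part of g is required. The symmetric windows |n| ≤ N, shifted by k, have partial sums
bounded by an absolute constant, uniformly in amplitude, k, N and the point
(`norm_planeWaveSum_le`). Dominated convergence then applies (`tendsto_sum_fourierCoef`). The
uniform bound is an oscillatory integral estimate: after folding the Dirichlet kernel, k and N enter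
only through a linear frequency, which second and third derivatives of the phase do not see, and van
der Corput's lemma handles the remaining phase A cos s + B sin s. -/

/-- A continuous function on `[a, b]` crosses the level `v` at a point of `[a, b]`, up to the
endpoints. -/
theorem exists_crossing {g : ℝ → ℝ} {a b : ℝ} (hab : a ≤ b) (hg : ContinuousOn g (Set.Icc a b))
    (v : ℝ) : ∃ c ∈ Set.Icc a b, (c = a ∨ g c ≤ v) ∧ (c = b ∨ v ≤ g c) := by
  by_cases ha : v ≤ g a
  · exact ⟨a, ⟨le_rfl, hab⟩, Or.inl rfl, Or.inr ha⟩
  by_cases hb : g b ≤ v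
  · exact ⟨b, ⟨hab, le_rfl⟩, Or.inr hb, Or.inl rfl⟩
  push Not at ha hb
  obtain ⟨c, hc, h⟩ := intermediate_value_Icc hab hg ⟨ha.le, hb.le⟩
  exact ⟨c, hc, Or.inr h.le, Or.inr h.ge⟩

/-- Removing from `[a, b]` the set where `|g| < δ`, when `g' ≥ λ`. -/
theorem norm_integral_le_of_le_deriv {F : ℝ → ℂ} {g g' : ℝ → ℝ} {a b δ l K : ℝ} (hab : a ≤ b)
    (hF : Continuous F) (hF1 : ∀ s, ‖F s‖ ≤ 1) (hg : ∀ s, HasDerivAt g (g' s) s)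
    (hl : 0 < l) (hδ : 0 < δ) (hg' : ∀ s ∈ Set.Icc a b, l ≤ g' s) (hK : 0 ≤ K)
    (H : ∀ c d, a ≤ c → c ≤ d → d ≤ b → (∀ s ∈ Set.Icc c d, δ ≤ |g s|) →
      ‖∫ s in c..d, F s‖ ≤ K) :
    ‖∫ s in a..b, F s‖ ≤ 2 * δ / l + 2 * K := by
  have hgc : Continuous g := continuous_iff_continuousAt.mpr fun s => (hg s).continuousAt
  have hinc : ∀ c d, a ≤ c → c ≤ d → d ≤ b → l * (d - c) ≤ g d - g c := by
    intro c d hac hcd hdb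
    refine (convex_Icc a b).mul_sub_le_image_sub_of_le_deriv hgc.continuousOn
      (fun s _ => (hg s).differentiableAt.differentiableWithinAt) ?_ c ⟨hac, hcd.trans hdb⟩ d
      ⟨hac.trans hcd, hdb⟩ hcd
    intro s hs
    rw [(hg s).deriv]
    exact hg' s (interior_subset hs)
  -- The points c and d are the crossings of the levels -δ and δ, clamped to the endpoints. Since g
  -- grows at rate at least l, the middle piece has length at most 2δ/l and |g| ≥ δ on the two outer
  -- pieces.
  obtain ⟨c, ⟨hac, hcb⟩, hc1, hc2⟩ := exists_crossing hab hgc.continuousOn (-δ)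
  obtain ⟨d, ⟨hcd, hdb⟩, hd1, hd2⟩ := exists_crossing hcb hgc.continuousOn δ
  have hlen : d - c ≤ 2 * δ / l := by
    rcases hd1 with rfl | hd1
    · rw [sub_self]; positivity
    rcases hc2 with rfl | hc2
    · rw [le_antisymm hdb hcd, sub_self]; positivity
    rw [le_div_iff₀ hl]
    have := hinc c d hac hcd hdb
    nlinarith
  have hi : ∀ x y, IntervalIntegrable F volume x y := fun x y => hF.intervalIntegrable x y
  have h1 : ‖∫ s in a..c, F s‖ ≤ K := by
    rcases hc1 with rfl | hc1
    · simpa using hK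
    refine H a c le_rfl hac hcb fun s hs => ?_
    have := hinc s c hs.1 hs.2 hcb
    have : g s ≤ -δ := by nlinarith [mul_nonneg hl.le (sub_nonneg.mpr hs.2)]
    rw [abs_of_nonpos (by linarith)]; linarith
  have h2 : ‖∫ s in d..b, F s‖ ≤ K := by
    rcases hd2 with rfl | hd2
    · simpa using hK
    refine H d b (hac.trans hcd) hdb le_rfl fun s hs => ?_
    have := hinc d s (hac.trans hcd) hs.1 hs.2
    have : δ ≤ g s := by nlinarith [mul_nonneg hl.le (sub_nonneg.mpr hs.1)]
    exact this.trans (le_abs_self _)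
  have h3 : ‖∫ s in c..d, F s‖ ≤ d - c := by
    have := intervalIntegral.norm_integral_le_of_norm_le_const (a := c) (b := d)
      (fun s _ => hF1 s)
    rwa [one_mul, abs_of_nonneg (sub_nonneg.mpr hcd)] at this
  rw [← intervalIntegral.integral_add_adjacent_intervals (hi a c) (hi c b),
    ← intervalIntegral.integral_add_adjacent_intervals (hi c d) (hi d b)]
  have := norm_add_le (∫ s in a..c, F s) ((∫ s in c..d, F s) + ∫ s in d..b, F s)
  have := norm_add_le (∫ s in c..d, F s) (∫ s in d..b, F s)
  linarith

/-- Removing from `[a, b]` the set where `|g| < δ`, when `|g'| ≥ λ`. -/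
theorem norm_integral_le_of_le_abs_deriv {F : ℝ → ℂ} {g g' : ℝ → ℝ} {a b δ l K : ℝ}
    (hab : a ≤ b) (hF : Continuous F) (hF1 : ∀ s, ‖F s‖ ≤ 1)
    (hg : ∀ s, HasDerivAt g (g' s) s) (hg'c : Continuous g')
    (hl : 0 < l) (hδ : 0 < δ) (hg' : ∀ s ∈ Set.Icc a b, l ≤ |g' s|) (hK : 0 ≤ K)
    (H : ∀ c d, a ≤ c → c ≤ d → d ≤ b → (∀ s ∈ Set.Icc c d, δ ≤ |g s|) →
      ‖∫ s in c..d, F s‖ ≤ K) :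
    ‖∫ s in a..b, F s‖ ≤ 2 * δ / l + 2 * K := by
  have hs : (∀ s ∈ Set.Icc a b, l ≤ g' s) ∨ (∀ s ∈ Set.Icc a b, l ≤ -g' s) := by
    by_contra! hcon
    obtain ⟨⟨s, hs, h1⟩, ⟨t, ht, h2⟩⟩ := hcon
    have hs' := hg' s hs
    have ht' := hg' t ht
    have hsn : g' s ≤ 0 := by
      by_contra! h; rw [abs_of_pos h] at hs'; linarith
    have htn : 0 ≤ g' t := by
      by_contra! h; rw [abs_of_neg h] at ht'; linarith
    obtain ⟨z, hz, hz0⟩ := isPreconnected_Icc.intermediate_value hs ht hg'c.continuousOn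
      ⟨hsn, htn⟩
    have := hg' z hz
    rw [hz0, abs_zero] at this
    linarith
  rcases hs with h | h
  · exact norm_integral_le_of_le_deriv hab hF hF1 hg hl hδ h hK H
  · refine norm_integral_le_of_le_deriv (g := fun s => -g s) hab hF hF1 (fun s => (hg s).neg) hl
      hδ h hK ?_
    simpa only [abs_neg] using H

/-- The integrand `e^{iφ}`. -/
def osc (φ : ℝ → ℝ) (s : ℝ) : ℂ := Complex.exp (Complex.I * φ s)

theorem norm_osc (φ : ℝ → ℝ) (s : ℝ) : ‖osc φ s‖ = 1 := by
  rw [osc, mul_comm, Complex.norm_exp_ofReal_mul_I]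

theorem continuous_osc {φ : ℝ → ℝ} (h : Continuous φ) : Continuous (osc φ) := by
  unfold osc; fun_prop

/-- Van der Corput's lemma for the first derivative. -/
theorem norm_integral_osc_le_of_deriv {φ φ' φ'' : ℝ → ℝ} (h1 : ∀ s, HasDerivAt φ (φ' s) s)
    (h2 : ∀ s, HasDerivAt φ' (φ'' s) s) (h2c : Continuous φ'') {a b c : ℝ} (hab : a ≤ b)
    (hc : 0 < c) (hφ' : ∀ s ∈ Set.Icc a b, 1 / c ≤ |φ' s|)
    (hφ'' : (∀ s ∈ Set.Icc a b, 0 ≤ φ'' s) ∨ (∀ s ∈ Set.Icc a b, φ'' s ≤ 0)) :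
    ‖∫ s in a..b, osc φ s‖ ≤ 4 * c := by
  have hc' : 0 < 1 / c := by positivity
  have hne : ∀ s ∈ Set.Icc a b, φ' s ≠ 0 := fun s hs h => by
    have := hφ' s hs
    rw [h, abs_zero] at this
    linarith
  have hinv : ∀ s ∈ Set.Icc a b, |(φ' s)⁻¹| ≤ c := fun s hs => by
    rw [abs_inv]
    have := inv_anti₀ hc' (hφ' s hs)
    simpa using this
  have hφ1 : Continuous φ := continuous_iff_continuousAt.mpr fun s => (h1 s).continuousAt
  have hφ2 : Continuous φ' := continuous_iff_continuousAt.mpr fun s => (h2 s).continuousAt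
  have hu : Set.uIcc a b = Set.Icc a b := Set.uIcc_of_le hab
  set D : ℝ → ℝ := fun s => -φ'' s / φ' s ^ 2 with hD
  have hDd : ∀ s ∈ Set.Icc a b, HasDerivAt (fun s => (φ' s)⁻¹) (D s) s := fun s hs =>
    (h2 s).inv (hne s hs)
  have hDc : ContinuousOn D (Set.Icc a b) :=
    h2c.neg.continuousOn.div (hφ2.pow 2).continuousOn fun s hs => pow_ne_zero 2 (hne s hs)
  have hDi : IntervalIntegrable D volume a b :=
    ContinuousOn.intervalIntegrable (by rwa [hu])
  have hDint : ∫ s in a..b, D s = (φ' b)⁻¹ - (φ' a)⁻¹ :=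
    intervalIntegral.integral_eq_sub_of_hasDerivAt (fun s hs => hDd s (hu ▸ hs)) hDi
  -- As φ'' keeps its sign, 1/φ' is monotone, so its total variation is the difference of its
  -- endpoint values, each at most c in modulus.
  have hDabs : ∫ s in a..b, |D s| ≤ 2 * c := by
    have ha := hinv a ⟨le_rfl, hab⟩
    have hb := hinv b ⟨hab, le_rfl⟩
    rw [abs_le] at ha hb
    rcases hφ'' with h | h
    · have : ∫ s in a..b, |D s| = ∫ s in a..b, -D s :=
        intervalIntegral.integral_congr fun s hs => by
          rw [hu] at hs
          refine abs_of_nonpos ?_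
          exact div_nonpos_of_nonpos_of_nonneg (neg_nonpos.mpr (h s hs)) (sq_nonneg _)
      rw [this, intervalIntegral.integral_neg, hDint]
      linarith
    · have : ∫ s in a..b, |D s| = ∫ s in a..b, D s :=
        intervalIntegral.integral_congr fun s hs => by
          rw [hu] at hs
          refine abs_of_nonneg ?_
          exact div_nonneg (neg_nonneg.mpr (h s hs)) (sq_nonneg _)
      rw [this, hDint]
      linarith
  -- integrate by parts
  set u : ℝ → ℂ := fun s => ((φ' s)⁻¹ : ℝ) with hudef
  have hud : ∀ s ∈ Set.uIcc a b, HasDerivAt u ((D s : ℝ) : ℂ) s := fun s hs =>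
    (hDd s (hu ▸ hs)).ofReal_comp
  have hv : ∀ s ∈ Set.uIcc a b, HasDerivAt (osc φ) (Complex.I * φ' s * osc φ s) s := fun s _ => by
    have := ((h1 s).ofReal_comp.const_mul Complex.I).cexp
    exact this.congr_deriv (mul_comm _ _)
  have hui : IntervalIntegrable (fun s => ((D s : ℝ) : ℂ)) volume a b :=
    ContinuousOn.intervalIntegrable (by
      rw [hu]; exact Complex.continuous_ofReal.comp_continuousOn hDc)
  have hoc := continuous_osc hφ1
  have hvi : IntervalIntegrable (fun s => Complex.I * φ' s * osc φ s) volume a b := by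
    apply Continuous.intervalIntegrable
    fun_prop
  have key := intervalIntegral.integral_mul_deriv_eq_deriv_mul hud hv hui hvi
  have hlhs : ∫ s in a..b, u s * (Complex.I * φ' s * osc φ s)
      = Complex.I * ∫ s in a..b, osc φ s := by
    rw [← intervalIntegral.integral_const_mul]
    refine intervalIntegral.integral_congr fun s hs => ?_
    have h0 : (φ' s : ℂ) ≠ 0 := by exact_mod_cast hne s (hu ▸ hs)
    simp only [hudef, Complex.ofReal_inv]
    field_simp
  have hnorm : ‖∫ s in a..b, osc φ s‖ = ‖Complex.I * ∫ s in a..b, osc φ s‖ := by simp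
  rw [hnorm, ← hlhs, key]
  have hu_le : ∀ s ∈ Set.Icc a b, ‖u s * osc φ s‖ ≤ c := fun s hs => by
    rw [norm_mul, norm_osc, mul_one, hudef, Complex.norm_real]
    exact hinv s hs
  have hI : ‖∫ s in a..b, (D s : ℂ) * osc φ s‖ ≤ 2 * c := by
    refine (intervalIntegral.norm_integral_le_integral_norm hab).trans (le_trans (le_of_eq ?_) hDabs)
    refine intervalIntegral.integral_congr fun s _ => ?_
    simp only [norm_mul, norm_osc, mul_one, Complex.norm_real, Real.norm_eq_abs]
  have e1 := hu_le b ⟨hab, le_rfl⟩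
  have e2 := hu_le a ⟨le_rfl, hab⟩
  calc _ ≤ ‖u b * osc φ b‖ + ‖u a * osc φ a‖ + ‖∫ s in a..b, (D s : ℂ) * osc φ s‖ :=
        (norm_sub_le _ _).trans (add_le_add_left (norm_sub_le _ _) _)
    _ ≤ 4 * c := by linarith

/-- Van der Corput's lemma for the second derivative. -/
theorem norm_integral_osc_le_of_deriv2 {φ φ' φ'' : ℝ → ℝ} (h1 : ∀ s, HasDerivAt φ (φ' s) s)
    (h2 : ∀ s, HasDerivAt φ' (φ'' s) s) (h2c : Continuous φ'') {a b c : ℝ} (hab : a ≤ b)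
    (hc : 0 < c) (hφ'' : ∀ s ∈ Set.Icc a b, 1 / c ^ 2 ≤ |φ'' s|) :
    ‖∫ s in a..b, osc φ s‖ ≤ 10 * c := by
  have hφ1 : Continuous φ := continuous_iff_continuousAt.mpr fun s => (h1 s).continuousAt
  have hc2 : 0 < 1 / c ^ 2 := by positivity
  have hsign : (∀ s ∈ Set.Icc a b, 0 ≤ φ'' s) ∨ (∀ s ∈ Set.Icc a b, φ'' s ≤ 0) := by
    by_contra! hcon
    obtain ⟨⟨s, hs, hs0⟩, ⟨t, ht, ht0⟩⟩ := hcon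
    obtain ⟨z, hz, hz0⟩ := isPreconnected_Icc.intermediate_value hs ht h2c.continuousOn
      ⟨hs0.le, ht0.le⟩
    have := hφ'' z hz
    rw [hz0, abs_zero] at this
    linarith
  -- Removing the set where |φ'| < 1/c costs 2c, and each of the two remaining pieces costs 4c by
  -- the first-derivative bound.
  have := norm_integral_le_of_le_abs_deriv (δ := 1 / c) (K := 4 * c) hab (continuous_osc hφ1)
    (fun s => (norm_osc φ s).le) h2 h2c hc2 (by positivity) hφ'' (by positivity)
    (fun x y hx hxy hy h => norm_integral_osc_le_of_deriv h1 h2 h2c hxy hc h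
      (hsign.imp (fun H s hs => H s ⟨hx.trans hs.1, hs.2.trans hy⟩)
        (fun H s hs => H s ⟨hx.trans hs.1, hs.2.trans hy⟩)))
  have e : 2 * (1 / c) / (1 / c ^ 2) + 2 * (4 * c) = 10 * c := by field_simp; norm_num
  rwa [e] at this

/-- Van der Corput's lemma for the third derivative. -/
theorem norm_integral_osc_le_of_deriv3 {φ φ' φ'' φ''' : ℝ → ℝ}
    (h1 : ∀ s, HasDerivAt φ (φ' s) s) (h2 : ∀ s, HasDerivAt φ' (φ'' s) s)
    (h3 : ∀ s, HasDerivAt φ'' (φ''' s) s) (h3c : Continuous φ''') {a b c : ℝ} (hab : a ≤ b)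
    (hc : 0 < c) (hφ''' : ∀ s ∈ Set.Icc a b, 1 / (2 * c ^ 3) ≤ |φ''' s|) :
    ‖∫ s in a..b, osc φ s‖ ≤ 24 * c := by
  have hφ1 : Continuous φ := continuous_iff_continuousAt.mpr fun s => (h1 s).continuousAt
  have h2c : Continuous φ'' := continuous_iff_continuousAt.mpr fun s => (h3 s).continuousAt
  -- The threshold 1/c² for φ'' makes the removed set cost 4c, and the second-derivative bound gives
  -- 10c on each remaining piece.
  have := norm_integral_le_of_le_abs_deriv (δ := 1 / c ^ 2) (K := 10 * c) hab
    (continuous_osc hφ1) (fun s => (norm_osc φ s).le) h3 h3c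
    (by positivity : 0 < 1 / (2 * c ^ 3)) (by positivity) hφ''' (by positivity)
    (fun x y _ hxy _ h => norm_integral_osc_le_of_deriv2 h1 h2 h2c hxy hc h)
  have e : 2 * (1 / c ^ 2) / (1 / (2 * c ^ 3)) + 2 * (10 * c) = 24 * c := by field_simp; norm_num
  rwa [e] at this

/-- The weight `1 / s` on `[a, b]` costs a factor `1 / a`. -/
theorem norm_integral_div_le {F : ℝ → ℂ} (hF : Continuous F) {a b K : ℝ} (ha : 0 < a)
    (hab : a ≤ b) (H : ∀ d ∈ Set.Icc a b, ‖∫ s in a..d, F s‖ ≤ K) :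
    ‖∫ s in a..b, F s / s‖ ≤ K / a := by
  have hb : 0 < b := ha.trans_le hab
  have hu : Set.uIcc a b = Set.Icc a b := Set.uIcc_of_le hab
  have hpos : ∀ s ∈ Set.Icc a b, 0 < s := fun s hs => ha.trans_le hs.1
  -- Integration by parts against the primitive vanishing at a: the boundary term costs K/b and the
  -- variation of 1/s costs K(1/a - 1/b), which add up to K/a.
  set G : ℝ → ℂ := fun d => ∫ s in a..d, F s with hG
  have hGd : ∀ s ∈ Set.uIcc a b, HasDerivAt G (F s) s := fun s _ =>
    intervalIntegral.integral_hasDerivAt_right (hF.intervalIntegrable _ _)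
      hF.aestronglyMeasurable.stronglyMeasurableAtFilter hF.continuousAt
  have hGc : Continuous G := intervalIntegral.continuous_primitive hF.intervalIntegrable a
  have hwr : ∀ s ∈ Set.uIcc a b, HasDerivAt (fun s : ℝ => s⁻¹) (-(s ^ 2)⁻¹) s := fun s hs =>
    hasDerivAt_inv (hpos s (hu ▸ hs)).ne'
  have hwd : ∀ s ∈ Set.uIcc a b,
      HasDerivAt (fun s : ℝ => ((s⁻¹ : ℝ) : ℂ)) ((-(s ^ 2)⁻¹ : ℝ) : ℂ) s := fun s hs =>
    (hwr s hs).ofReal_comp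
  have hwc : ContinuousOn (fun s : ℝ => -(s ^ 2)⁻¹) (Set.uIcc a b) := by
    rw [hu]
    exact ((continuous_pow 2).continuousOn.inv₀
      fun s hs => pow_ne_zero 2 (hpos s hs).ne').neg
  have hwi : IntervalIntegrable (fun s : ℝ => -(s ^ 2)⁻¹) volume a b := hwc.intervalIntegrable
  have hwi' : IntervalIntegrable (fun s : ℝ => ((-(s ^ 2)⁻¹ : ℝ) : ℂ)) volume a b :=
    (Complex.continuous_ofReal.comp_continuousOn hwc).intervalIntegrable
  have key := intervalIntegral.integral_mul_deriv_eq_deriv_mul hwd hGd hwi'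
    (hF.intervalIntegrable a b)
  have e0 : ∫ s in a..b, F s / s = ∫ s in a..b, ((s⁻¹ : ℝ) : ℂ) * F s := by
    refine intervalIntegral.integral_congr fun s _ => ?_
    simp only [Complex.ofReal_inv]
    rw [div_eq_inv_mul]
  have hGa : G a = 0 := by simp [hG]
  rw [e0, key, hGa, mul_zero, sub_zero]
  have hKi : ∫ s in a..b, K * (s ^ 2)⁻¹ = K * (a⁻¹ - b⁻¹) := by
    have := intervalIntegral.integral_eq_sub_of_hasDerivAt hwr hwi
    rw [intervalIntegral.integral_neg] at this
    rw [intervalIntegral.integral_const_mul]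
    congr 1
    linarith
  have hint : ‖∫ s in a..b, ((-(s ^ 2)⁻¹ : ℝ) : ℂ) * G s‖ ≤ K * (a⁻¹ - b⁻¹) := by
    rw [← hKi]
    refine intervalIntegral.norm_integral_le_of_norm_le hab ?_ ?_
    · refine Eventually.of_forall fun s hs => ?_
      have hs' : s ∈ Set.Icc a b := ⟨hs.1.le, hs.2⟩
      have hn : (0 : ℝ) ≤ (s ^ 2)⁻¹ := by positivity
      rw [norm_mul, Complex.norm_real, norm_neg, Real.norm_of_nonneg hn, mul_comm]
      exact mul_le_mul_of_nonneg_right (H s hs') hn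
    · have := hwi.neg.const_mul K
      simpa using this
  have hb1 : ‖((b⁻¹ : ℝ) : ℂ) * G b‖ ≤ b⁻¹ * K := by
    rw [norm_mul, Complex.norm_real, Real.norm_of_nonneg (by positivity)]
    exact mul_le_mul_of_nonneg_left (H b ⟨hab, le_rfl⟩) (by positivity)
  calc _ ≤ b⁻¹ * K + K * (a⁻¹ - b⁻¹) := (norm_sub_le _ _).trans (add_le_add hb1 hint)
    _ = K / a := by ring

end Oscillatory


/-! ### Uniform bounds for oscillatory integrals with the weight ds/s -/

namespace Oscillatory

theorem intervalIntegrable_div {F : ℝ → ℂ} (hF : Continuous F) {a b : ℝ} (ha : 0 < a)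
    (hab : a ≤ b) : IntervalIntegrable (fun s : ℝ => F s / s) volume a b := by
  apply ContinuousOn.intervalIntegrable
  rw [Set.uIcc_of_le hab]
  exact hF.continuousOn.div Complex.continuous_ofReal.continuousOn
    fun s hs => by exact_mod_cast (ha.trans_le hs.1).ne'

/-- The factor s in the hypothesis cancels the singular weight. This is the tool for replacing a
phase by its Taylor polynomial on a short interval. -/
theorem norm_integral_div_sub_le {F G : ℝ → ℂ} (hF : Continuous F) (hG : Continuous G)
    {a b K : ℝ} (ha : 0 < a) (hab : a ≤ b)
    (H : ∀ s ∈ Set.Icc a b, ‖F s - G s‖ ≤ K * s) :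
    ‖∫ s in a..b, F s / s‖ ≤ ‖∫ s in a..b, G s / s‖ + K * (b - a) := by
  have h1 : ∫ s in a..b, F s / s = (∫ s in a..b, G s / s) + ∫ s in a..b, (F s - G s) / s := by
    rw [← intervalIntegral.integral_add (intervalIntegrable_div hG ha hab)
      (intervalIntegrable_div (F := fun s => F s - G s) (hF.sub hG) ha hab)]
    refine intervalIntegral.integral_congr fun s _ => ?_
    ring
  have h2 : ‖∫ s in a..b, (F s - G s) / s‖ ≤ K * (b - a) := by
    have := intervalIntegral.norm_integral_le_of_norm_le_const (a := a) (b := b) (C := K)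
      (f := fun s : ℝ => (F s - G s) / s) (fun s hs => by
        rw [Set.uIoc_of_le hab] at hs
        have hs0 : 0 < s := ha.trans hs.1
        rw [norm_div, Complex.norm_real, Real.norm_of_nonneg hs0.le, div_le_iff₀ hs0]
        exact H s ⟨hs.1.le, hs.2⟩)
    rwa [abs_of_nonneg (sub_nonneg.mpr hab)] at this
  rw [h1]
  exact (norm_add_le _ _).trans (add_le_add_right h2 _)

/-- Splitting `[a, b]` at the point where `r s ^ m = 1`. -/
theorem norm_integral_le_of_split {F : ℝ → ℂ} (hF : Continuous F) {a b r K₁ K₂ : ℝ} (m : ℕ)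
    (ha : 0 < a) (hab : a ≤ b) (hK₁ : 0 ≤ K₁) (hK₂ : 0 ≤ K₂)
    (H₁ : ∀ c, a ≤ c → c ≤ b → r * c ^ m ≤ 1 → ‖∫ s in a..c, F s / s‖ ≤ K₁)
    (H₂ : ∀ c, a ≤ c → c ≤ b → 1 ≤ r * c ^ m → ‖∫ s in c..b, F s / s‖ ≤ K₂) :
    ‖∫ s in a..b, F s / s‖ ≤ K₁ + K₂ := by
  obtain ⟨c, ⟨hac, hcb⟩, h1, h2⟩ := exists_crossing hab
    (g := fun s => r * s ^ m) (by fun_prop) 1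
  have hc : 0 < c := ha.trans_le hac
  rw [← intervalIntegral.integral_add_adjacent_intervals (intervalIntegrable_div hF ha hac)
    (intervalIntegrable_div hF hc hcb)]
  refine (norm_add_le _ _).trans (add_le_add ?_ ?_)
  · rcases h1 with rfl | h1
    · simpa using hK₁
    · exact H₁ c hac hcb h1
  · rcases h2 with rfl | h2
    · simpa using hK₂
    · exact H₂ c hac hcb h2

theorem sin_eq_osc (φ : ℝ → ℝ) (s : ℝ) : ((Real.sin (φ s) : ℝ) : ℂ)
    = (osc φ s - osc (fun s => -φ s) s) / (2 * Complex.I) := by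
  have h1 : osc φ s = Complex.exp (φ s * Complex.I) := by rw [osc, mul_comm]
  have h2 : osc (fun s => -φ s) s = Complex.exp (-φ s * Complex.I) := by
    rw [osc, mul_comm]; push_cast; rfl
  rw [h1, h2, Complex.ofReal_sin, Complex.sin, eq_div_iff (by simp)]
  linear_combination (-(Complex.exp (-φ s * Complex.I)) + Complex.exp (φ s * Complex.I)) *
    (-1) * Complex.I_sq

theorem osc_mul_sin (α φ : ℝ → ℝ) (s : ℝ) : osc α s * (Real.sin (φ s) : ℝ)
    = (osc (fun s => α s + φ s) s - osc (fun s => α s - φ s) s) / (2 * Complex.I) := by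
  rw [sin_eq_osc]
  have h1 : osc (fun s => α s + φ s) s = osc α s * osc φ s := by
    simp only [osc]; rw [← Complex.exp_add]; push_cast; ring_nf
  have h2 : osc (fun s => α s - φ s) s = osc α s * osc (fun s => -φ s) s := by
    simp only [osc]; rw [← Complex.exp_add]; push_cast; ring_nf
  rw [h1, h2]
  ring

/-- `e^{iα} sin φ` is a combination of `e^{i(α ± φ)}`. -/
theorem norm_integral_osc_mul_sin_div_le {α φ : ℝ → ℝ} (hα : Continuous α) (hφ : Continuous φ)
    {a b K : ℝ} (ha : 0 < a) (hab : a ≤ b)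
    (H₁ : ∀ d ∈ Set.Icc a b, ‖∫ s in a..d, osc (fun s => α s + φ s) s‖ ≤ K * a)
    (H₂ : ∀ d ∈ Set.Icc a b, ‖∫ s in a..d, osc (fun s => α s - φ s) s‖ ≤ K * a) :
    ‖∫ s in a..b, osc α s * (Real.sin (φ s) : ℝ) / s‖ ≤ K := by
  have c1 : Continuous (osc fun s => α s + φ s) := continuous_osc (hα.add hφ)
  have c2 : Continuous (osc fun s => α s - φ s) := continuous_osc (hα.sub hφ)
  have e : ∫ s in a..b, osc α s * (Real.sin (φ s) : ℝ) / s
      = ((∫ s in a..b, osc (fun s => α s + φ s) s / s) -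
        ∫ s in a..b, osc (fun s => α s - φ s) s / s) / (2 * Complex.I) := by
    rw [← intervalIntegral.integral_sub (intervalIntegrable_div c1 ha hab)
      (intervalIntegrable_div c2 ha hab), ← intervalIntegral.integral_div]
    refine intervalIntegral.integral_congr fun s _ => ?_
    simp only [osc_mul_sin]
    ring
  have h1 := norm_integral_div_le c1 ha hab H₁
  have h2 := norm_integral_div_le c2 ha hab H₂
  rw [mul_div_cancel_right₀ _ ha.ne'] at h1 h2
  rw [e, norm_div]
  have h3 : ‖(2 * Complex.I : ℂ)‖ = 2 := by simp
  rw [h3, div_le_iff₀ two_pos]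
  exact (norm_sub_le _ _).trans (by linarith)

/-- The split is at |L| s = 1. Before it |sin(Ls)| ≤ |L| s absorbs the weight; after it the
first-derivative van der Corput bound gains the factor that the weight loses. -/
theorem norm_integral_sin_div_le (L : ℝ) {a b : ℝ} (ha : 0 < a) (hab : a ≤ b) :
    ‖∫ s in a..b, ((Real.sin (L * s) : ℝ) : ℂ) / s‖ ≤ 5 := by
  have hF : Continuous fun s : ℝ => ((Real.sin (L * s) : ℝ) : ℂ) := by fun_prop
  have := norm_integral_le_of_split hF (r := |L|) (K₁ := 1) (K₂ := 4) 1 ha hab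
    (by norm_num) (by norm_num) ?_ ?_
  · linarith
  · intro c hac hcb h
    have := norm_integral_div_sub_le (G := fun _ => 0) hF continuous_const (K := |L|) ha hac
      (fun s hs => by
        rw [sub_zero, Complex.norm_real, Real.norm_eq_abs]
        refine Real.abs_sin_le_abs.trans_eq ?_
        rw [abs_mul, abs_of_pos (ha.trans_le hs.1)])
    simp only [zero_div, intervalIntegral.integral_zero, norm_zero, zero_add] at this
    refine this.trans ?_
    nlinarith [abs_nonneg L]
  · intro c hac hcb h
    have hc := ha.trans_le hac
    rw [pow_one] at h
    have hder : ∀ L : ℝ, 1 ≤ |L| * c → ∀ d ∈ Set.Icc c b,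
        ‖∫ s in c..d, osc (fun s => L * s) s‖ ≤ 4 * c := fun L hL d hd =>
      norm_integral_osc_le_of_deriv (φ' := fun _ => L) (φ'' := fun _ => 0)
        (fun s => by simpa using (hasDerivAt_id s).const_mul L) (fun s => hasDerivAt_const s L)
        continuous_const hd.1 hc (fun s _ => by rwa [div_le_iff₀ hc])
        (Or.inl fun _ _ => le_rfl)
    have := norm_integral_osc_mul_sin_div_le (α := fun _ => 0) (φ := fun s => L * s) (K := 4)
      continuous_const (by fun_prop) hc hcb
      (fun d hd => by simpa only [zero_add] using hder L h d hd)
      (fun d hd => by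
        simpa only [zero_sub, neg_mul] using hder (-L) (by rwa [abs_neg]) d hd)
    simpa [osc] using this

theorem norm_osc_sub_le (φ ψ : ℝ → ℝ) (s : ℝ) : ‖osc φ s - osc ψ s‖ ≤ |φ s - ψ s| := by
  have e : osc φ s - osc ψ s = osc ψ s * (Complex.exp (Complex.I * ((φ s - ψ s : ℝ) : ℂ)) - 1) := by
    rw [osc, osc, mul_sub, ← Complex.exp_add, mul_one]
    push_cast
    ring_nf
  rw [e, norm_mul, norm_osc, one_mul]
  exact (Real.norm_exp_I_mul_ofReal_sub_one_le (x := φ s - ψ s))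

/-- The split is at |A| s² = 1. Before it the quadratic phase is nearly constant and the linear case
applies (5 + 1); after it the second derivative, which ignores L, gives 10. -/
theorem norm_integral_quadratic_sin_div_le (A L : ℝ) {a b : ℝ} (ha : 0 < a) (hab : a ≤ b) :
    ‖∫ s in a..b, osc (fun s => A * (1 - s ^ 2 / 2)) s * (Real.sin (L * s) : ℝ) / s‖ ≤ 16 := by
  have hα : Continuous fun s : ℝ => A * (1 - s ^ 2 / 2) := by fun_prop
  have hF : Continuous fun s : ℝ =>
      osc (fun s => A * (1 - s ^ 2 / 2)) s * ((Real.sin (L * s) : ℝ) : ℂ) :=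
    (continuous_osc hα).mul (by fun_prop)
  have := norm_integral_le_of_split hF (r := |A|) (K₁ := 6) (K₂ := 10) 2 ha hab
    (by norm_num) (by norm_num) ?_ ?_
  · linarith
  · intro c hac hcb h
    have hc := ha.trans_le hac
    have := norm_integral_div_sub_le (G := fun s => osc (fun _ => A) s *
        ((Real.sin (L * s) : ℝ) : ℂ)) hF ((continuous_osc continuous_const).mul (by fun_prop))
      (K := |A| * c) ha hac (fun s hs => by
        have hs0 := ha.trans_le hs.1
        rw [← sub_mul, norm_mul, Complex.norm_real, Real.norm_eq_abs]
        have h1 := norm_osc_sub_le (fun s => A * (1 - s ^ 2 / 2)) (fun _ => A) s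
        have h2 : |A * (1 - s ^ 2 / 2) - A| = |A| * (s ^ 2 / 2) := by
          rw [show A * (1 - s ^ 2 / 2) - A = -(A * (s ^ 2 / 2)) by ring, abs_neg, abs_mul,
            abs_of_nonneg (by positivity : (0 : ℝ) ≤ s ^ 2 / 2)]
        rw [h2] at h1
        calc _ ≤ |A| * (s ^ 2 / 2) * 1 :=
              mul_le_mul h1 (Real.abs_sin_le_one _) (abs_nonneg _) (by positivity)
          _ ≤ |A| * c * s := by
              rw [mul_one, mul_assoc]
              refine mul_le_mul_of_nonneg_left ?_ (abs_nonneg A)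
              nlinarith [hs.2])
    have h2 : ‖∫ s in a..c, osc (fun _ => A) s * ((Real.sin (L * s) : ℝ) : ℂ) / s‖ ≤ 5 := by
      have e : ∫ s in a..c, osc (fun _ => A) s * ((Real.sin (L * s) : ℝ) : ℂ) / s
          = osc (fun _ => A) 0 * ∫ s in a..c, ((Real.sin (L * s) : ℝ) : ℂ) / s := by
        rw [← intervalIntegral.integral_const_mul]
        refine intervalIntegral.integral_congr fun s _ => ?_
        simp only [osc]
        ring
      rw [e, norm_mul, norm_osc, one_mul]
      exact norm_integral_sin_div_le L ha hac
    have h3 : |A| * c * (c - a) ≤ 1 := by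
      refine le_trans ?_ h
      rw [mul_assoc]
      refine mul_le_mul_of_nonneg_left ?_ (abs_nonneg A)
      nlinarith
    linarith
  · intro c hac hcb h
    have hc := ha.trans_le hac
    have hder : ∀ L : ℝ, ∀ d ∈ Set.Icc c b,
        ‖∫ s in c..d, osc (fun s => A * (1 - s ^ 2 / 2) + L * s) s‖ ≤ 10 * c := fun L d hd =>
      norm_integral_osc_le_of_deriv2 (φ' := fun s => -A * s + L) (φ'' := fun _ => -A)
        (fun s => by
          have h1 := (((hasDerivAt_pow 2 s).div_const 2).const_sub 1).const_mul A
          refine (h1.add ((hasDerivAt_id s).const_mul L)).congr_deriv ?_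
          norm_num)
        (fun s => by simpa using ((hasDerivAt_id s).const_mul (-A)).add_const L)
        continuous_const hd.1 hc (fun s _ => by
          rw [abs_neg, div_le_iff₀ (by positivity)]; exact h)
    refine norm_integral_osc_mul_sin_div_le hα (by fun_prop) hc hcb (hder L) fun d hd => ?_
    simpa only [neg_mul, sub_eq_add_neg] using hder (-L) d hd

/-- A cubic error suffices, because the final split is made at the scale r s³ = 1. The upper bound
for the cosine comes from cos s = 1 - 2 sin²(s/2). -/
theorem abs_cos_sub_le {s : ℝ} (h0 : 0 ≤ s) (h1 : s ≤ 1) :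
    |Real.cos s - (1 - s ^ 2 / 2)| ≤ s ^ 3 := by
  have e1 := Real.one_sub_sq_div_two_le_cos (x := s)
  have e2 := Real.sin_ge_sub_cube (x := s / 2) (by positivity)
  have e3 : Real.cos s = 1 - 2 * Real.sin (s / 2) ^ 2 := by
    have := Real.cos_two_mul (s / 2)
    rw [mul_div_cancel₀ _ two_ne_zero, Real.cos_sq'] at this
    rw [this]; ring
  rw [abs_of_nonneg (by linarith), e3]
  have e4 : 0 ≤ s / 2 - (s / 2) ^ 3 / 6 := by nlinarith [pow_le_one₀ h0 h1 (n := 2)]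
  have e5 : (s / 2 - (s / 2) ^ 3 / 6) ^ 2 ≤ Real.sin (s / 2) ^ 2 := pow_le_pow_left₀ e4 e2 2
  have e6 : 0 ≤ s ^ 3 := by positivity
  have e7 : s ^ 3 * s ≤ s ^ 3 * 1 := mul_le_mul_of_nonneg_left h1 e6
  have e8 : 0 ≤ s ^ 6 := by positivity
  nlinarith

/-- With r the larger of |A| and |B|, the split is at r s³ = 1. Before it A cos s and B sin s may be
replaced by their Taylor polynomials of degree at most 2, leaving the quadratic case (16 + 2). After
it the second or third derivative of the phase is at least r/2, giving 24. Neither derivative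
contains M, hence the uniformity in M. -/
theorem norm_integral_cos_sin_div_le (A B M : ℝ) {a b : ℝ} (ha : 0 < a) (hab : a ≤ b)
    (hb : b ≤ 1 / 5) :
    ‖∫ s in a..b, osc (fun s => A * Real.cos s) s *
      (Real.sin (M * s + B * Real.sin s) : ℝ) / s‖ ≤ 42 := by
  have hα : Continuous fun s : ℝ => A * Real.cos s := by fun_prop
  have hβ : Continuous fun s : ℝ => M * s + B * Real.sin s := by fun_prop
  have hF : Continuous fun s : ℝ => osc (fun s => A * Real.cos s) s *
      ((Real.sin (M * s + B * Real.sin s) : ℝ) : ℂ) :=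
    (continuous_osc hα).mul (by fun_prop)
  set r := max |A| |B| with hr
  have hr0 : 0 ≤ r := (abs_nonneg A).trans (le_max_left _ _)
  have := norm_integral_le_of_split hF (r := r) (K₁ := 18) (K₂ := 24) 3 ha hab
    (by norm_num) (by norm_num) ?_ ?_
  · linarith
  · intro c hac hcb h
    have hc := ha.trans_le hac
    have h1 := norm_integral_div_sub_le (G := fun s => osc (fun s => A * (1 - s ^ 2 / 2)) s *
        ((Real.sin ((M + B) * s) : ℝ) : ℂ)) hF
      ((continuous_osc (by fun_prop)).mul (by fun_prop)) (K := 2 * r * c ^ 2) ha hac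
      (fun s hs => by
        have hs0 := ha.trans_le hs.1
        have e1 := norm_osc_sub_le (fun s => A * Real.cos s) (fun s => A * (1 - s ^ 2 / 2)) s
        rw [← mul_sub, abs_mul] at e1
        have e2 := abs_cos_sub_le hs0.le (by linarith [hs.2])
        have e3 : |Real.sin (M * s + B * Real.sin s) - Real.sin ((M + B) * s)|
            ≤ |B| * s ^ 3 := by
          refine (Real.abs_sin_sub_sin_le _ _).trans ?_
          rw [show M * s + B * Real.sin s - (M + B) * s = -(B * (s - Real.sin s)) by ring,
            abs_neg, abs_mul]
          refine mul_le_mul_of_nonneg_left ?_ (abs_nonneg B)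
          have := Real.abs_sub_sin_le s
          rw [abs_of_pos hs0] at this
          have : 0 < s ^ 3 := by positivity
          linarith
        have e4 : ‖osc (fun s => A * Real.cos s) s - osc (fun s => A * (1 - s ^ 2 / 2)) s‖
            ≤ r * s ^ 3 :=
          e1.trans (mul_le_mul (le_max_left _ _) e2 (abs_nonneg _) hr0)
        have e5 : |Real.sin (M * s + B * Real.sin s) - Real.sin ((M + B) * s)| ≤ r * s ^ 3 :=
          e3.trans (mul_le_mul_of_nonneg_right (le_max_right _ _) (by positivity))
        have e6 : osc (fun s => A * Real.cos s) s *
              ((Real.sin (M * s + B * Real.sin s) : ℝ) : ℂ) -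
            osc (fun s => A * (1 - s ^ 2 / 2)) s * ((Real.sin ((M + B) * s) : ℝ) : ℂ) =
            osc (fun s => A * Real.cos s) s * ((Real.sin (M * s + B * Real.sin s) -
              Real.sin ((M + B) * s) : ℝ) : ℂ) +
            (osc (fun s => A * Real.cos s) s - osc (fun s => A * (1 - s ^ 2 / 2)) s) *
              ((Real.sin ((M + B) * s) : ℝ) : ℂ) := by
          push_cast; ring
        rw [e6]
        refine (norm_add_le _ _).trans ?_
        rw [norm_mul, norm_mul, norm_osc, one_mul, Complex.norm_real, Complex.norm_real,
          Real.norm_eq_abs, Real.norm_eq_abs]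
        have e7 := mul_le_mul e4 (Real.abs_sin_le_one ((M + B) * s)) (abs_nonneg _)
          (by positivity)
        have e8 : r * s ^ 3 ≤ r * c ^ 2 * s := by
          rw [mul_assoc]
          refine mul_le_mul_of_nonneg_left ?_ hr0
          have : s ^ 2 ≤ c ^ 2 := pow_le_pow_left₀ hs0.le hs.2 2
          nlinarith
        linarith)
    have h2 := norm_integral_quadratic_sin_div_le A (M + B) ha hac
    have h3 : 2 * r * c ^ 2 * (c - a) ≤ 2 := by
      have : r * c ^ 2 * (c - a) ≤ r * c ^ 3 := by
        have : 0 ≤ r * c ^ 2 := by positivity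
        nlinarith
      linarith
    linarith
  · intro c hac hcb h
    have hc := ha.trans_le hac
    have hr' : 1 / c ^ 3 ≤ r := by rwa [div_le_iff₀ (by positivity)]
    -- This is where b ≤ 1/5 is used: the cosine dominates the sine by 1/2, so the larger of |A| and
    -- |B| controls the chosen derivative.
    have hcs : ∀ s ∈ Set.Icc c b, 1 / 2 ≤ Real.cos s - Real.sin s ∧ 0 ≤ Real.sin s ∧
        0 ≤ Real.cos s := by
      intro s hs
      have hs0 : 0 < s := hc.trans_le hs.1
      have hs5 : s ≤ 1 / 5 := hs.2.trans hb
      have h1 := Real.one_sub_sq_div_two_le_cos (x := s)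
      have h2 := Real.sin_le hs0.le
      have h3 := Real.sin_nonneg_of_nonneg_of_le_pi hs0.le (by linarith [Real.pi_gt_three])
      refine ⟨by nlinarith, h3, by nlinarith⟩
    have hder : ∀ B M : ℝ, r = max |A| |B| → ∀ d ∈ Set.Icc c b,
        ‖∫ s in c..d, osc (fun s => A * Real.cos s + (M * s + B * Real.sin s)) s‖ ≤ 24 * c := by
      intro B M hrB d hd
      have d1 : ∀ s, HasDerivAt (fun s => A * Real.cos s + (M * s + B * Real.sin s))
          (A * -Real.sin s + (M + B * Real.cos s)) s := fun s =>
        (((Real.hasDerivAt_cos s).const_mul A).add (((hasDerivAt_id s).const_mul M).add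
          ((Real.hasDerivAt_sin s).const_mul B))).congr_deriv (by simp)
      have d2 : ∀ s, HasDerivAt (fun s => A * -Real.sin s + (M + B * Real.cos s))
          (A * -Real.cos s + B * -Real.sin s) s := fun s =>
        ((Real.hasDerivAt_sin s).neg.const_mul A).add
          (((Real.hasDerivAt_cos s).const_mul B).const_add M)
      have d3 : ∀ s, HasDerivAt (fun s => A * -Real.cos s + B * -Real.sin s)
          (A * Real.sin s + B * -Real.cos s) s := fun s =>
        (((Real.hasDerivAt_cos s).neg.const_mul A).add
          ((Real.hasDerivAt_sin s).neg.const_mul B)).congr_deriv (by simp)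
      -- If |A| is the larger, A cos s dominates the second derivative; otherwise B cos s dominates
      -- the third.
      rcases le_total |B| |A| with hBA | hBA
      · refine (norm_integral_osc_le_of_deriv2 d1 d2 (by fun_prop) hd.1 hc ?_).trans
          (by linarith)
        intro s hs
        obtain ⟨h1, h2, h3⟩ := hcs s ⟨hs.1, hs.2.trans hd.2⟩
        rw [hrB, max_eq_left hBA] at hr'
        -- As c ≤ 1/5, the lower bound 1/(2c³) already exceeds 1/c².
        have e1 : 1 / c ^ 2 ≤ |A| * (1 / 2) := by
          have : 1 / c ^ 2 ≤ 1 / c ^ 3 * (1 / 2) := by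
            rw [div_mul_div_comm, one_mul, div_le_div_iff₀ (by positivity) (by positivity)]
            have : 0 < c ^ 2 := by positivity
            nlinarith [hcb.trans hb]
          linarith
        have e2 : |A| * Real.cos s - |B| * Real.sin s ≤ |A * -Real.cos s + B * -Real.sin s| := by
          have := abs_sub_abs_le_abs_sub (A * -Real.cos s) (B * Real.sin s)
          rw [abs_mul, abs_mul, abs_neg, abs_of_nonneg h2, abs_of_nonneg h3] at this
          rwa [mul_neg B, ← sub_eq_add_neg]
        nlinarith [abs_nonneg A]
      · refine norm_integral_osc_le_of_deriv3 d1 d2 d3 (by fun_prop) hd.1 hc ?_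
        intro s hs
        obtain ⟨h1, h2, h3⟩ := hcs s ⟨hs.1, hs.2.trans hd.2⟩
        rw [hrB, max_eq_right hBA] at hr'
        have e1 : 1 / (2 * c ^ 3) ≤ |B| * (1 / 2) := by
          have : 1 / (2 * c ^ 3) = 1 / c ^ 3 * (1 / 2) := by
            rw [div_mul_div_comm, one_mul, mul_comm]
          linarith
        have e2 : |B| * Real.cos s - |A| * Real.sin s ≤ |A * Real.sin s + B * -Real.cos s| := by
          have := abs_sub_abs_le_abs_sub (B * Real.cos s) (A * Real.sin s)
          rw [abs_mul, abs_mul, abs_of_nonneg h2, abs_of_nonneg h3, abs_sub_comm] at this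
          rwa [mul_neg B, ← sub_eq_add_neg]
        nlinarith [abs_nonneg B]
    refine norm_integral_osc_mul_sin_div_le hα hβ hc hcb (hder B M hr) fun d hd => ?_
    have := hder (-B) (-M) (by rw [abs_neg]) d hd
    simpa only [neg_mul, sub_eq_add_neg, neg_add] using this

end Oscillatory


/-! ### The Dirichlet kernel against a sinusoidal phase -/

namespace Oscillatory

/-- The Dirichlet kernel. -/
def dirichlet (N : ℕ) (s : ℝ) : ℂ := ∑ n ∈ Finset.Icc (-(N : ℤ)) N, Complex.exp (Complex.I * n * s)

theorem continuous_dirichlet (N : ℕ) : Continuous (dirichlet N) := by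
  unfold dirichlet; fun_prop

theorem norm_dirichlet_le (N : ℕ) (s : ℝ) : ‖dirichlet N s‖ ≤ 2 * N + 1 := by
  refine (norm_sum_le _ _).trans ?_
  have h : ∀ n : ℤ, ‖Complex.exp (Complex.I * n * s)‖ = 1 := fun n => by
    rw [show Complex.I * n * s = ((n * s : ℝ) : ℂ) * Complex.I by push_cast; ring,
      Complex.norm_exp_ofReal_mul_I]
  simp only [h, Finset.sum_const, Int.card_Icc, nsmul_eq_mul, mul_one]
  have : ((N : ℤ) + 1 - -(N : ℤ)).toNat = 2 * N + 1 := by omega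
  rw [this]; push_cast; rfl

theorem dirichlet_mul_sin (N : ℕ) (s : ℝ) :
    dirichlet N s * Complex.sin (s / 2) = Complex.sin ((N + 1 / 2) * s) := by
  induction N with
  | zero => simp [dirichlet, div_eq_inv_mul]
  | succ N ih =>
    have e : dirichlet (N + 1) s = dirichlet N s + 2 * Complex.cos ((N + 1) * s) := by
      have hset : Finset.Icc (-((N + 1 : ℕ) : ℤ)) ((N + 1 : ℕ) : ℤ) =
          insert (-((N : ℤ) + 1)) (insert ((N : ℤ) + 1) (Finset.Icc (-(N : ℤ)) N)) := by
        ext z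
        simp only [Finset.mem_insert, Finset.mem_Icc]
        push_cast
        omega
      unfold dirichlet
      rw [hset, Finset.sum_insert (by simp; omega), Finset.sum_insert (by simp), Complex.cos]
      push_cast
      ring_nf
    have e2 : Complex.sin (((N + 1 : ℕ) + 1 / 2) * s) =
        Complex.sin ((N + 1 / 2) * s) + 2 * Complex.cos ((N + 1) * s) * Complex.sin (s / 2) := by
      rw [show (((N + 1 : ℕ) : ℂ) + 1 / 2) * s = (N + 1) * s + s / 2 by push_cast; ring,
        show ((N : ℂ) + 1 / 2) * s = (N + 1) * s - s / 2 by ring, Complex.sin_add,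
        Complex.sin_sub]
      ring
    rw [e, add_mul, ih, e2]

/-- On (0, 1/5] the weight 1/sin(s/2) differs from 2/s by at most 1, so the bound 42 becomes 2·42 +
1. -/
theorem norm_integral_cos_sin_div_sin_le (A B M : ℝ) {a b : ℝ} (ha : 0 < a) (hab : a ≤ b)
    (hb : b ≤ 1 / 5) :
    ‖∫ s in a..b, osc (fun s => A * Real.cos s) s *
      (Real.sin (M * s + B * Real.sin s) : ℝ) / (Real.sin (s / 2) : ℝ)‖ ≤ 85 := by
  set F : ℝ → ℂ := fun s => osc (fun s => A * Real.cos s) s *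
      (Real.sin (M * s + B * Real.sin s) : ℝ) with hFdef
  have hF : Continuous F := (continuous_osc (by fun_prop)).mul (by fun_prop)
  have hF1 : ∀ s, ‖F s‖ ≤ 1 := fun s => by
    rw [hFdef, norm_mul, norm_osc, one_mul, Complex.norm_real]
    exact Real.abs_sin_le_one _
  have hsin : ∀ s ∈ Set.Icc a b, 0 < Real.sin (s / 2) ∧
      |(Real.sin (s / 2))⁻¹ - 2 * s⁻¹| ≤ 1 := by
    intro s hs
    have h0 : 0 < s := ha.trans_le hs.1
    have h1 := Real.sin_ge_sub_cube (x := s / 2) (by positivity)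
    have h2 := Real.sin_le (x := s / 2) (by positivity)
    have h5 : s ≤ 1 / 5 := hs.2.trans hb
    have h3 : s / 4 ≤ Real.sin (s / 2) := by
      have : s ^ 3 ≤ s * 1 := by
        have : s ^ 2 ≤ 1 := by nlinarith
        nlinarith
      nlinarith
    have hpos : 0 < Real.sin (s / 2) := by linarith
    refine ⟨hpos, ?_⟩
    have e : (Real.sin (s / 2))⁻¹ - 2 * s⁻¹ = (s - 2 * Real.sin (s / 2)) / (s * Real.sin (s / 2)) := by
      field_simp
    rw [e, abs_of_nonneg (div_nonneg (by linarith) (by positivity)), div_le_one (by positivity)]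
    have : s ^ 3 ≤ s ^ 2 * (1 / 5) := by nlinarith [sq_nonneg s]
    nlinarith
  have e1 : ∫ s in a..b, F s / (Real.sin (s / 2) : ℝ) = 2 * (∫ s in a..b, F s / s) +
      ∫ s in a..b, F s * (((Real.sin (s / 2))⁻¹ - 2 * s⁻¹ : ℝ) : ℂ) := by
    rw [← intervalIntegral.integral_const_mul, ← intervalIntegral.integral_add]
    · refine intervalIntegral.integral_congr fun s _ => ?_
      push_cast
      ring
    · exact (intervalIntegrable_div hF ha hab).const_mul 2
    · apply ContinuousOn.intervalIntegrable
      rw [Set.uIcc_of_le hab]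
      refine hF.continuousOn.mul (Complex.continuous_ofReal.comp_continuousOn ?_)
      refine ContinuousOn.sub (ContinuousOn.inv₀ (by fun_prop) fun s hs => (hsin s hs).1.ne') ?_
      exact continuousOn_const.mul (continuousOn_id.inv₀ fun s hs => (ha.trans_le hs.1).ne')
  have e2 : ‖∫ s in a..b, F s * (((Real.sin (s / 2))⁻¹ - 2 * s⁻¹ : ℝ) : ℂ)‖ ≤ 1 * |b - a| := by
    refine intervalIntegral.norm_integral_le_of_norm_le_const fun s hs => ?_
    rw [Set.uIoc_of_le hab] at hs
    rw [norm_mul, Complex.norm_real]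
    exact mul_le_one₀ (hF1 s) (norm_nonneg _) (hsin s ⟨hs.1.le, hs.2⟩).2
  rw [abs_of_nonneg (sub_nonneg.mpr hab)] at e2
  have e3 := norm_integral_cos_sin_div_le A B M ha hab hb
  rw [e1]
  refine (norm_add_le _ _).trans ?_
  rw [norm_mul, Complex.norm_ofNat]
  linarith

/-- The partial Fourier sums of `e^{i(A cos s + B sin s - ks)}` at `0` are bounded uniformly. -/
theorem norm_integral_mul_dirichlet_le (A B k : ℝ) (N : ℕ) :
    ‖∫ s in (-Real.pi)..Real.pi, osc (fun s => A * Real.cos s + B * Real.sin s - k * s) s *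
      dirichlet N s‖ ≤ 400 := by
  set h : ℝ → ℂ := fun s => osc (fun s => A * Real.cos s + B * Real.sin s - k * s) s *
    dirichlet N s with hh
  have hc : Continuous h := (continuous_osc (by fun_prop)).mul (continuous_dirichlet N)
  have hb : ∀ s, ‖h s‖ ≤ 2 * N + 1 := fun s => by
    rw [hh, norm_mul, norm_osc, one_mul]; exact norm_dirichlet_le N s
  -- Folding about 0 exploits that A cos s is even while B sin s - ks is odd: the two values combine
  -- into a cosine of the odd part.
  set H : ℝ → ℂ := fun s => h s + h (-s) with hH
  have hHc : Continuous H := hc.add (hc.comp continuous_neg)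
  have hi : ∀ x y, IntervalIntegrable H volume x y := fun x y => hHc.intervalIntegrable x y
  have hfold : ∫ s in (-Real.pi)..Real.pi, h s = ∫ s in (0 : ℝ)..Real.pi, H s := by
    have e := intervalIntegral.integral_comp_neg (a := 0) (b := Real.pi) h
    rw [neg_zero] at e
    have hcn : Continuous fun s => h (-s) := hc.comp continuous_neg
    rw [hH, intervalIntegral.integral_add (hc.intervalIntegrable _ _)
      (hcn.intervalIntegrable _ _), e, add_comm,
      intervalIntegral.integral_add_adjacent_intervals (hc.intervalIntegrable _ _)
      (hc.intervalIntegrable _ _)]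
  set G : ℝ → ℝ → ℝ → ℂ := fun B M s => osc (fun s => A * Real.cos s) s *
      (Real.sin (M * s + B * Real.sin s) : ℝ) with hG
  have hGc : ∀ B M, Continuous (G B M) := fun B M =>
    (continuous_osc (by fun_prop)).mul (by fun_prop)
  have hG1 : ∀ B M s, ‖G B M s‖ ≤ 1 := fun B M s => by
    rw [hG, norm_mul, norm_osc, one_mul, Complex.norm_real]
    exact Real.abs_sin_le_one _
  have hsin : ∀ s, 0 < s → s ≤ Real.pi → s / Real.pi ≤ Real.sin (s / 2) := fun s h0 h1 => by
    have := Real.mul_le_sin (x := s / 2) (by positivity) (by linarith)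
    calc _ = 2 / Real.pi * (s / 2) := by ring
      _ ≤ _ := this
  -- The product 2 cos(B sin s - ks) sin((N+1/2)s) splits into two sines in which k and N occur only
  -- in the linear frequency N + 1/2 ∓ k.
  have hHG : ∀ s, 0 < s → s ≤ Real.pi → H s =
      G B (N + 1 / 2 - k) s / (Real.sin (s / 2) : ℝ) +
      G (-B) (N + 1 / 2 + k) s / (Real.sin (s / 2) : ℝ) := by
    intro s h0 h1
    have hs : 0 < Real.sin (s / 2) := lt_of_lt_of_le (by positivity) (hsin s h0 h1)
    have hs' : Complex.sin (s / 2) ≠ 0 := by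
      have : ((Real.sin (s / 2) : ℝ) : ℂ) ≠ 0 := by exact_mod_cast hs.ne'
      simpa using this
    have hD : dirichlet N s = Complex.sin ((N + 1 / 2) * s) / Complex.sin (s / 2) := by
      rw [eq_div_iff hs', dirichlet_mul_sin]
    have hD' : dirichlet N (-s) = Complex.sin ((N + 1 / 2) * s) / Complex.sin (s / 2) := by
      rw [eq_div_iff hs']
      have := dirichlet_mul_sin N (-s)
      rw [Complex.ofReal_neg, neg_div, Complex.sin_neg, mul_neg, mul_neg, Complex.sin_neg,
        neg_inj] at this
      exact this
    have e1 : osc (fun s => A * Real.cos s + B * Real.sin s - k * s) s =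
        osc (fun s => A * Real.cos s) s *
          Complex.exp (((B * Real.sin s - k * s : ℝ) : ℂ) * Complex.I) := by
      simp only [osc]; rw [← Complex.exp_add]; push_cast; ring_nf
    have e2 : osc (fun s => A * Real.cos s + B * Real.sin s - k * s) (-s) =
        osc (fun s => A * Real.cos s) s *
          Complex.exp (-((B * Real.sin s - k * s : ℝ) : ℂ) * Complex.I) := by
      simp only [osc]; rw [← Complex.exp_add, Real.cos_neg, Real.sin_neg]; push_cast; ring_nf
    have e3 := Complex.two_cos ((B * Real.sin s - k * s : ℝ) : ℂ)
    rw [hH, hG]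
    simp only [hh]
    rw [hD, hD', e1, e2]
    have e4 : ((Real.sin ((N + 1 / 2 - k) * s + B * Real.sin s) : ℝ) : ℂ) +
        ((Real.sin ((N + 1 / 2 + k) * s + -B * Real.sin s) : ℝ) : ℂ) =
        2 * Complex.cos ((B * Real.sin s - k * s : ℝ) : ℂ) * Complex.sin ((N + 1 / 2) * s) := by
      rw [show (N + 1 / 2 - k) * s + B * Real.sin s = (N + 1 / 2) * s + (B * Real.sin s - k * s)
          by ring, show (N + 1 / 2 + k) * s + -B * Real.sin s =
          (N + 1 / 2) * s - (B * Real.sin s - k * s) by ring, Real.sin_add, Real.sin_sub ((N + 1 / 2) * s)]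
      push_cast
      ring
    have e5 : Complex.sin (s / 2) = ((Real.sin (s / 2) : ℝ) : ℂ) := by push_cast; rfl
    rw [e5]
    linear_combination (-osc (fun s => A * Real.cos s) s / ((Real.sin (s / 2) : ℝ) : ℂ)) * e4 -
      (osc (fun s => A * Real.cos s) s / ((Real.sin (s / 2) : ℝ) : ℂ) *
        Complex.sin ((N + 1 / 2) * s)) * e3
  have hπ := Real.pi_gt_three
  have hπ4 := Real.pi_lt_four
  have hN : (1 : ℝ) ≤ 2 * N + 1 := by
    have : (0 : ℝ) ≤ N := N.cast_nonneg
    linarith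
  -- Below ε the trivial bound 2(2N+1) on the folded integrand costs only 2/5; the factor 5 keeps ε
  -- ≤ 1/5. Beyond 1/5 the kernel is bounded, since sin(s/2) ≥ 1/20.
  set ε : ℝ := 1 / (5 * (2 * N + 1)) with hε
  have hε0 : 0 < ε := by positivity
  have hε5 : ε ≤ 1 / 5 := by
    rw [hε]
    exact one_div_le_one_div_of_le (by norm_num) (by linarith)
  have i1 : ‖∫ s in (0 : ℝ)..ε, H s‖ ≤ 1 := by
    have := intervalIntegral.norm_integral_le_of_norm_le_const (a := 0) (b := ε) (f := H)
      (C := 2 * (2 * N + 1)) (fun s _ => (norm_add_le _ _).trans (by linarith [hb s, hb (-s)]))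
    rw [sub_zero, abs_of_pos hε0, hε] at this
    refine this.trans (le_of_eq_of_le (b := 2 / 5) ?_ (by norm_num))
    field_simp
  have i2 : ‖∫ s in ε..(1 / 5), H s‖ ≤ 170 := by
    have e : ∫ s in ε..(1 / 5), H s =
        (∫ s in ε..(1 / 5), G B (N + 1 / 2 - k) s / (Real.sin (s / 2) : ℝ)) +
        ∫ s in ε..(1 / 5), G (-B) (N + 1 / 2 + k) s / (Real.sin (s / 2) : ℝ) := by
      have hint : ∀ B M, IntervalIntegrable (fun s => G B M s / (Real.sin (s / 2) : ℝ)) volume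
          ε (1 / 5) := fun B M => by
        apply ContinuousOn.intervalIntegrable
        rw [Set.uIcc_of_le hε5]
        refine (hGc B M).continuousOn.div (by fun_prop) fun s hs => ?_
        have : 0 < s := hε0.trans_le hs.1
        exact_mod_cast (lt_of_lt_of_le (by positivity) (hsin s this (by linarith [hs.2]))).ne'
      rw [← intervalIntegral.integral_add (hint _ _) (hint _ _)]
      refine intervalIntegral.integral_congr fun s hs => ?_
      rw [Set.uIcc_of_le hε5] at hs
      exact hHG s (hε0.trans_le hs.1) (by linarith [hs.2])
    rw [e]
    have b1 := norm_integral_cos_sin_div_sin_le A B (N + 1 / 2 - k) hε0 hε5 le_rfl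
    have b2 := norm_integral_cos_sin_div_sin_le A (-B) (N + 1 / 2 + k) hε0 hε5 le_rfl
    exact (norm_add_le _ _).trans (by linarith)
  have i3 : ‖∫ s in (1 / 5)..Real.pi, H s‖ ≤ 40 * |Real.pi - 1 / 5| := by
    refine intervalIntegral.norm_integral_le_of_norm_le_const fun s hs => ?_
    rw [Set.uIoc_of_le (by linarith)] at hs
    have h0 : 0 < s := by linarith [hs.1]
    have h1 := hsin s h0 hs.2
    have h2 : 1 / 20 ≤ s / Real.pi := by
      rw [div_le_div_iff₀ (by norm_num) (by positivity)]
      linarith [hs.1]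
    rw [hHG s h0 hs.2, ← add_div, norm_div, Complex.norm_real, Real.norm_eq_abs,
      abs_of_nonneg (by linarith), div_le_iff₀ (by linarith)]
    have := norm_add_le (G B (N + 1 / 2 - k) s) (G (-B) (N + 1 / 2 + k) s)
    have := hG1 B (N + 1 / 2 - k) s
    have := hG1 (-B) (N + 1 / 2 + k) s
    linarith
  rw [abs_of_nonneg (by linarith)] at i3
  rw [hfold, ← intervalIntegral.integral_add_adjacent_intervals (hi 0 ε) (hi ε Real.pi),
    ← intervalIntegral.integral_add_adjacent_intervals (hi ε (1 / 5)) (hi (1 / 5) Real.pi)]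
  have n1 := norm_add_le (∫ s in (0 : ℝ)..ε, H s)
    ((∫ s in ε..(1 / 5), H s) + ∫ s in (1 / 5)..Real.pi, H s)
  have n2 := norm_add_le (∫ s in ε..(1 / 5), H s) (∫ s in (1 / 5)..Real.pi, H s)
  linarith

end Oscillatory


/-! ### Fourier series of plane waves on the circle -/

namespace SE2

open Oscillatory

/-- The restriction `β ↦ e^{i(a cos β + b sin β)}` of a plane wave to the unit circle. -/
def planeWave (a b : ℝ) : C(Ang, ℂ) where
  toFun β := Complex.exp (Complex.I * ((a * Real.Angle.cos β + b * Real.Angle.sin β : ℝ) : ℂ))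
  continuous_toFun := by
    have hc : Continuous (fun β : Ang => Real.Angle.cos β) := Real.Angle.continuous_cos
    have hs : Continuous (fun β : Ang => Real.Angle.sin β) := Real.Angle.continuous_sin
    fun_prop

theorem planeWave_apply (a b : ℝ) (β : Ang) : planeWave a b β =
    Complex.exp (Complex.I * ((a * Real.Angle.cos β + b * Real.Angle.sin β : ℝ) : ℂ)) := rfl

theorem planeWave_coe (a b x : ℝ) : planeWave a b (x : Ang) =
    osc (fun x => a * Real.cos x + b * Real.sin x) x := rfl

theorem fourier_ang (n : ℤ) (x : ℝ) :
    fourier n (x : Ang) = Complex.exp (Complex.I * n * x) := by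
  rw [fourier_coe_apply]
  congr 1
  have : (Real.pi : ℂ) ≠ 0 := by exact_mod_cast Real.pi_ne_zero
  push_cast
  field_simp

/-- Integration by parts for Fourier integrals over a period. -/
theorem integral_mul_exp_of_hasDerivAt {F F' : ℝ → ℂ} (h : ∀ x, HasDerivAt F (F' x) x)
    (hc : Continuous F') (hp : F (2 * Real.pi) = F 0) (n : ℤ) :
    Complex.I * n * ∫ x in (0 : ℝ)..(2 * Real.pi), F x * Complex.exp (-(Complex.I * n * x)) =
      ∫ x in (0 : ℝ)..(2 * Real.pi), F' x * Complex.exp (-(Complex.I * n * x)) := by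
  have hv : ∀ x : ℝ, HasDerivAt (fun x : ℝ => Complex.exp (-(Complex.I * n * x)))
      (-(Complex.I * n) * Complex.exp (-(Complex.I * n * x))) x := fun x => by
    have := (((hasDerivAt_id x).ofReal_comp.const_mul (Complex.I * n)).neg).cexp
    refine this.congr_deriv ?_
    simp only [id_eq, Complex.ofReal_one, Pi.neg_apply]
    ring
  have key := intervalIntegral.integral_mul_deriv_eq_deriv_mul (a := 0) (b := 2 * Real.pi)
    (fun x _ => h x) (fun x _ => hv x) (hc.intervalIntegrable _ _)
    (Continuous.intervalIntegrable (by fun_prop) _ _)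
  have e1 : Complex.exp (-(Complex.I * n * ((2 * Real.pi : ℝ) : ℂ))) = 1 := by
    rw [Complex.exp_eq_one_iff]
    exact ⟨-n, by push_cast; ring⟩
  rw [e1, hp] at key
  simp only [Complex.ofReal_zero, mul_zero, neg_zero, Complex.exp_zero, sub_self, zero_sub] at key
  rw [← neg_eq_iff_eq_neg, ← intervalIntegral.integral_neg] at key
  rw [← key, ← intervalIntegral.integral_const_mul]
  refine intervalIntegral.integral_congr fun x _ => ?_
  ring

/-- Two integrations by parts over a period give coefficients of order 1/n². -/
theorem summable_fourierCoeff_of_hasDerivAt (f : C(Ang, ℂ)) {F' F'' : ℝ → ℂ}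
    (h1 : ∀ x : ℝ, HasDerivAt (fun x : ℝ => f (x : Ang)) (F' x) x)
    (h2 : ∀ x, HasDerivAt F' (F'' x) x) (hc : Continuous F'')
    (hp : F' (2 * Real.pi) = F' 0) : Summable (fourierCoeff f) := by
  have hF' : Continuous F' := continuous_iff_continuousAt.mpr fun x => (h2 x).continuousAt
  have hcoe : ((2 * Real.pi : ℝ) : Ang) = ((0 : ℝ) : Ang) := by
    rw [AddCircle.coe_period]; rfl
  set M : ℝ := ∫ x in (0 : ℝ)..(2 * Real.pi), ‖F'' x‖ with hM
  have hπ : (0 : ℝ) ≤ 2 * Real.pi := Real.two_pi_pos.le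
  have hcoef : ∀ n : ℤ, fourierCoeff f n = (1 / (2 * Real.pi) : ℝ) •
      ∫ x in (0 : ℝ)..(2 * Real.pi), f (x : Ang) * Complex.exp (-(Complex.I * n * x)) := by
    intro n
    rw [fourierCoeff_eq_intervalIntegral f n 0, zero_add]
    congr 1
    refine intervalIntegral.integral_congr fun x _ => ?_
    simp only [fourier_ang, smul_eq_mul]
    push_cast
    ring_nf
  have hbound : ∀ n : ℤ, n ≠ 0 → ‖fourierCoeff f n‖ ≤ M / (2 * Real.pi) * (1 / (n : ℝ) ^ 2) := by
    intro n hn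
    have e1 := integral_mul_exp_of_hasDerivAt h1 hF' (by rw [hcoe]) n
    have e2 := integral_mul_exp_of_hasDerivAt h2 hc hp n
    rw [← e1] at e2
    have e3 : ‖∫ x in (0 : ℝ)..(2 * Real.pi), F'' x * Complex.exp (-(Complex.I * n * x))‖ ≤ M := by
      refine (intervalIntegral.norm_integral_le_integral_norm hπ).trans (le_of_eq ?_)
      refine intervalIntegral.integral_congr fun x _ => ?_
      have : ‖Complex.exp (-(Complex.I * n * x))‖ = 1 := by
        rw [show -(Complex.I * n * x) = ((-(n * x) : ℝ) : ℂ) * Complex.I by push_cast; ring,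
          Complex.norm_exp_ofReal_mul_I]
      simp only [norm_mul, this, mul_one]
    have hn0 : 0 < (n : ℝ) ^ 2 := by
      have : (n : ℝ) ≠ 0 := by exact_mod_cast hn
      positivity
    have hIn : ‖Complex.I * n‖ = |(n : ℝ)| := by
      rw [norm_mul, Complex.norm_I, one_mul, Complex.norm_intCast]
    rw [← e2, norm_mul (Complex.I * n), norm_mul (Complex.I * n), hIn, ← mul_assoc, ← sq, sq_abs] at e3
    rw [hcoef, norm_smul, Real.norm_of_nonneg (by positivity)]
    rw [mul_comm, ← le_div_iff₀ hn0] at e3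
    calc _ ≤ 1 / (2 * Real.pi) * (M / (n : ℝ) ^ 2) :=
          mul_le_mul_of_nonneg_left e3 (by positivity)
      _ = _ := by ring
  have hs : Summable fun n : ℤ => M / (2 * Real.pi) * (1 / (n : ℝ) ^ 2) :=
    (Real.summable_one_div_int_pow.mpr one_lt_two).mul_left _
  -- The bound fails to say anything at n = 0, so the comparison is made off that point.
  refine Summable.of_norm_bounded_eventually hs ?_
  filter_upwards [(Set.finite_singleton (0 : ℤ)).compl_mem_cofinite] with n hn
  exact hbound n hn

theorem summable_fourierCoeff_planeWave (a b : ℝ) : Summable (fourierCoeff (planeWave a b)) := by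
  have h1 : ∀ x : ℝ, HasDerivAt (fun x : ℝ => planeWave a b (x : Ang))
      (Complex.I * ((-a * Real.sin x + b * Real.cos x : ℝ) : ℂ) * planeWave a b (x : Ang)) x := by
    intro x
    have := ((((Real.hasDerivAt_cos x).const_mul a).add
      ((Real.hasDerivAt_sin x).const_mul b)).ofReal_comp.const_mul Complex.I).cexp
    refine this.congr_deriv ?_
    rw [mul_comm]
    simp only [mul_neg, neg_mul]
    rfl
  have h2 : ∀ x : ℝ, HasDerivAt
      (fun x : ℝ => Complex.I * ((-a * Real.sin x + b * Real.cos x : ℝ) : ℂ))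
      (Complex.I * ((-a * Real.cos x + b * -Real.sin x : ℝ) : ℂ)) x := fun x =>
    (((Real.hasDerivAt_sin x).const_mul (-a)).add
      ((Real.hasDerivAt_cos x).const_mul b)).ofReal_comp.const_mul Complex.I
  refine summable_fourierCoeff_of_hasDerivAt _ h1 (fun x => (h2 x).mul (h1 x)) ?_ ?_
  · have : Continuous fun x : ℝ => planeWave a b (x : Ang) :=
      (planeWave a b).continuous.comp (AddCircle.continuous_mk' _)
    fun_prop
  · have : ((2 * Real.pi : ℝ) : Ang) = ((0 : ℝ) : Ang) := by
      rw [AddCircle.coe_period]; rfl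
    rw [this, Real.sin_two_pi, Real.cos_two_pi, Real.sin_zero, Real.cos_zero]

/-- The shifted symmetric partial sums of the Fourier series of a plane wave. -/
def planeWaveSum (a b : ℝ) (k : ℤ) (N : ℕ) (γ : Ang) : ℂ :=
  ∑ n ∈ Finset.Icc (-(N : ℤ)) N, fourierCoeff (planeWave a b) (k - n) * fourier (k - n) γ

/-- Absolute summability allows the reflection n ↦ k - n, after which symmetric windows are cofinal
among finite sets. -/
theorem tendsto_planeWaveSum (a b : ℝ) (k : ℤ) (γ : Ang) :
    Tendsto (fun N => planeWaveSum a b k N γ) atTop (𝓝 (planeWave a b γ)) := by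
  have h := has_pointwise_sum_fourier_series_of_summable (summable_fourierCoeff_planeWave a b) γ
  have h' : HasSum (fun n : ℤ => fourierCoeff (planeWave a b) (k - n) * fourier (k - n) γ)
      (planeWave a b γ) := by
    simp only [smul_eq_mul] at h
    rw [← (Equiv.subLeft k).hasSum_iff] at h
    simpa only [Function.comp_def, Equiv.subLeft_apply] using h
  rw [HasSum, SummationFilter.unconditional_filter] at h'
  exact h'.comp (Finset.tendsto_Icc_neg (R := ℤ))

/-- Recentring at γ rotates the amplitude (a, b) into (A, B) by the addition formulas, and the
shifted window turns into e^{-iks} times the Dirichlet kernel. The absolute constant is what makes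
dominated convergence possible for merely integrable functions. -/
theorem norm_planeWaveSum_le (a b : ℝ) (k : ℤ) (N : ℕ) (γ : Ang) :
    ‖planeWaveSum a b k N γ‖ ≤ 400 := by
  obtain ⟨x, rfl⟩ := QuotientAddGroup.mk_surjective γ
  set A := a * Real.cos x + b * Real.sin x
  set B := b * Real.cos x - a * Real.sin x
  have hcoef : ∀ m : ℤ, fourierCoeff (planeWave a b) m * fourier m (x : Ang) =
      (1 / (2 * Real.pi) : ℝ) • ∫ s in (-Real.pi)..Real.pi,
        osc (fun s => A * Real.cos s + B * Real.sin s) s * Complex.exp (-(Complex.I * m * s)) := by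
    intro m
    rw [fourierCoeff_eq_intervalIntegral _ m (x + -Real.pi),
      show x + -Real.pi + 2 * Real.pi = x + Real.pi by ring,
      ← intervalIntegral.integral_comp_add_left, smul_mul_assoc,
      ← intervalIntegral.integral_mul_const]
    congr 1
    refine intervalIntegral.integral_congr fun s _ => ?_
    simp only [smul_eq_mul]
    rw [fourier_ang, fourier_ang, planeWave_coe, mul_right_comm, mul_comm]
    congr 1
    · simp only [osc]
      congr 3
      rw [Real.cos_add, Real.sin_add]
      ring
    · rw [← Complex.exp_add]
      push_cast
      ring_nf
  have hsum : planeWaveSum a b k N (x : Ang) = (1 / (2 * Real.pi) : ℝ) •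
      ∫ s in (-Real.pi)..Real.pi,
        osc (fun s => A * Real.cos s + B * Real.sin s - k * s) s * dirichlet N s := by
    rw [planeWaveSum, Finset.sum_congr rfl fun n _ => hcoef (k - n), ← Finset.smul_sum,
      ← intervalIntegral.integral_finsetSum]
    · congr 1
      refine intervalIntegral.integral_congr fun s _ => ?_
      rw [dirichlet, Finset.mul_sum]
      refine Finset.sum_congr rfl fun n _ => ?_
      simp only [osc]
      rw [← Complex.exp_add, ← Complex.exp_add]
      push_cast
      ring_nf
    · intro n _
      exact ((continuous_osc (by fun_prop)).mul (by fun_prop)).intervalIntegrable _ _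
  rw [hsum, norm_smul, Real.norm_of_nonneg (by positivity)]
  have h1 := norm_integral_mul_dirichlet_le A B k N
  have h2 : 1 / (2 * Real.pi) ≤ 1 := by
    rw [div_le_one Real.two_pi_pos]
    linarith [Real.pi_gt_three]
  calc _ ≤ 1 * (400 : ℝ) := mul_le_mul h2 h1 (norm_nonneg _) zero_le_one
    _ = 400 := one_mul _

end SE2


/-! ### The Haar measure of `SE(2)` -/

namespace SE2

instance : SFinite haar := by
  unfold haar
  infer_instance

theorem measurable_x : Measurable SE2.x := measurable_fst.comp measurableEquivProd.measurable

theorem measurable_y : Measurable SE2.y :=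
  (measurable_fst.comp measurable_snd).comp measurableEquivProd.measurable

theorem measurable_θ : Measurable SE2.θ :=
  (measurable_snd.comp measurable_snd).comp measurableEquivProd.measurable

theorem measurable_mk {α : Type*} [MeasurableSpace α] {a b : α → ℝ} {c : α → Ang}
    (ha : Measurable a) (hb : Measurable b) (hc : Measurable c) :
    Measurable fun t => (⟨a t, b t, c t⟩ : SE2) :=
  measurableEquivProd.symm.measurable.comp (ha.prodMk (hb.prodMk hc))

theorem continuous_cos : Continuous fun α : Ang => Real.Angle.cos α := Real.Angle.continuous_cos

theorem continuous_sin : Continuous fun α : Ang => Real.Angle.sin α := Real.Angle.continuous_sin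

theorem measurable_cos : Measurable fun α : Ang => Real.Angle.cos α := continuous_cos.measurable

theorem measurable_sin : Measurable fun α : Ang => Real.Angle.sin α := continuous_sin.measurable

instance : MeasurableMul₂ SE2 where
  measurable_mul := by
    have c : Measurable fun p : SE2 × SE2 => Real.Angle.cos p.1.θ :=
      measurable_cos.comp (measurable_θ.comp measurable_fst)
    have s : Measurable fun p : SE2 × SE2 => Real.Angle.sin p.1.θ :=
      measurable_sin.comp (measurable_θ.comp measurable_fst)
    have x1 : Measurable fun p : SE2 × SE2 => p.1.x := measurable_x.comp measurable_fst
    have y1 : Measurable fun p : SE2 × SE2 => p.1.y := measurable_y.comp measurable_fst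
    have x2 : Measurable fun p : SE2 × SE2 => p.2.x := measurable_x.comp measurable_snd
    have y2 : Measurable fun p : SE2 × SE2 => p.2.y := measurable_y.comp measurable_snd
    exact measurable_mk (x1.add ((c.mul x2).sub (s.mul y2))) (y1.add ((s.mul x2).add (c.mul y2)))
      ((measurable_θ.comp measurable_fst).add (measurable_θ.comp measurable_snd))

instance : MeasurableInv SE2 where
  measurable_inv := by
    have c := measurable_cos.comp measurable_θ
    have s := measurable_sin.comp measurable_θ
    exact measurable_mk ((c.mul measurable_x).add (s.mul measurable_y)).neg
      ((s.neg.mul measurable_x).add (c.mul measurable_y)).neg measurable_θ.neg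

/-- The coordinates `(θ, x + iy)`. -/
def coordEquiv : SE2 ≃ᵐ Ang × ℂ where
  toFun g := (g.θ, ⟨g.x, g.y⟩)
  invFun q := ⟨q.2.re, q.2.im, q.1⟩
  left_inv _ := rfl
  right_inv _ := rfl
  measurable_toFun := by
    refine measurable_θ.prodMk ?_
    exact Complex.measurableEquivRealProd.symm.measurable.comp (measurable_x.prodMk measurable_y)
  measurable_invFun := measurable_mk (Complex.measurable_re.comp measurable_snd)
    (Complex.measurable_im.comp measurable_snd) measurable_fst

theorem measurePreserving_coordEquiv : MeasurePreserving coordEquiv haar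
    (ENNReal.ofReal (1 / (4 * Real.pi ^ 2)) •
      (volume : Measure Ang).prod (volume : Measure ℂ)) := by
  have e : MeasurePreserving measurableEquivProd haar
      (ENNReal.ofReal (1 / (4 * Real.pi ^ 2)) • (volume : Measure (ℝ × ℝ × Ang))) := by
    refine ⟨measurableEquivProd.measurable, ?_⟩
    rw [haar, Measure.map_smul, measurableEquivProd.map_map_symm]
  have h1 : MeasurePreserving (MeasurableEquiv.prodAssoc.symm : ℝ × ℝ × Ang ≃ᵐ (ℝ × ℝ) × Ang)
      volume volume := volume_preserving_prodAssoc.symm _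
  have h2 : MeasurePreserving (Prod.swap : (ℝ × ℝ) × Ang → Ang × (ℝ × ℝ)) volume volume :=
    Measure.measurePreserving_swap
  have h3 : MeasurePreserving (Prod.map id Complex.measurableEquivRealProd.symm :
      Ang × (ℝ × ℝ) → Ang × ℂ) volume volume :=
    (MeasurePreserving.id _).prod (Complex.volume_preserving_equiv_real_prod.symm _)
  exact ((h3.comp (h2.comp h1)).smul_measure _).comp e

/-- The rotation by `α` as a complex number. -/
def rot (α : Ang) : ℂ := ⟨Real.Angle.cos α, Real.Angle.sin α⟩

theorem measurable_rot : Measurable rot :=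
  Complex.measurableEquivRealProd.symm.measurable.comp (measurable_cos.prodMk measurable_sin)

theorem measurePreserving_rot_mul (α : Ang) :
    MeasurePreserving (fun z : ℂ => rot α * z) volume volume := by
  have key : ∀ θ : Real.Angle, (⟨θ.cos, θ.sin⟩ : ℂ) = θ.toCircle := fun θ => by
    rw [Real.Angle.coe_toCircle]
    apply Complex.ext <;> simp
  have e : (fun z : ℂ => rot α * z) = rotation (Real.Angle.toCircle α) := by
    funext z
    rw [rotation_apply, ← key α, rot]
  rw [e]
  exact (rotation _).measurePreserving

theorem measurePreserving_of_coord {f : SE2 → SE2} {F : Ang × ℂ → Ang × ℂ}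
    (hF : MeasurePreserving F ((volume : Measure Ang).prod (volume : Measure ℂ))
      ((volume : Measure Ang).prod (volume : Measure ℂ)))
    (h : ∀ g, coordEquiv (f g) = F (coordEquiv g)) : MeasurePreserving f haar haar := by
  have := (measurePreserving_coordEquiv.symm coordEquiv).comp
    ((hF.smul_measure (ENNReal.ofReal (1 / (4 * Real.pi ^ 2)))).comp measurePreserving_coordEquiv)
  convert this using 1
  funext g
  simp only [Function.comp_apply]
  rw [← h, coordEquiv.symm_apply_apply]

instance : Measure.IsMulLeftInvariant haar where
  map_mul_left_eq_self g := by
    refine (measurePreserving_of_coord (F := Prod.map (fun θ => g.θ + θ)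
      fun z => (⟨g.x, g.y⟩ : ℂ) + rot g.θ * z) ?_ fun h => ?_).map_eq
    · exact (measurePreserving_add_left volume g.θ).prod
        ((measurePreserving_add_left volume _).comp (measurePreserving_rot_mul g.θ))
    · refine Prod.ext rfl ?_
      apply Complex.ext <;> simp [coordEquiv, mul_def, rot, add_comm]

/-- A right translation is a skew product: the angle is shifted, and over each fixed angle the plane
is translated by a vector depending on that angle only. -/
instance : Measure.IsMulRightInvariant haar where
  map_mul_right_eq_self h := by
    refine (measurePreserving_of_coord (F := fun q => (q.1 + h.θ,
      q.2 + rot q.1 * (⟨h.x, h.y⟩ : ℂ))) ?_ fun g => ?_).map_eq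
    · refine (measurePreserving_add_right volume h.θ).skew_product
        (g := fun α z => z + rot α * (⟨h.x, h.y⟩ : ℂ)) ?_ ?_
      · exact measurable_snd.add ((measurable_rot.comp measurable_fst).mul_const _)
      · exact Eventually.of_forall fun α => (measurePreserving_add_right volume _).map_eq
    · refine Prod.ext rfl ?_
      apply Complex.ext <;> simp [coordEquiv, mul_def, rot, add_comm]

instance : Measure.IsInvInvariant haar where
  inv_eq_self := by
    refine (measurePreserving_of_coord (f := fun g => g⁻¹) (F := fun q => (-q.1,
      -(rot (-q.1) * q.2))) ?_ fun g => ?_).map_eq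
    · refine (Measure.measurePreserving_neg volume).skew_product
        (g := fun α z => -(rot (-α) * z)) ?_ ?_
      · exact ((measurable_rot.comp measurable_fst.neg).mul measurable_snd).neg
      · exact Eventually.of_forall fun α => ((Measure.measurePreserving_neg volume).comp
          (measurePreserving_rot_mul (-α))).map_eq
    · refine Prod.ext rfl ?_
      apply Complex.ext <;> (simp [coordEquiv, inv_def, rot, cos_neg', sin_neg']; try ring)

/-! ### The fundamental domain -/

instance : Countable latticeΓ := by
  have hs : Function.Surjective fun p : ℤ × ℤ =>
      (⟨⟨p.1, p.2, 0⟩, ⟨p.1, p.2, rfl⟩⟩ : latticeΓ) := by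
    rintro ⟨_, i, j, rfl⟩
    exact ⟨(i, j), rfl⟩
  exact hs.countable

theorem measurableSet_fundDomain : MeasurableSet fundDomain :=
  (measurable_x measurableSet_Ico).inter (measurable_y measurableSet_Ico)

theorem isFundamentalDomain : IsFundamentalDomain latticeΓ fundDomain haar := by
  refine IsFundamentalDomain.mk' measurableSet_fundDomain.nullMeasurableSet fun g => ?_
  have hfl : ∀ (x : ℝ) (i : ℤ), (i : ℝ) + x ∈ Set.Ico (0 : ℝ) 1 ↔ i = -⌊x⌋ := by
    intro x i
    have h1 := Int.floor_le x
    have h2 := Int.lt_floor_add_one x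
    constructor
    · rintro ⟨h3, h4⟩
      have h5 : (-⌊x⌋ : ℤ) < i + 1 := by
        have : ((-⌊x⌋ : ℤ) : ℝ) < ((i + 1 : ℤ) : ℝ) := by push_cast; linarith
        exact_mod_cast this
      have h6 : i < -⌊x⌋ + 1 := by
        have : (i : ℝ) < ((-⌊x⌋ + 1 : ℤ) : ℝ) := by push_cast; linarith
        exact_mod_cast this
      omega
    · rintro rfl
      push_cast
      exact ⟨by linarith, by linarith⟩
  have hmem : ∀ i j : ℤ, (⟨i, j, 0⟩ : SE2) * g ∈ fundDomain ↔ i = -⌊g.x⌋ ∧ j = -⌊g.y⌋ := by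
    intro i j
    rw [← hfl, ← hfl]
    simp [fundDomain, mul_def, cos_zero', sin_zero']
  refine ⟨⟨⟨(-⌊g.x⌋ : ℤ), (-⌊g.y⌋ : ℤ), 0⟩, _, _, rfl⟩, (hmem _ _).mpr ⟨rfl, rfl⟩, ?_⟩
  rintro ⟨_, i, j, rfl⟩ h
  obtain ⟨rfl, rfl⟩ := (hmem i j).mp h
  rfl

/-- Right translations commute with the left action of the lattice and preserve the measure.
Consequently integrals of lattice-invariant functions over the domain are unchanged by right
translation. -/
theorem isFundamentalDomain_image (u : SE2) :
    IsFundamentalDomain latticeΓ ((fun g => g * u) '' fundDomain) haar :=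
  isFundamentalDomain.image_of_equiv (Equiv.mulRight u)
    (measurePreserving_mul_right haar u⁻¹).quasiMeasurePreserving (Equiv.refl _)
    fun _ _ => mul_assoc _ _ _

theorem measurableEmbedding_mul_right (u : SE2) : MeasurableEmbedding fun g : SE2 => g * u :=
  (MeasurableEquiv.mulRight u).measurableEmbedding

theorem setLIntegral_mul_right {f : SE2 → ℝ≥0∞} (hf : ∀ (γ : latticeΓ) g, f (γ * g) = f g)
    (u : SE2) : ∫⁻ g in fundDomain, f (g * u) ∂haar = ∫⁻ g in fundDomain, f g ∂haar := by
  rw [(measurePreserving_mul_right haar u).setLIntegral_comp_emb (measurableEmbedding_mul_right u)]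
  exact (isFundamentalDomain_image u).setLIntegral_eq isFundamentalDomain f hf

theorem setIntegral_mul_right {f : SE2 → ℂ} (hf : ∀ (γ : latticeΓ) g, f (γ * g) = f g)
    (u : SE2) : ∫ g in fundDomain, f (g * u) ∂haar = ∫ g in fundDomain, f g ∂haar := by
  rw [← (measurePreserving_mul_right haar u).setIntegral_image_emb (measurableEmbedding_mul_right u)]
  exact (isFundamentalDomain_image u).setIntegral_eq isFundamentalDomain hf

theorem haar_fundDomain : haar fundDomain = ENNReal.ofReal (1 / (2 * Real.pi)) := by
  rw [haar, Measure.smul_apply, MeasurableEquiv.map_apply]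
  have : (measurableEquivProd.symm ⁻¹' fundDomain) =
      Set.Ico (0 : ℝ) 1 ×ˢ Set.Ico (0 : ℝ) 1 ×ˢ (Set.univ : Set Ang) := by
    ext q
    simp [fundDomain, measurableEquivProd, equivProd]
  rw [this, Measure.volume_eq_prod, Measure.prod_prod, Measure.volume_eq_prod, Measure.prod_prod,
    AddCircle.measure_univ, Real.volume_Ico, smul_eq_mul, sub_zero, ENNReal.ofReal_one, one_mul,
    one_mul, ← ENNReal.ofReal_mul (by positivity)]
  congr 1
  have := Real.pi_ne_zero
  field_simp
  ring

instance : IsFiniteMeasure (haar.restrict fundDomain) :=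
  ⟨by rw [Measure.restrict_apply_univ, haar_fundDomain]; exact ENNReal.ofReal_lt_top⟩

end SE2


/-! ### Matrix elements of the representations -/

namespace SE2

/-- This cocycle identity is the multiplicativity of the representation, in the form used below. -/
theorem phase_mul (p : ℝ) (g h : SE2) (β : Ang) :
    phase p (g * h) β = phase p g β * phase p h (β - g.θ) := by
  rw [phase, phase, phase, ← Complex.exp_add, sub_eq_add_neg, cos_add', sin_add', cos_neg',
    sin_neg', mul_def]
  push_cast
  ring_nf

theorem phase_one (p : ℝ) (β : Ang) : phase p 1 β = 1 := by
  simp [phase, one_def]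

/-- The cocycle identity for g⁻¹ * g = 1 says that the phase of g⁻¹ inverts the rotated phase of g;
since the phase is unimodular, the inverse is the conjugate. -/
theorem conj_phase (p : ℝ) (g : SE2) (β : Ang) :
    (starRingEnd ℂ) (phase p g (β + g.θ)) = phase p g⁻¹ β := by
  have h := phase_mul p g⁻¹ g β
  have hθ : (g⁻¹).θ = -g.θ := rfl
  rw [inv_mul_cancel, phase_one, hθ, sub_neg_eq_add] at h
  have h2 : phase p g (β + g.θ) * (starRingEnd ℂ) (phase p g (β + g.θ)) = 1 := by
    rw [Complex.mul_conj, Complex.normSq_eq_norm_sq, norm_phase]; simp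
  calc _ = phase p g⁻¹ β * phase p g (β + g.θ) * (starRingEnd ℂ) (phase p g (β + g.θ)) := by
        rw [← h, one_mul]
    _ = _ := by rw [mul_assoc, h2, mul_one]

theorem phase_inv_eq (p : ℝ) (g : SE2) (β : Ang) :
    phase p g⁻¹ β = planeWave (p * g.x) (p * g.y) (β + g.θ) := by
  rw [← conj_phase, phase, planeWave_apply, ← Complex.exp_conj]
  congr 1
  simp only [map_neg, map_mul, Complex.conj_I, Complex.conj_ofReal]
  push_cast
  ring

theorem fourier_sub_apply (n : ℤ) (α β : Ang) :
    fourier n (α - β) = fourier n α * fourier (-n) β := by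
  rw [sub_eq_add_neg, fourier_apply, fourier_apply, fourier_apply, smul_add, smul_neg, neg_smul,
    AddCircle.toCircle_add, Circle.coe_mul]

/-- `U_p(g) e_n` as a continuous function. -/
def repFun (p : ℝ) (n : ℤ) (g : SE2) : C(Ang, ℂ) where
  toFun β := phase p g β * fourier n (β - g.θ)
  continuous_toFun := (continuous_phase p g).mul
    ((fourier n).continuous.comp (continuous_sub_right g.θ))

theorem repFun_apply (p : ℝ) (n : ℤ) (g : SE2) (β : Ang) :
    repFun p n g β = phase p g β * fourier n (β - g.θ) := rfl

theorem U_e (p : ℝ) (n : ℤ) (g : SE2) :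
    U p g (e n) = ContinuousMap.toLp 2 AddCircle.haarAddCircle ℂ (repFun p n g) := by
  apply Lp.ext
  have h1 : ∀ᵐ β ∂(AddCircle.haarAddCircle : Measure Ang),
      (e n : Ang → ℂ) (β - g.θ) = fourier n (β - g.θ) :=
    (measurePreserving_sub_right AddCircle.haarAddCircle g.θ).quasiMeasurePreserving.ae
      (p := fun β => (e n : Ang → ℂ) β = fourier n β) (coeFn_fourierLp 2 n)
  filter_upwards [(memLp_U p g (e n)).coeFn_toLp, h1, ContinuousMap.coeFn_toLp (p := 2) (𝕜 := ℂ)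
    AddCircle.haarAddCircle (repFun p n g)] with β h2 h3 h4
  rw [h4, U, h2, h3, repFun_apply]

theorem U_one_e (p : ℝ) (n : ℤ) : U p 1 (e n) = e n := by
  rw [U_e, e, fourierLp]
  congr 1
  ext β
  rw [repFun_apply, phase_one, one_mul]
  change fourier n (β - 0) = _
  rw [sub_zero]

theorem inner_U_e (p : ℝ) (k n : ℤ) (g h : SE2) :
    inner ℂ (U p g (e k)) (U p h (e n)) =
      ∫ β, (starRingEnd ℂ) (repFun p k g β) * repFun p n h β ∂AddCircle.haarAddCircle := by
  rw [U_e, U_e, ContinuousMap.inner_toLp]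
  refine integral_congr_ae (Eventually.of_forall fun β => ?_)
  simp only [mul_comm]

/-- Unitarity together with the homomorphism property, checked on basis vectors only, by translating
the integration variable by the angle of g. -/
theorem inner_U_e_eq (p : ℝ) (k n : ℤ) (g h : SE2) :
    inner ℂ (U p g (e k)) (U p h (e n)) = inner ℂ (e k) (U p (g⁻¹ * h) (e n)) := by
  conv_rhs => rw [← U_one_e p k]
  rw [inner_U_e, inner_U_e, ← (measurePreserving_add_right AddCircle.haarAddCircle
    g.θ).integral_comp (MeasurableEquiv.addRight g.θ).measurableEmbedding]
  refine integral_congr_ae (Eventually.of_forall fun β => ?_)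
  have hθ : (g⁻¹).θ = -g.θ := rfl
  have hθ2 : (g⁻¹ * h).θ = -g.θ + h.θ := rfl
  have hθ1 : (1 : SE2).θ = 0 := rfl
  simp only [repFun_apply, map_mul, conj_phase, phase_mul, hθ, hθ2, hθ1, phase_one,
    sub_neg_eq_add, add_sub_cancel_right, sub_zero, one_mul]
  rw [show β - (-g.θ + h.θ) = β + g.θ - h.θ by abel]
  ring

theorem norm_U_e (p : ℝ) (n : ℤ) (g : SE2) : ‖U p g (e n)‖ = 1 := by
  have h1 := inner_U_e_eq p n n g g
  rw [inv_mul_cancel, U_one_e, inner_self_eq_norm_sq_to_K, inner_self_eq_norm_sq_to_K,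
    orthonormal_fourier.1 n] at h1
  have h2 : ‖U p g (e n)‖ ^ 2 = 1 := by
    have : ((‖U p g (e n)‖ ^ 2 : ℝ) : ℂ) = 1 := by
      push_cast
      simpa using h1
    exact_mod_cast this
  exact (pow_eq_one_iff_of_nonneg (norm_nonneg _) two_ne_zero).mp h2

/-- The matrix elements `⟨U_p(g⁻¹) e_n, e_m⟩`. -/
def matCoef (p : ℝ) (n m : ℤ) (g : SE2) : ℂ := inner ℂ (e m) (U p g⁻¹ (e n))

theorem norm_matCoef_le (p : ℝ) (n m : ℤ) (g : SE2) : ‖matCoef p n m g‖ ≤ 1 := by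
  refine (norm_inner_le_norm _ _).trans ?_
  rw [norm_U_e, orthonormal_fourier.1 m, one_mul]

theorem matCoef_eq_inner (p : ℝ) (n m : ℤ) (g : SE2) :
    matCoef p n m g = inner ℂ (U p g (e m)) (e n) := by
  have := inner_U_e_eq p m n g 1
  rw [U_one_e, mul_one] at this
  rw [this, matCoef]

/-- Translating by the angle of g straightens the rotated plane wave into its unrotated form. This
identifies the matrix elements with Fourier coefficients of a plane wave. -/
theorem matCoef_eq (p : ℝ) (n m : ℤ) (g : SE2) : matCoef p n m g =
    fourier m g.θ * fourierCoeff (planeWave (p * g.x) (p * g.y)) (m - n) := by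
  have h0 : matCoef p n m g = inner ℂ (U p 1 (e m)) (U p g⁻¹ (e n)) := by rw [U_one_e, matCoef]
  have hc := (measurePreserving_add_right AddCircle.haarAddCircle g.θ).integral_comp
    (MeasurableEquiv.addRight g.θ).measurableEmbedding
    (fun β => fourier (-(m - n)) β • planeWave (p * g.x) (p * g.y) β)
  rw [h0, inner_U_e, fourierCoeff, ← hc, ← integral_const_mul]
  refine integral_congr_ae (Eventually.of_forall fun β => ?_)
  have hθ : (g⁻¹).θ = -g.θ := rfl
  have hθ1 : (1 : SE2).θ = 0 := rfl
  simp only [repFun_apply, phase_one, hθ, hθ1, one_mul, sub_zero, sub_neg_eq_add, smul_eq_mul,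
    phase_inv_eq]
  have h1 : (starRingEnd ℂ) (fourier m β) = fourier (-m) (β + g.θ) * fourier m g.θ := by
    have := fourier_sub_apply (-m) (β + g.θ) g.θ
    rw [add_sub_cancel_right, neg_neg] at this
    rw [← this, fourier_neg]
  rw [h1, show -(m - n) = -m + n by ring, fourier_add]
  ring

/-- Parseval for U_p(g⁻¹)e_n against U_p(u)e_k. The inverse (gu)⁻¹ = u⁻¹g⁻¹ reverses the operators,
so the indices come out in the order nm, mk. -/
theorem hasSum_matCoef_mul (p : ℝ) (n k : ℤ) (g u : SE2) :
    HasSum (fun m => matCoef p n m g * matCoef p m k u) (matCoef p n k (g * u)) := by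
  have h := fourierBasis.hasSum_inner_mul_inner (U p u (e k)) (U p g⁻¹ (e n))
  rw [coe_fourierBasis, inner_U_e_eq, ← mul_inv_rev] at h
  have e1 : (fun m => matCoef p n m g * matCoef p m k u) = fun m =>
      inner ℂ (U p u (e k)) (e m) * inner ℂ (e m) (U p g⁻¹ (e n)) := funext fun m => by
    rw [mul_comm, matCoef_eq_inner p m k, matCoef]
  rw [e1]
  exact h

/-- Bessel's inequality for a row of one matrix and a column of the other, joined by the
arithmetic-geometric mean inequality. The bound does not depend on g and u, hence serves as a
dominant for integration. -/
theorem sum_norm_matCoef_mul_le (p : ℝ) (n k : ℤ) (g u : SE2) (s : Finset ℤ) :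
    ∑ m ∈ s, ‖matCoef p n m g * matCoef p m k u‖ ≤ 1 := by
  have b1 : ∑ m ∈ s, ‖matCoef p n m g‖ ^ 2 ≤ 1 := by
    have := orthonormal_fourier.sum_inner_products_le (U p g⁻¹ (e n)) (s := s)
    rwa [norm_U_e, one_pow] at this
  have b2 : ∑ m ∈ s, ‖matCoef p m k u‖ ^ 2 ≤ 1 := by
    have := orthonormal_fourier.sum_inner_products_le (U p u (e k)) (s := s)
    rw [norm_U_e, one_pow] at this
    refine (Finset.sum_congr rfl fun m _ => ?_).trans_le this
    rw [matCoef_eq_inner, norm_inner_symm]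
  have b3 : ∀ m ∈ s, ‖matCoef p n m g * matCoef p m k u‖ ≤
      (‖matCoef p n m g‖ ^ 2 + ‖matCoef p m k u‖ ^ 2) / 2 := fun m _ => by
    rw [norm_mul]
    linarith [two_mul_le_add_sq ‖matCoef p n m g‖ ‖matCoef p m k u‖]
  refine (Finset.sum_le_sum b3).trans ?_
  rw [← Finset.sum_div, Finset.sum_add_distrib]
  linarith

/-- The vector depends continuously on g: a jointly continuous kernel is curried to a continuous map
into C(𝕊¹), which maps continuously into L². -/
theorem stronglyMeasurable_U_inv_e (p : ℝ) (n : ℤ) :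
    StronglyMeasurable fun g : SE2 => U p g⁻¹ (e n) := by
  set F : C((ℝ × ℝ × Ang) × Ang, ℂ) := ⟨fun q =>
    Complex.exp (Complex.I * ((p * q.1.1 * Real.Angle.cos (q.2 + q.1.2.2) +
      p * q.1.2.1 * Real.Angle.sin (q.2 + q.1.2.2) : ℝ) : ℂ)) * fourier n (q.2 + q.1.2.2), by
    have h : Continuous fun q : (ℝ × ℝ × Ang) × Ang => q.2 + q.1.2.2 := by fun_prop
    have hc := continuous_cos.comp h
    have hs := continuous_sin.comp h
    have hf := (fourier (T := 2 * Real.pi) n).continuous.comp h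
    simp only [Function.comp_def] at hc hs hf
    fun_prop⟩
  have hF : Continuous fun q : ℝ × ℝ × Ang =>
      ContinuousMap.toLp (E := ℂ) 2 (AddCircle.haarAddCircle : Measure Ang) ℂ (F.curry q) :=
    (ContinuousMap.toLp (E := ℂ) 2 (AddCircle.haarAddCircle : Measure Ang) ℂ).continuous.comp
      F.curry.continuous
  have := hF.stronglyMeasurable.comp_measurable measurableEquivProd.measurable
  convert this using 2 with g
  rw [U_e]
  simp only [Function.comp_apply]
  congr 1
  ext β
  rw [repFun_apply, phase_inv_eq, planeWave_apply]
  have hθ : (g⁻¹).θ = -g.θ := rfl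
  rw [hθ, sub_neg_eq_add]
  rfl

theorem stronglyMeasurable_matCoef (p : ℝ) (n m : ℤ) : StronglyMeasurable (matCoef p n m) :=
  (innerSL ℂ (e m)).continuous.comp_stronglyMeasurable (stronglyMeasurable_U_inv_e p n)

/-- The operator-valued integrand is Bochner integrable on basis vectors, as these are moved
isometrically, so the inner product passes under the integral. -/
theorem fourierCoef_eq_integral {f : SE2 → ℂ} (hf : Integrable f haar) (p : ℝ) (n m : ℤ) :
    fourierCoef f p n m = ∫ g, f g * matCoef p n m g ∂haar := by
  have hi : Integrable (fun g => f g • U p g⁻¹ (e n)) haar := by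
    refine hf.mono (hf.1.smul (stronglyMeasurable_U_inv_e p n).aestronglyMeasurable) ?_
    refine Eventually.of_forall fun g => ?_
    rw [norm_smul, norm_U_e, mul_one]
  rw [fourierCoef, fourierOp, ← integral_inner hi]
  refine integral_congr_ae (Eventually.of_forall fun g => ?_)
  simp only [inner_smul_right]
  rfl

end SE2


/-! ### The character integrals and the inner series -/

namespace SE2

/-- The function `e^{2πi(i x + j y)} e^{ilθ}` on `SE(2)`. -/
def latticeChar (i j l : ℤ) (g : SE2) : ℂ :=
  Complex.exp (Complex.I * ((2 * Real.pi * (i * g.x + j * g.y) : ℝ) : ℂ)) * fourier l g.θ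

theorem norm_fourier_apply (l : ℤ) (β : Ang) : ‖fourier l β‖ = 1 := by
  rw [fourier_apply, Circle.norm_coe]

theorem norm_latticeChar (i j l : ℤ) (g : SE2) : ‖latticeChar i j l g‖ = 1 := by
  rw [latticeChar, norm_mul, norm_fourier_apply, mul_one, mul_comm, Complex.norm_exp_ofReal_mul_I]

theorem measurable_latticeChar (i j l : ℤ) : Measurable (latticeChar i j l) := by
  have h1 : Measurable fun g : SE2 => 2 * Real.pi * (i * g.x + j * g.y) :=
    (((measurable_x.const_mul _).add (measurable_y.const_mul _)).const_mul _)
  have h2 : Measurable fun g : SE2 => fourier l g.θ :=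
    (fourier l).continuous.measurable.comp measurable_θ
  exact (Complex.measurable_exp.comp
    ((Complex.measurable_ofReal.comp h1).const_mul _)).mul h2

/-- The integral `∬ f₁(g) f₂(u) conj χ(g u) dg du` against a lattice character. -/
def charIntegral (f₁ f₂ : SE2 → ℂ) (i j l : ℤ) : ℂ :=
  ∫ z, f₁ z.1 * f₂ z.2 * (starRingEnd ℂ) (latticeChar i j l (z.1 * z.2)) ∂haar.prod haar

variable {f₁ f₂ : SE2 → ℂ}

theorem integrable_mul_bounded (hf₁ : Integrable f₁ haar) (hf₂ : Integrable f₂ haar)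
    {h : SE2 × SE2 → ℂ} (hm : AEStronglyMeasurable h (haar.prod haar)) {C : ℝ}
    (hC : ∀ z, ‖h z‖ ≤ C) :
    Integrable (fun z : SE2 × SE2 => f₁ z.1 * f₂ z.2 * h z) (haar.prod haar) :=
  (hf₁.mul_prod hf₂).mul_bdd (c := C) hm (Eventually.of_forall hC)

theorem stronglyMeasurable_matCoef_mul (p : ℝ) (n k : ℤ) :
    StronglyMeasurable fun z : SE2 × SE2 => matCoef p n k (z.1 * z.2) :=
  (stronglyMeasurable_matCoef p n k).comp_measurable measurable_mul

/-- Each product of coefficients is a double integral by Fubini, and the sum over m is taken inside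
by the multiplicativity of the matrix elements. The uniform Bessel bound makes the series of
integrated norms converge. -/
theorem hasSum_fourierCoef_mul (hf₁ : Integrable f₁ haar) (hf₂ : Integrable f₂ haar) (p : ℝ)
    (n k : ℤ) : HasSum (fun m => fourierCoef f₁ p n m * fourierCoef f₂ p m k)
      (∫ z, f₁ z.1 * f₂ z.2 * matCoef p n k (z.1 * z.2) ∂haar.prod haar) := by
  set Φ : ℤ → SE2 × SE2 → ℂ := fun m z =>
    f₁ z.1 * f₂ z.2 * (matCoef p n m z.1 * matCoef p m k z.2) with hΦ
  have hΦm : ∀ m, Integrable (Φ m) (haar.prod haar) := fun m => by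
    refine integrable_mul_bounded hf₁ hf₂ (C := 1) ?_ fun z => ?_
    · exact (((stronglyMeasurable_matCoef p n m).comp_measurable measurable_fst).mul
        ((stronglyMeasurable_matCoef p m k).comp_measurable measurable_snd)).aestronglyMeasurable
    · rw [norm_mul]
      exact mul_le_one₀ (norm_matCoef_le _ _ _ _) (norm_nonneg _) (norm_matCoef_le _ _ _ _)
  have hint : ∀ m, ∫ z, Φ m z ∂haar.prod haar = fourierCoef f₁ p n m * fourierCoef f₂ p m k := by
    intro m
    rw [fourierCoef_eq_integral hf₁, fourierCoef_eq_integral hf₂, ← integral_prod_mul]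
    refine integral_congr_ae (Eventually.of_forall fun z => ?_)
    simp only [hΦ]
    ring
  have hs : Summable fun m => ∫ z, ‖Φ m z‖ ∂haar.prod haar := by
    refine summable_of_sum_le (c := ∫ z, ‖f₁ z.1 * f₂ z.2‖ ∂haar.prod haar)
      (fun m => integral_nonneg fun z => norm_nonneg _) fun s => ?_
    rw [← integral_finsetSum _ fun m _ => (hΦm m).norm]
    refine integral_mono (integrable_finsetSum _ fun m _ => (hΦm m).norm)
      (hf₁.mul_prod hf₂).norm fun z => ?_
    simp only [hΦ]
    simp_rw [norm_mul (f₁ z.1 * f₂ z.2)]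
    rw [← Finset.mul_sum]
    exact mul_le_of_le_one_right (norm_nonneg _) (sum_norm_matCoef_mul_le p n k z.1 z.2 s)
  have key : HasSum (fun m => ∫ z, Φ m z ∂haar.prod haar)
      (∫ z, ∑' m, Φ m z ∂haar.prod haar) := hasSum_integral_of_summable_integral_norm hΦm hs
  simp only [hint] at key
  convert key using 1
  refine integral_congr_ae (Eventually.of_forall fun z => ?_)
  simp only [hΦ]
  rw [tsum_mul_left, (hasSum_matCoef_mul p n k z.1 z.2).tsum_eq]

/-! ### Lattice points on a circle -/

theorem norm_add_mul_I (i j : ℤ) : ‖(i : ℂ) + (j : ℂ) * Complex.I‖ = radius i j := by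
  rw [radius, Complex.norm_eq_sqrt_sq_add_sq]
  simp

theorem radius_mul_cos_polarAngle (i j : ℤ) : radius i j * Real.cos (polarAngle i j) = i := by
  have h : Real.cos (polarAngle i j) = Real.cos (Complex.arg ((i : ℂ) + (j : ℂ) * Complex.I)) := by
    rw [polarAngle, toIcoMod, zsmul_eq_mul, Real.cos_sub_int_mul_two_pi]
  rw [h, ← norm_add_mul_I, Complex.norm_mul_cos_arg]
  simp

theorem radius_mul_sin_polarAngle (i j : ℤ) : radius i j * Real.sin (polarAngle i j) = j := by
  have h : Real.sin (polarAngle i j) = Real.sin (Complex.arg ((i : ℂ) + (j : ℂ) * Complex.I)) := by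
    rw [polarAngle, toIcoMod, zsmul_eq_mul, Real.sin_sub_int_mul_two_pi]
  rw [h, ← norm_add_mul_I, Complex.norm_mul_sin_arg]
  simp

/-- At a fixed radius the angle determines the point, so a sum over the set of angles counts each
lattice point on the circle once. -/
theorem injOn_polarAngle (r : ℝ) :
    Set.InjOn (fun q : ℤ × ℤ => polarAngle q.1 q.2) {q | r = radius q.1 q.2} := by
  rintro ⟨i, j⟩ h ⟨i', j'⟩ h' heq
  simp only [Set.mem_ofPred_eq] at h h' heq
  have h1 := radius_mul_cos_polarAngle i j
  have h2 := radius_mul_sin_polarAngle i j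
  rw [← h, heq, h', radius_mul_cos_polarAngle] at h1
  rw [← h, heq, h', radius_mul_sin_polarAngle] at h2
  ext
  · exact_mod_cast h1.symm
  · exact_mod_cast h2.symm

theorem image_polarAngle (r : ℝ) :
    (fun q : ℤ × ℤ => polarAngle q.1 q.2) '' {q | r = radius q.1 q.2} = anglesAt r := by
  ext θ
  constructor
  · rintro ⟨⟨i, j⟩, h, rfl⟩
    exact ⟨i, j, h, rfl⟩
  · rintro ⟨i, j, h, rfl⟩
    exact ⟨(i, j), h, rfl⟩

theorem latticeAt_finite (r : ℝ) : {q : ℤ × ℤ | r = radius q.1 q.2}.Finite :=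
  Set.Finite.of_finite_image (by rw [image_polarAngle]; exact anglesAt_finite r)
    (injOn_polarAngle r)

/-- The lattice points of norm `r`. -/
def latticeAt (r : ℝ) : Finset (ℤ × ℤ) := (latticeAt_finite r).toFinset

theorem mem_latticeAt {r : ℝ} {q : ℤ × ℤ} : q ∈ latticeAt r ↔ r = radius q.1 q.2 := by
  simp [latticeAt]

theorem kernelK_eq (r : ℝ) (q : ℤ) (a φ : ℝ) : kernelK r q a φ = ∑ κ ∈ latticeAt r,
    Complex.exp (Complex.I * ((2 * Real.pi * (κ.1 * (a * Real.cos φ) + κ.2 * (a * Real.sin φ)) :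
      ℝ) : ℂ)) * Complex.exp (Complex.I * q * polarAngle κ.1 κ.2) := by
  have h : (anglesAt_finite r).toFinset =
      (latticeAt r).image fun κ : ℤ × ℤ => polarAngle κ.1 κ.2 := by
    ext θ
    rw [Set.Finite.mem_toFinset, ← image_polarAngle, Finset.mem_image]
    simp only [Set.mem_image, mem_latticeAt, Set.mem_ofPred_eq]
  have hinj : Set.InjOn (fun κ : ℤ × ℤ => polarAngle κ.1 κ.2) (latticeAt r) := by
    intro κ hκ κ' hκ' heq
    exact injOn_polarAngle r (mem_latticeAt.mp hκ) (mem_latticeAt.mp hκ') heq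
  rw [kernelK, h, Finset.sum_image hinj]
  refine Finset.sum_congr rfl fun κ hκ => ?_
  have h1 := radius_mul_cos_polarAngle κ.1 κ.2
  have h2 := radius_mul_sin_polarAngle κ.1 κ.2
  rw [← mem_latticeAt.mp hκ] at h1 h2
  congr 2
  rw [← h1, ← h2, Real.cos_sub]
  push_cast
  ring

theorem fourier_add_pi (m : ℤ) (x : ℝ) : fourier m ((x + Real.pi : ℝ) : Ang) =
    (-1 : ℂ) ^ m * Complex.exp (Complex.I * m * x) := by
  rw [fourier_ang, ← Complex.exp_pi_mul_I, ← Complex.exp_int_mul, ← Complex.exp_add]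
  congr 1
  push_cast
  ring

/-- Evaluating at the opposite angle reverses the sign of the exponent, which produces the
conjugate. Under Fourier expansion the shift by π becomes (-1)^{k-n}. -/
theorem planeWave_eq_conj_latticeChar (i j k : ℤ) (g : SE2) :
    fourier k g.θ * planeWave (2 * Real.pi * radius i j * g.x) (2 * Real.pi * radius i j * g.y)
      ((polarAngle i j + Real.pi : ℝ) : Ang) =
    (starRingEnd ℂ) (latticeChar i j (-k) g) := by
  rw [latticeChar, map_mul, ← fourier_neg, neg_neg, mul_comm]
  congr 1
  rw [planeWave_coe, Oscillatory.osc, ← Complex.exp_conj, map_mul, Complex.conj_I,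
    Complex.conj_ofReal]
  congr 1
  rw [Real.cos_add_pi, Real.sin_add_pi, neg_mul, ← mul_neg, ← Complex.ofReal_neg]
  congr 2
  have h1 := radius_mul_cos_polarAngle i j
  have h2 := radius_mul_sin_polarAngle i j
  linear_combination (-2 * Real.pi * g.x) * h1 + (-2 * Real.pi * g.y) * h2

/-- The partial sum over n is the integral of f₁ ⊗ f₂ against a shifted partial Fourier sum of the
plane wave attached to gu. Pointwise these tend to the conjugate character, and their uniform bound
permits dominated convergence. -/
theorem tendsto_sum_fourierCoef (hf₁ : Integrable f₁ haar) (hf₂ : Integrable f₂ haar)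
    (i j k : ℤ) : Tendsto (fun N : ℕ => ∑ n ∈ Finset.Icc (-(N : ℤ)) N, (-1 : ℂ) ^ (k - n) *
      Complex.exp (Complex.I * (k - n : ℤ) * polarAngle i j) *
      ∑' m, fourierCoef f₁ (2 * Real.pi * radius i j) n m *
        fourierCoef f₂ (2 * Real.pi * radius i j) m k) atTop
      (𝓝 (charIntegral f₁ f₂ i j (-k))) := by
  set p := 2 * Real.pi * radius i j
  set γ : Ang := ((polarAngle i j + Real.pi : ℝ) : Ang)
  set G : ℕ → SE2 × SE2 → ℂ := fun N z => fourier k (z.1 * z.2).θ *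
    planeWaveSum (p * (z.1 * z.2).x) (p * (z.1 * z.2).y) k N γ with hG
  have hGeq : ∀ N z, G N z =
      ∑ n ∈ Finset.Icc (-(N : ℤ)) N, fourier (k - n) γ * matCoef p n k (z.1 * z.2) := by
    intro N z
    simp only [hG]
    rw [planeWaveSum, Finset.mul_sum]
    refine Finset.sum_congr rfl fun n _ => ?_
    rw [matCoef_eq]
    ring
  have hGm : ∀ N, StronglyMeasurable (G N) := fun N => by
    rw [show G N = fun z => ∑ n ∈ Finset.Icc (-(N : ℤ)) N,
      fourier (k - n) γ * matCoef p n k (z.1 * z.2) from funext (hGeq N)]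
    exact Finset.stronglyMeasurable_fun_sum _ fun n _ =>
      (stronglyMeasurable_matCoef_mul p n k).const_mul _
  have hGb : ∀ N z, ‖G N z‖ ≤ 400 := fun N z => by
    simp only [hG]
    rw [norm_mul, norm_fourier_apply, one_mul]
    exact norm_planeWaveSum_le _ _ _ _ _
  have hsum : ∀ N : ℕ, ∑ n ∈ Finset.Icc (-(N : ℤ)) N, (-1 : ℂ) ^ (k - n) *
      Complex.exp (Complex.I * (k - n : ℤ) * polarAngle i j) *
      ∑' m, fourierCoef f₁ p n m * fourierCoef f₂ p m k =
      ∫ z, f₁ z.1 * f₂ z.2 * G N z ∂haar.prod haar := by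
    intro N
    simp only [hGeq, Finset.mul_sum]
    rw [integral_finsetSum]
    · refine Finset.sum_congr rfl fun n _ => ?_
      rw [(hasSum_fourierCoef_mul hf₁ hf₂ p n k).tsum_eq, ← fourier_add_pi,
        ← integral_const_mul]
      refine integral_congr_ae (Eventually.of_forall fun z => ?_)
      simp only [γ]
      ring
    · intro n _
      refine integrable_mul_bounded hf₁ hf₂ (C := 1)
        ((stronglyMeasurable_matCoef_mul p n k).const_mul _).aestronglyMeasurable fun z => ?_
      rw [norm_mul, norm_fourier_apply, one_mul]
      exact norm_matCoef_le _ _ _ _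
  simp only [hsum]
  -- The dominant is 400 |f₁ ⊗ f₂|; no decay of f₁ or f₂ is needed because 400 is independent of the
  -- translation part.
  refine tendsto_integral_of_dominated_convergence (fun z => ‖f₁ z.1 * f₂ z.2‖ * 400)
    (fun N => (integrable_mul_bounded hf₁ hf₂ (hGm N).aestronglyMeasurable (hGb N)).1)
    ((hf₁.mul_prod hf₂).norm.mul_const _) (fun N => Eventually.of_forall fun z => ?_)
    (Eventually.of_forall fun z => ?_)
  · rw [norm_mul]
    exact mul_le_mul_of_nonneg_left (hGb N z) (norm_nonneg _)
  · refine Tendsto.const_mul _ ?_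
    rw [← planeWave_eq_conj_latticeChar]
    exact (tendsto_planeWaveSum _ _ _ _).const_mul _

/-- Without a translation frequency the character is a homomorphism, so the double integral factors.
-/
theorem charIntegral_zero (f₁ f₂ : SE2 → ℂ) (k : ℤ) :
    charIntegral f₁ f₂ 0 0 k = charCoef f₁ k * charCoef f₂ k := by
  rw [charIntegral, charCoef, charCoef, ← integral_prod_mul]
  refine integral_congr_ae (Eventually.of_forall fun z => ?_)
  have hθ : (z.1 * z.2).θ = z.1.θ + z.2.θ := rfl
  have h : fourier k (z.1.θ + z.2.θ) = fourier k z.1.θ * fourier k z.2.θ := by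
    rw [fourier_apply, fourier_apply, fourier_apply, smul_add, AddCircle.toCircle_add,
      Circle.coe_mul]
  simp only [latticeChar, χ, hθ, h, map_mul]
  simp
  ring

end SE2


/-! ### The coset space -/

namespace SE2

/-- The representative of a coset in the fundamental domain. -/
def rep : CosetSpace → SE2 :=
  Quotient.lift (fun g => ⟨Int.fract g.x, Int.fract g.y, g.θ⟩) (by
    intro a b hab
    obtain ⟨i, j, h⟩ := QuotientGroup.rightRel_apply.mp hab
    have hb : b = ⟨i, j, 0⟩ * a := by rw [← h, inv_mul_cancel_right]
    rw [hb]
    simp [mul_def, cos_zero', sin_zero'])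

theorem rep_coset (g : SE2) : rep (coset g) = ⟨Int.fract g.x, Int.fract g.y, g.θ⟩ := rfl

theorem coset_mul (γ : latticeΓ) (g : SE2) : coset (γ * g) = coset g := by
  refine Quotient.sound (QuotientGroup.rightRel_apply.mpr ?_)
  rw [mul_inv_rev, mul_inv_cancel_left]
  exact inv_mem γ.2

theorem coset_rep (q : CosetSpace) : coset (rep q) = q := by
  induction q using Quotient.inductionOn with
  | h g =>
    have h := coset_mul ⟨⟨(-⌊g.x⌋ : ℤ), (-⌊g.y⌋ : ℤ), 0⟩, _, _, rfl⟩ g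
    refine Eq.trans ?_ h
    change coset (rep (coset g)) = _
    rw [rep_coset]
    congr 1
    ext <;> simp [mul_def, cos_zero', sin_zero', Int.fract, sub_eq_neg_add]

theorem rep_coset_of_mem {g : SE2} (hg : g ∈ fundDomain) : rep (coset g) = g := by
  rw [rep_coset, Int.fract_eq_self.mpr hg.1, Int.fract_eq_self.mpr hg.2]

theorem measurable_coset : Measurable coset := measurable_from_quotient.mp measurable_id

theorem measurable_rep : Measurable rep := by
  refine measurable_from_quotient.mpr ?_
  exact measurable_mk measurable_x.fract measurable_y.fract measurable_θ

theorem measurePreserving_coset :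
    MeasurePreserving coset (haar.restrict fundDomain) cosetMeasure := ⟨measurable_coset, rfl⟩

theorem measurePreserving_rep :
    MeasurePreserving rep cosetMeasure (haar.restrict fundDomain) := by
  refine ⟨measurable_rep, ?_⟩
  rw [cosetMeasure, Measure.map_map measurable_rep measurable_coset]
  conv_rhs => rw [← Measure.map_id (μ := haar.restrict fundDomain)]
  refine Measure.map_congr ?_
  filter_upwards [ae_restrict_mem measurableSet_fundDomain] with g hg
  exact rep_coset_of_mem hg

/-- The pullbacks along `coset` and along its section `rep` both preserve measure, and composing
them recovers the function exactly. -/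
theorem aestronglyMeasurable_cosetMeasure_iff {E : Type*} [TopologicalSpace E]
    {F : CosetSpace → E} : AEStronglyMeasurable F cosetMeasure ↔
      AEStronglyMeasurable (fun g => F (coset g)) (haar.restrict fundDomain) := by
  constructor
  · exact fun h => h.comp_measurePreserving measurePreserving_coset
  · intro h
    have := h.comp_measurePreserving measurePreserving_rep
    simpa only [Function.comp_def, coset_rep] using this

theorem memLp_cosetMeasure_iff {E : Type*} [NormedAddCommGroup E] {p : ℝ≥0∞}
    {F : CosetSpace → E} : MemLp F p cosetMeasure ↔
      MemLp (fun g => F (coset g)) p (haar.restrict fundDomain) := by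
  constructor
  · exact fun h => h.comp_measurePreserving measurePreserving_coset
  · intro h
    have := h.comp_measurePreserving measurePreserving_rep
    simpa only [Function.comp_def, coset_rep] using this

/-! ### The torus -/

theorem volume_eq_haarAddCircle : (volume : Measure (AddCircle (1 : ℝ))) = AddCircle.haarAddCircle := by
  rw [AddCircle.volume_eq_smul_haarAddCircle, ENNReal.ofReal_one, one_smul]

/-- The probability Haar measure of the torus. -/
abbrev torusHaar : Measure (UnitAddTorus (Fin 3)) := Measure.pi fun _ => AddCircle.haarAddCircle

/-- Rescaling is a topological group isomorphism, and a Haar probability measure is unique. -/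
theorem map_homeomorphAddCircle_haar :
    Measure.map (AddCircle.homeomorphAddCircle (2 * Real.pi) 1 Real.two_pi_pos.ne' one_ne_zero)
      (AddCircle.haarAddCircle : Measure Ang) = (AddCircle.haarAddCircle : Measure UnitAddCircle) := by
  set ε := AddCircle.homeomorphAddCircle (2 * Real.pi) 1 Real.two_pi_pos.ne' one_ne_zero
  have h1 : (Measure.map ε (AddCircle.haarAddCircle : Measure Ang)).IsAddHaarMeasure :=
    (AddCircle.equivAddCircle (2 * Real.pi) 1 Real.two_pi_pos.ne'
      one_ne_zero).isAddHaarMeasure_map _ ε.continuous ε.symm.continuous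
  have h2 : IsProbabilityMeasure (Measure.map ε (AddCircle.haarAddCircle : Measure Ang)) :=
    Measure.isProbabilityMeasure_map ε.measurable.aemeasurable
  exact Measure.isAddHaarMeasure_eq_of_isProbabilityMeasure _ _

/-- The coordinates modulo the lattice. -/
def toTorus (g : SE2) : UnitAddTorus (Fin 3) :=
  ![(g.x : UnitAddCircle), (g.y : UnitAddCircle),
    AddCircle.homeomorphAddCircle (2 * Real.pi) 1 Real.two_pi_pos.ne' one_ne_zero g.θ]

theorem mFourier_toTorus (i j l : ℤ) (g : SE2) :
    UnitAddTorus.mFourier ![i, j, l] (toTorus g) = latticeChar i j l g := by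
  obtain ⟨x, y, θ⟩ := g
  obtain ⟨θ, rfl⟩ := QuotientAddGroup.mk_surjective θ
  have h : fourier l (AddCircle.homeomorphAddCircle (2 * Real.pi) 1 Real.two_pi_pos.ne'
      one_ne_zero (θ : Ang)) = fourier l (θ : Ang) := by
    rw [AddCircle.homeomorphAddCircle_apply_mk, fourier_coe_apply, fourier_coe_apply]
    congr 1
    have : (Real.pi : ℂ) ≠ 0 := by exact_mod_cast Real.pi_ne_zero
    push_cast
    field_simp
  change ∏ m : Fin 3, fourier ((![i, j, l] : Fin 3 → ℤ) m) _ = _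
  rw [Fin.prod_univ_three]
  simp only [toTorus, latticeChar, Matrix.cons_val_zero, Matrix.cons_val_one, Matrix.cons_val]
  congr 1
  rw [fourier_coe_apply, fourier_coe_apply, ← Complex.exp_add]
  congr 1
  push_cast
  ring

theorem toTorus_rep_coset (g : SE2) : toTorus (rep (coset g)) = toTorus g := by
  have h : ∀ x : ℝ, ((Int.fract x : ℝ) : UnitAddCircle) = (x : UnitAddCircle) := fun x => by
    rw [Int.fract, AddCircle.coe_sub, sub_eq_self]
    exact (AddCircle.coe_eq_zero_iff 1).mpr ⟨⌊x⌋, by simp⟩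
  rw [rep_coset, toTorus, toTorus]
  simp only [h]

theorem latticeChar_coset (i j l : ℤ) (γ : latticeΓ) (g : SE2) :
    latticeChar i j l (γ * g) = latticeChar i j l g := by
  rw [← mFourier_toTorus, ← mFourier_toTorus, ← toTorus_rep_coset (γ * g), coset_mul,
    toTorus_rep_coset]

theorem measurable_toTorus : Measurable toTorus := by
  refine measurable_pi_iff.mpr fun m => ?_
  have h : Measurable fun x : ℝ => (x : UnitAddCircle) := AddCircle.measurable_mk'
  fin_cases m
  · exact h.comp measurable_x
  · exact h.comp measurable_y
  · exact (Homeomorph.measurable _).comp measurable_θ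

/-- The comparison is checked on boxes. The constant is the mass (4π²)⁻¹·2π of the domain, and its
inverse is the factor 2π of the expansion. -/
theorem map_toTorus : Measure.map toTorus (haar.restrict fundDomain) =
    ENNReal.ofReal (1 / (2 * Real.pi)) • torusHaar := by
  set ε := AddCircle.homeomorphAddCircle (2 * Real.pi) 1 Real.two_pi_pos.ne' one_ne_zero
  have hπ := Real.pi_pos
  have key : torusHaar =
      ENNReal.ofReal (2 * Real.pi) • Measure.map toTorus (haar.restrict fundDomain) := by
    refine Measure.pi_eq fun s hs => ?_
    have hI : ∀ t : Set UnitAddCircle, MeasurableSet t →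
        volume ((fun x : ℝ => (x : UnitAddCircle)) ⁻¹' t ∩ Set.Ico 0 1) = AddCircle.haarAddCircle t := by
      intro t ht
      have := (AddCircle.measurePreserving_mk 1 0).measure_preimage ht.nullMeasurableSet
      rw [← volume_eq_haarAddCircle, ← this, Measure.restrict_apply (AddCircle.measurable_mk' ht), zero_add]
      exact measure_congr ((ae_eq_refl _).inter Ico_ae_eq_Ioc)
    have hε : ∀ t : Set UnitAddCircle, MeasurableSet t →
        volume (ε ⁻¹' t) = ENNReal.ofReal (2 * Real.pi) * AddCircle.haarAddCircle t := by
      intro t ht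
      rw [AddCircle.volume_eq_smul_haarAddCircle, Measure.smul_apply, smul_eq_mul,
        ← map_homeomorphAddCircle_haar, Measure.map_apply ε.measurable ht]
    rw [Measure.smul_apply, Measure.map_apply measurable_toTorus (MeasurableSet.univ_pi hs),
      Measure.restrict_apply (measurable_toTorus (MeasurableSet.univ_pi hs)), haar,
      Measure.smul_apply, MeasurableEquiv.map_apply]
    have hset : measurableEquivProd.symm ⁻¹' (toTorus ⁻¹' (Set.univ.pi s) ∩ fundDomain) =
        ((fun x : ℝ => (x : UnitAddCircle)) ⁻¹' s 0 ∩ Set.Ico 0 1) ×ˢ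
        ((fun x : ℝ => (x : UnitAddCircle)) ⁻¹' s 1 ∩ Set.Ico 0 1) ×ˢ (ε ⁻¹' s 2) := by
      ext q
      simp only [Set.mem_preimage, Set.mem_inter_iff, Set.mem_pi, Set.mem_univ, true_imp_iff,
        Fin.forall_fin_succ, Set.mem_prod, fundDomain, Set.mem_ofPred_eq]
      simp [toTorus, measurableEquivProd, equivProd, ε]
      tauto
    rw [hset, Measure.volume_eq_prod, Measure.prod_prod, Measure.volume_eq_prod,
      Measure.prod_prod, hI _ (hs 0), hI _ (hs 1), hε _ (hs 2), Fin.prod_univ_three]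
    have hc : ENNReal.ofReal (2 * Real.pi) * (ENNReal.ofReal (1 / (4 * Real.pi ^ 2)) *
        ENNReal.ofReal (2 * Real.pi)) = 1 := by
      rw [← ENNReal.ofReal_mul (by positivity), ← ENNReal.ofReal_mul (by positivity),
        ← ENNReal.ofReal_one]
      congr 1
      field_simp
      ring
    rw [smul_eq_mul, smul_eq_mul]
    calc _ = (ENNReal.ofReal (2 * Real.pi) * (ENNReal.ofReal (1 / (4 * Real.pi ^ 2)) *
        ENNReal.ofReal (2 * Real.pi))) * (AddCircle.haarAddCircle (s 0) *
          AddCircle.haarAddCircle (s 1) * AddCircle.haarAddCircle (s 2)) := by ring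
      _ = _ := by rw [hc, one_mul]
  rw [key, smul_smul, ← ENNReal.ofReal_mul (by positivity),
    show 1 / (2 * Real.pi) * (2 * Real.pi) = 1 by field_simp, ENNReal.ofReal_one, one_smul]

/-- A section of `toTorus` with values in the fundamental domain. -/
def ofTorus (t : UnitAddTorus (Fin 3)) : SE2 :=
  ⟨AddCircle.measurableEquivIco 1 0 (t 0), AddCircle.measurableEquivIco 1 0 (t 1),
    (AddCircle.homeomorphAddCircle (2 * Real.pi) 1 Real.two_pi_pos.ne' one_ne_zero).symm (t 2)⟩

theorem measurable_ofTorus : Measurable ofTorus :=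
  measurable_mk
    (measurable_subtype_coe.comp ((MeasurableEquiv.measurable _).comp (measurable_pi_apply 0)))
    (measurable_subtype_coe.comp ((MeasurableEquiv.measurable _).comp (measurable_pi_apply 1)))
    ((Homeomorph.measurable _).comp (measurable_pi_apply 2))

theorem ofTorus_toTorus {g : SE2} (hg : g ∈ fundDomain) : ofTorus (toTorus g) = g := by
  have h : ∀ x : ℝ, x ∈ Set.Ico (0 : ℝ) 1 →
      ((AddCircle.measurableEquivIco 1 0 (x : UnitAddCircle) : Set.Ico (0 : ℝ) (0 + 1)) : ℝ) = x :=
    fun x hx => by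
      change ((AddCircle.equivIco 1 0 (x : UnitAddCircle) : Set.Ico (0 : ℝ) (0 + 1)) : ℝ) = x
      rw [AddCircle.equivIco_coe_eq (by simpa using hx)]
  obtain ⟨h1, h2⟩ := hg
  ext
  · simpa [ofTorus, toTorus] using h _ h1
  · simpa [ofTorus, toTorus] using h _ h2
  · simp [ofTorus, toTorus]

theorem map_ofTorus : Measure.map ofTorus torusHaar =
    ENNReal.ofReal (2 * Real.pi) • haar.restrict fundDomain := by
  have h : torusHaar =
      ENNReal.ofReal (2 * Real.pi) • Measure.map toTorus (haar.restrict fundDomain) := by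
    have := Real.pi_pos
    rw [map_toTorus, smul_smul, ← ENNReal.ofReal_mul (by positivity),
      show 2 * Real.pi * (1 / (2 * Real.pi)) = 1 by field_simp, ENNReal.ofReal_one, one_smul]
  rw [h, Measure.map_smul, Measure.map_map measurable_ofTorus measurable_toTorus]
  congr 1
  conv_rhs => rw [← Measure.map_id (μ := haar.restrict fundDomain)]
  refine Measure.map_congr ?_
  filter_upwards [ae_restrict_mem measurableSet_fundDomain] with g hg
  exact ofTorus_toTorus hg

end SE2


/-! ### Expansions in `L²` of the coset space -/

namespace SE2

theorem hasSumL2_of_hasSum {X ι : Type*} [MeasurableSpace X] {μ : Measure X}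
    {g : ι → Lp ℂ 2 μ} {S : Lp ℂ 2 μ} (h : HasSum g S) {G : ι → X → ℂ}
    (hG : ∀ i, g i =ᵐ[μ] G i) : HasSumL2 μ G S := by
  refine ⟨Lp.memLp S, fun i => (memLp_congr_ae (hG i)).mp (Lp.memLp (g i)), ?_⟩
  rw [HasSum, SummationFilter.unconditional_filter] at h
  have h1 := (Lp.tendsto_Lp_iff_tendsto_eLpNorm' (fun s : Finset ι => ∑ i ∈ s, g i) S).mp h
  refine h1.congr fun s => eLpNorm_congr_ae ?_
  have h2 : ∀ᵐ x ∂μ, ∀ i ∈ s, g i x = G i x :=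
    (ae_ball_iff s.countable_toSet).mpr fun i _ => hG i
  filter_upwards [Lp.coeFn_finsetSum s g, h2] with x hx hx2
  rw [Pi.sub_apply, hx, Finset.sum_apply, Finset.sum_congr rfl hx2]

theorem exists_eLpNorm_smul_measure_le {X : Type*} [MeasurableSpace X] (μ : Measure X) {c : ℝ≥0∞}
    (hc : c ≠ ∞) : ∃ K : ℝ≥0∞, K ≠ ∞ ∧ ∀ f : X → ℂ, eLpNorm f 2 (c • μ) ≤ K * eLpNorm f 2 μ :=
  ⟨_, ENNReal.rpow_ne_top_of_nonneg ENNReal.toReal_nonneg hc,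
    fun f => eLpNorm_smul_measure_le c f 2 μ⟩

theorem HasSumL2.comp {X Y ι : Type*} [MeasurableSpace X] [MeasurableSpace Y] {μ : Measure X}
    {ν : Measure Y} {t : Y → X} {c : ℝ≥0∞} (hc : c ≠ ∞) (ht : Measurable t)
    (hm : Measure.map t ν = c • μ) {G : ι → X → ℂ} {S : X → ℂ} (h : HasSumL2 μ G S) :
    HasSumL2 ν (fun i y => G i (t y)) (fun y => S (t y)) := by
  have hp : MeasurePreserving t ν (c • μ) := ⟨ht, hm⟩
  obtain ⟨hS, hG, hT⟩ := h
  refine ⟨(hS.smul_measure hc).comp_measurePreserving hp,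
    fun i => ((hG i).smul_measure hc).comp_measurePreserving hp, ?_⟩
  obtain ⟨K, hK, hle⟩ := exists_eLpNorm_smul_measure_le μ hc
  have h1 : ∀ s : Finset ι, eLpNorm (fun y => (∑ i ∈ s, G i (t y)) - S (t y)) 2 ν ≤
      K * eLpNorm (fun x => (∑ i ∈ s, G i x) - S x) 2 μ := fun s => by
    have hmem : AEStronglyMeasurable (fun x => (∑ i ∈ s, G i x) - S x) (c • μ) :=
      (((memLp_finsetSum s fun i _ => hG i).sub hS).smul_measure hc).1
    exact (eLpNorm_comp_measurePreserving hmem hp).trans_le (hle _)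
  have h2 := ENNReal.Tendsto.const_mul hT (Or.inr hK)
  rw [mul_zero] at h2
  exact tendsto_of_tendsto_of_tendsto_of_le_of_le tendsto_const_nhds h2 (fun _ => zero_le) h1

theorem radius_pos {i j : ℤ} (h : ¬(i = 0 ∧ j = 0)) : 0 < radius i j := by
  rw [← norm_add_mul_I, norm_pos_iff]
  intro h0
  have h1 := congrArg Complex.re h0
  have h2 := congrArg Complex.im h0
  simp at h1 h2
  exact h ⟨h1, h2⟩

/-- The Fourier coefficients on the torus. -/
def torusCoeff (f : UnitAddTorus (Fin 3) → ℂ) (n : Fin 3 → ℤ) : ℂ :=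
  ∫ t, UnitAddTorus.mFourier (-n) t • f t ∂torusHaar

/-- The Fourier monomials as elements of `L²`. -/
def torusLp (n : Fin 3 → ℤ) : Lp ℂ 2 torusHaar :=
  ContinuousMap.toLp (E := ℂ) 2 torusHaar ℂ (UnitAddTorus.mFourier n)

theorem coeFn_torusLp (n : Fin 3 → ℤ) : torusLp n =ᵐ[torusHaar] UnitAddTorus.mFourier n :=
  ContinuousMap.coeFn_toLp torusHaar (UnitAddTorus.mFourier n)

theorem hasSum_torusCoeff (f : Lp ℂ 2 torusHaar) :
    HasSum (fun n => torusCoeff f n • torusLp n) f :=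
  UnitAddTorus.hasSum_mFourier_series_L2 f

/-- The index of the series in which the frequency `n` occurs. -/
def freqIndex (n : Fin 3 → ℤ) : ℤ ⊕ (PosRadius × ℤ) :=
  if h : n 0 = 0 ∧ n 1 = 0 then Sum.inl (n 2)
  -- The sign of the third entry reflects that the second series is written with e^{-ikα}.
  else Sum.inr (⟨radius (n 0) (n 1), radius_pos h, n 0, n 1, rfl⟩, -n 2)

/-- The frequencies that are gathered in a term of the two series. -/
def freqSet : ℤ ⊕ (PosRadius × ℤ) → Finset (Fin 3 → ℤ)
  | Sum.inl k => {![0, 0, k]}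
  | Sum.inr (ρ, k) => (latticeAt ρ).map ⟨fun κ => ![κ.1, κ.2, -k], fun κ κ' h => by
      have h0 := congrFun h 0
      have h1 := congrFun h 1
      exact Prod.ext h0 h1⟩

theorem sum_freqSet_inr {E : Type*} [AddCommMonoid E] (v : (Fin 3 → ℤ) → E) (b : PosRadius × ℤ) :
    ∑ n ∈ freqSet (Sum.inr b), v n = ∑ κ ∈ latticeAt b.1, v ![κ.1, κ.2, -b.2] := by
  obtain ⟨ρ, k⟩ := b
  rw [freqSet, Finset.sum_map]
  rfl

theorem mem_freqSet (b : ℤ ⊕ (PosRadius × ℤ)) (n : Fin 3 → ℤ) :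
    n ∈ freqSet b ↔ freqIndex n = b := by
  have h3 : ∀ i j l : ℤ, n = ![i, j, l] ↔ n 0 = i ∧ n 1 = j ∧ n 2 = l := fun i j l => by
    constructor
    · rintro rfl; exact ⟨rfl, rfl, rfl⟩
    · rintro ⟨rfl, rfl, rfl⟩; ext m; fin_cases m <;> rfl
  rcases b with k | ⟨ρ, k⟩
  · rw [freqSet, Finset.mem_singleton, h3, freqIndex]
    split_ifs with h
    · simp [h.1, h.2]
    · simp only [iff_false]
      tauto
  · rw [freqSet, Finset.mem_map, freqIndex]
    constructor
    · rintro ⟨⟨i, j⟩, hκ, rfl⟩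
      have hr : ρ.1 = radius i j := mem_latticeAt.mp hκ
      have h0 : ¬(i = 0 ∧ j = 0) := by
        rintro ⟨rfl, rfl⟩
        have := ρ.2.1
        rw [hr] at this
        simp [radius] at this
      have h0' : ¬((![i, j, -k] : Fin 3 → ℤ) 0 = 0 ∧ (![i, j, -k] : Fin 3 → ℤ) 1 = 0) := h0
      change (if h : (![i, j, -k] : Fin 3 → ℤ) 0 = 0 ∧ (![i, j, -k] : Fin 3 → ℤ) 1 = 0 then _
        else _) = _
      rw [dif_neg h0']
      congr 1
      exact Prod.ext (Subtype.ext hr.symm) (neg_neg k)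
    · split_ifs with h
      · simp
      · intro he
        have he' := Sum.inr_injective he
        rw [Prod.ext_iff] at he'
        obtain ⟨h1, h2⟩ := he'
        refine ⟨(n 0, n 1), mem_latticeAt.mpr (congrArg Subtype.val h1).symm, ?_⟩
        refine ((h3 _ _ _).mpr ⟨rfl, rfl, ?_⟩).symm
        have h2' : -n 2 = k := h2
        rw [← h2', neg_neg]

/-- Grouping a convergent series by the values of `freqIndex`. -/
theorem hasSum_freqSet {E : Type*} [NormedAddCommGroup E] {v : (Fin 3 → ℤ) → E} {f : E}
    (h : HasSum v f) : HasSum (fun b => ∑ n ∈ freqSet b, v n) f := by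
  rw [← (Equiv.sigmaFiberEquiv freqIndex).hasSum_iff] at h
  refine h.sigma fun b => ?_
  have h1 : {n | freqIndex n = b} = (freqSet b : Set (Fin 3 → ℤ)) := by
    ext n; simp [mem_freqSet]
  have h2 : HasSum (fun n : (freqSet b : Set (Fin 3 → ℤ)) => v n) (∑ n ∈ freqSet b, v n) :=
    (freqSet b).hasSum v
  rw [← h1] at h2
  exact h2

/-- The lattice characters on the coset space. -/
def cosetChar (i j l : ℤ) (q : CosetSpace) : ℂ := latticeChar i j l (rep q)

theorem cosetChar_coset (i j l : ℤ) (g : SE2) : cosetChar i j l (coset g) = latticeChar i j l g := by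
  rw [cosetChar, ← mFourier_toTorus, toTorus_rep_coset, mFourier_toTorus]

/-- Fourier inversion on the torus for F/(2π): the division compensates for passing from integrals
over the domain to the probability measure, so the coefficients are exactly the given numbers.
Unconditional convergence allows the frequencies to be grouped into finite blocks and the blocks to
be separated into two series. -/
theorem exists_hasSumL2 {F : CosetSpace → ℂ} (hF : MemLp F 2 cosetMeasure)
    {a : ℤ → ℤ → ℤ → ℂ} (ha : ∀ i j l, ∫ g in fundDomain,
      F (coset g) * (starRingEnd ℂ) (latticeChar i j l g) ∂haar = a i j l) :
    ∃ S T : CosetSpace → ℂ,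
      HasSumL2 cosetMeasure (fun k q => a 0 0 k * cosetChar 0 0 k q) S ∧
      HasSumL2 cosetMeasure (fun (b : PosRadius × ℤ) q => ∑ κ ∈ latticeAt b.1,
        a κ.1 κ.2 (-b.2) * cosetChar κ.1 κ.2 (-b.2) q) T ∧
      F =ᵐ[cosetMeasure] fun q => 2 * Real.pi * (S q + T q) := by
  have hπ := Real.pi_pos
  have hπ' : (Real.pi : ℂ) ≠ 0 := by exact_mod_cast hπ.ne'
  set t : CosetSpace → UnitAddTorus (Fin 3) := fun q => toTorus (rep q) with ht
  have htm : Measurable t := measurable_toTorus.comp measurable_rep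
  have htmap : Measure.map t cosetMeasure = ENNReal.ofReal (1 / (2 * Real.pi)) • torusHaar := by
    rw [← map_toTorus, ← measurePreserving_rep.map_eq,
      Measure.map_map measurable_toTorus measurable_rep]
    rfl
  -- the function on the torus
  set f₀ : UnitAddTorus (Fin 3) → ℂ := fun s => F (coset (ofTorus s)) / (2 * Real.pi) with hf₀
  have hmp : MeasurePreserving (fun s => coset (ofTorus s)) torusHaar
      (ENNReal.ofReal (2 * Real.pi) • cosetMeasure) := by
    refine ⟨measurable_coset.comp measurable_ofTorus, ?_⟩
    rw [cosetMeasure, ← Measure.map_smul, ← map_ofTorus,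
      Measure.map_map measurable_coset measurable_ofTorus]
    rfl
  have hf₀L : MemLp f₀ 2 torusHaar := by
    have := (hF.smul_measure (ENNReal.ofReal_ne_top (r := 2 * Real.pi))).comp_measurePreserving hmp
    have h2 := this.const_mul ((2 * Real.pi : ℂ)⁻¹)
    refine (memLp_congr_ae (Eventually.of_forall fun s => ?_)).mp h2
    simp only [hf₀, Function.comp_apply]
    ring
  set f : Lp ℂ 2 torusHaar := hf₀L.toLp f₀ with hf
  have hst : ∀ g ∈ fundDomain, f₀ (toTorus g) = F (coset g) / (2 * Real.pi) := fun g hg => by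
    rw [hf₀]; simp only [ofTorus_toTorus hg]
  -- its Fourier coefficients
  have hcoef : ∀ i j l : ℤ, torusCoeff f ![i, j, l] = a i j l := by
    intro i j l
    have h1 : torusCoeff f ![i, j, l] =
        ∫ s, (starRingEnd ℂ) (UnitAddTorus.mFourier ![i, j, l] s) * f₀ s ∂torusHaar := by
      rw [torusCoeff]
      refine integral_congr_ae ?_
      filter_upwards [hf₀L.coeFn_toLp] with s hs
      rw [hf, hs, UnitAddTorus.mFourier_neg, smul_eq_mul]
    have hm : AEStronglyMeasurable (fun s : UnitAddTorus (Fin 3) =>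
        (starRingEnd ℂ) (UnitAddTorus.mFourier ![i, j, l] s) * f₀ s) torusHaar :=
      (Complex.continuous_conj.comp (UnitAddTorus.mFourier _).continuous).aestronglyMeasurable.mul
        hf₀L.1
    have h2 : ∫ s, (starRingEnd ℂ) (UnitAddTorus.mFourier ![i, j, l] s) * f₀ s
        ∂(ENNReal.ofReal (1 / (2 * Real.pi)) • torusHaar) =
        a i j l / (2 * Real.pi) := by
      rw [← map_toTorus, integral_map measurable_toTorus.aemeasurable]
      · rw [← ha, ← integral_div]
        refine setIntegral_congr_fun measurableSet_fundDomain fun g hg => ?_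
        rw [hst g hg, mFourier_toTorus]
        ring
      · rw [map_toTorus]
        exact hm.smul_measure _
    rw [integral_smul_measure, ENNReal.toReal_ofReal (by positivity), Complex.real_smul] at h2
    rw [h1]
    push_cast at h2
    field_simp at h2
    linear_combination h2
  have hsum := hasSum_freqSet (hasSum_torusCoeff f)
  set v : (Fin 3 → ℤ) → Lp ℂ 2 torusHaar :=
    fun n => torusCoeff f n • torusLp n with hv
  have hvae : ∀ i j l : ℤ, v ![i, j, l] =ᵐ[torusHaar]
      fun s => a i j l * UnitAddTorus.mFourier ![i, j, l] s := fun i j l => by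
    filter_upwards [Lp.coeFn_smul (torusCoeff f ![i, j, l])
      (torusLp ![i, j, l]), coeFn_torusLp ![i, j, l]]
      with s h1 h2
    rw [hv, h1, Pi.smul_apply, h2, hcoef, smul_eq_mul]
  have s1 := (hsum.summable.comp_injective Sum.inl_injective).hasSum
  have s2 := (hsum.summable.comp_injective Sum.inr_injective).hasSum
  have hST := (s1.sum s2).unique hsum
  set S' := ∑' k, ((fun b => ∑ n ∈ freqSet b, v n) ∘ Sum.inl) k
  set T' := ∑' k, ((fun b => ∑ n ∈ freqSet b, v n) ∘ Sum.inr) k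
  have l1 := hasSumL2_of_hasSum s1 (G := fun k s => a 0 0 k * UnitAddTorus.mFourier ![0, 0, k] s)
    fun k => by
      simp only [Function.comp_apply, freqSet, Finset.sum_singleton]
      exact hvae 0 0 k
  have l2 := hasSumL2_of_hasSum s2 (G := fun b s => ∑ κ ∈ latticeAt b.1,
      a κ.1 κ.2 (-b.2) * UnitAddTorus.mFourier ![κ.1, κ.2, -b.2] s) fun b => by
    simp only [Function.comp_apply, sum_freqSet_inr]
    have h2 : ∀ᵐ x ∂torusHaar, ∀ κ ∈ latticeAt b.1, v ![κ.1, κ.2, -b.2] x =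
        a κ.1 κ.2 (-b.2) * UnitAddTorus.mFourier ![κ.1, κ.2, -b.2] x :=
      (ae_ball_iff (latticeAt b.1).countable_toSet).mpr fun κ _ => hvae _ _ _
    filter_upwards [Lp.coeFn_finsetSum (latticeAt b.1) (fun κ => v ![κ.1, κ.2, -b.2]), h2]
      with x hx hx2
    rw [hx, Finset.sum_apply, Finset.sum_congr rfl hx2]
  have m1 := l1.comp ENNReal.ofReal_ne_top htm htmap
  have m2 := l2.comp ENNReal.ofReal_ne_top htm htmap
  simp only [ht, mFourier_toTorus] at m1 m2
  refine ⟨fun q => S' (t q), fun q => T' (t q), m1, m2, ?_⟩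
  have hae : ∀ᵐ s ∂torusHaar, f₀ s = S' s + T' s := by
    filter_upwards [hf₀L.coeFn_toLp, Lp.coeFn_add S' T'] with s h1 h2
    rw [← h1, ← Pi.add_apply, ← h2, hST]
  have hqmp : Measure.map t cosetMeasure ≪ torusHaar := by
    rw [htmap]
    exact Measure.smul_absolutelyContinuous
  have hae' : ∀ᵐ q ∂cosetMeasure, f₀ (t q) = S' (t q) + T' (t q) :=
    Measure.QuasiMeasurePreserving.ae ⟨htm, hqmp⟩ hae
  have hrep : ∀ᵐ q ∂cosetMeasure, rep q ∈ fundDomain :=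
    measurePreserving_rep.quasiMeasurePreserving.ae (ae_restrict_mem measurableSet_fundDomain)
  filter_upwards [hae', hrep] with q h1 h2
  rw [← h1, ht]
  simp only [hst _ h2, coset_rep]
  field_simp

end SE2


/-! ### Convolution on the coset space -/

/-- Cauchy–Schwarz for the factors a b^{1/2} and b^{1/2}. -/
theorem ENNReal.lintegral_mul_sq_le {α : Type*} [MeasurableSpace α] {μ : Measure α}
    {a b : α → ℝ≥0∞} (ha : AEMeasurable a μ) (hb : AEMeasurable b μ) :
    (∫⁻ t, a t * b t ∂μ) ^ 2 ≤ (∫⁻ t, a t ^ 2 * b t ∂μ) * ∫⁻ t, b t ∂μ := by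
  have h := ENNReal.lintegral_mul_norm_pow_le (μ := μ) ((ha.pow_const 2).mul hb) hb
    (p := 1 / 2) (q := 1 / 2) (by norm_num) (by norm_num) (by norm_num)
  have e : ∀ t, ((a ^ 2 * b) t) ^ (1 / 2 : ℝ) * b t ^ (1 / 2 : ℝ) = a t * b t := fun t => by
    rw [← ENNReal.mul_rpow_of_nonneg _ _ (by norm_num)]
    have : (a ^ 2 * b) t * b t = (a t * b t) ^ (2 : ℝ) := by
      rw [ENNReal.rpow_two, Pi.mul_apply, Pi.pow_apply]
      ring
    rw [this, ← ENNReal.rpow_mul]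
    norm_num
  have h' : ∫⁻ t, a t * b t ∂μ ≤
      ((∫⁻ t, a t ^ 2 * b t ∂μ) * ∫⁻ t, b t ∂μ) ^ (1 / 2 : ℝ) := by
    rw [ENNReal.mul_rpow_of_nonneg _ _ (by norm_num)]
    refine le_trans (le_of_eq ?_) h
    exact lintegral_congr fun t => (e t).symm
  refine (pow_le_pow_left' h' 2).trans (le_of_eq ?_)
  rw [← ENNReal.rpow_two, ← ENNReal.rpow_mul]
  norm_num

namespace SE2

variable {f₁ f₂ : SE2 → ℂ}

theorem periodization_coset {E : Type*} [AddCommMonoid E] [TopologicalSpace E] (f : SE2 → E)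
    (g : SE2) : periodization f (coset g) = ∑' γ : latticeΓ, f (γ * g) := rfl

theorem cosetConv_coset (ψ : CosetSpace → ℂ) (f : SE2 → ℂ) (g : SE2) :
    cosetConv ψ f (coset g) = ∫ h, ψ (coset h) * f (h⁻¹ * g) ∂haar := rfl

theorem aestronglyMeasurable_periodization_coset (hf₁ : Integrable f₁ haar) :
    AEStronglyMeasurable (fun g => periodization f₁ (coset g)) haar := by
  refine AEStronglyMeasurable.tsum (L := SummationFilter.unconditional _) fun γ : latticeΓ => ?_
  exact hf₁.1.comp_measurePreserving (measurePreserving_lattice_mul γ)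

theorem norm_periodization_le (f : SE2 → ℂ) (q : CosetSpace) :
    ‖periodization f q‖ ≤ ‖periodization (fun g => ‖f g‖) q‖ := by
  obtain ⟨g, rfl⟩ : ∃ g, coset g = q := ⟨rep q, coset_rep q⟩
  rw [periodization_coset, periodization_coset]
  by_cases h : Summable fun γ : latticeΓ => ‖f (γ * g)‖
  · exact (norm_tsum_le_tsum_norm h).trans (le_abs_self _)
  -- For complex series summability is absolute, so off the summability set both periodizations take
  -- the default value 0.
  · rw [tsum_eq_zero_of_not_summable h, tsum_eq_zero_of_not_summable fun h' => h h'.norm]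
    simp

theorem memLp_periodization (hf₁ : Integrable f₁ haar)
    (hper : MemLp (periodization fun g => ‖f₁ g‖) 2 cosetMeasure) :
    MemLp (periodization f₁) 2 cosetMeasure := by
  refine hper.of_le ?_ (Eventually.of_forall fun q => norm_periodization_le f₁ q)
  rw [aestronglyMeasurable_cosetMeasure_iff]
  exact (aestronglyMeasurable_periodization_coset hf₁).restrict

section Convolution

variable {ψ : CosetSpace → ℂ}

theorem aestronglyMeasurable_mul_inv_mul
    (hm : AEStronglyMeasurable (fun g => ψ (coset g)) haar) (hf₂ : Integrable f₂ haar) :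
    AEStronglyMeasurable (fun z : SE2 × SE2 => ψ (coset (z.1 * z.2⁻¹)) * f₂ z.2)
      (haar.prod haar) := by
  have h := hm.comp_quasiMeasurePreserving (quasiMeasurePreserving_div haar haar)
  simp only [Function.comp_def, div_eq_mul_inv] at h
  exact h.mul (hf₂.1.comp_quasiMeasurePreserving Measure.quasiMeasurePreserving_snd)

theorem aestronglyMeasurable_mul_inv_mul_restrict
    (hm : AEStronglyMeasurable (fun g => ψ (coset g)) haar) (hf₂ : Integrable f₂ haar) :
    AEStronglyMeasurable (fun z : SE2 × SE2 => ψ (coset (z.1 * z.2⁻¹)) * f₂ z.2)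
      ((haar.restrict fundDomain).prod haar) :=
  (aestronglyMeasurable_mul_inv_mul hm hf₂).mono_ac
    (Measure.restrict_le_self.absolutelyContinuous.prod Measure.AbsolutelyContinuous.rfl)

/-- Young's inequality on the quotient: Cauchy–Schwarz with weight |f₂|, Tonelli, and the invariance
of integrals over the domain under right translation by u⁻¹. -/
theorem lintegral_sq_convolution_lt_top
    (hm : AEStronglyMeasurable (fun g => ψ (coset g)) haar) (hψ : MemLp ψ 2 cosetMeasure)
    (hf₂ : Integrable f₂ haar) :
    ∫⁻ g in fundDomain, (∫⁻ u, ‖ψ (coset (g * u⁻¹))‖ₑ * ‖f₂ u‖ₑ ∂haar) ^ 2 ∂haar < ∞ := by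
  have hm' : AEMeasurable (fun z : SE2 × SE2 => ‖ψ (coset (z.1 * z.2⁻¹))‖ₑ)
      ((haar.restrict fundDomain).prod haar) := by
    have h := hm.comp_quasiMeasurePreserving (quasiMeasurePreserving_div haar haar)
    simp only [Function.comp_def, div_eq_mul_inv] at h
    exact (h.mono_ac (Measure.restrict_le_self.absolutelyContinuous.prod
      Measure.AbsolutelyContinuous.rfl)).enorm
  have hf' : AEMeasurable (fun u => ‖f₂ u‖ₑ) haar := hf₂.1.enorm
  have hslice : ∀ g : SE2, AEMeasurable (fun u => ‖ψ (coset (g * u⁻¹))‖ₑ) haar := fun g => by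
    have h := hm.comp_measurePreserving (Measure.measurePreserving_div_left haar g)
    simp only [Function.comp_def, div_eq_mul_inv] at h
    exact h.enorm
  calc ∫⁻ g in fundDomain, (∫⁻ u, ‖ψ (coset (g * u⁻¹))‖ₑ * ‖f₂ u‖ₑ ∂haar) ^ 2 ∂haar
      ≤ ∫⁻ g in fundDomain, (∫⁻ u, ‖ψ (coset (g * u⁻¹))‖ₑ ^ 2 * ‖f₂ u‖ₑ ∂haar) *
          ∫⁻ u, ‖f₂ u‖ₑ ∂haar ∂haar :=
        lintegral_mono fun g => ENNReal.lintegral_mul_sq_le (hslice g) hf'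
    _ = (∫⁻ g in fundDomain, ∫⁻ u, ‖ψ (coset (g * u⁻¹))‖ₑ ^ 2 * ‖f₂ u‖ₑ ∂haar ∂haar) *
          ∫⁻ u, ‖f₂ u‖ₑ ∂haar := lintegral_mul_const' _ _ hf₂.2.ne
    _ = (∫⁻ u, ∫⁻ g in fundDomain, ‖ψ (coset (g * u⁻¹))‖ₑ ^ 2 * ‖f₂ u‖ₑ ∂haar ∂haar) *
          ∫⁻ u, ‖f₂ u‖ₑ ∂haar := by
        rw [lintegral_lintegral_swap]
        exact (hm'.pow_const 2).mul (hf'.comp_quasiMeasurePreserving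
          Measure.quasiMeasurePreserving_snd)
    _ = (∫⁻ g in fundDomain, ‖ψ (coset g)‖ₑ ^ 2 ∂haar) * (∫⁻ u, ‖f₂ u‖ₑ ∂haar) *
          ∫⁻ u, ‖f₂ u‖ₑ ∂haar := by
        have h : ∀ u : SE2, ∫⁻ g in fundDomain, ‖ψ (coset (g * u⁻¹))‖ₑ ^ 2 * ‖f₂ u‖ₑ ∂haar =
            (∫⁻ g in fundDomain, ‖ψ (coset g)‖ₑ ^ 2 ∂haar) * ‖f₂ u‖ₑ := fun u => by
          rw [lintegral_mul_const' _ _ enorm_ne_top,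
            setLIntegral_mul_right (f := fun g => ‖ψ (coset g)‖ₑ ^ 2)
              fun γ g => by rw [coset_mul]]
        simp_rw [h]
        rw [lintegral_const_mul'' _ hf']
    _ < ∞ := by
        have h1 : ∫⁻ g in fundDomain, ‖ψ (coset g)‖ₑ ^ 2 ∂haar < ∞ := by
          have h := (eLpNorm_lt_top_iff_lintegral_rpow_enorm_lt_top (by norm_num) (by norm_num)).mp
            (memLp_cosetMeasure_iff.mp hψ).2
          simpa using h
        exact ENNReal.mul_lt_top (ENNReal.mul_lt_top h1 hf₂.2) hf₂.2

/-- The domain has finite measure and x ≤ x² + 1, so the square bound suffices. -/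
theorem lintegral_convolution_lt_top
    (hm : AEStronglyMeasurable (fun g => ψ (coset g)) haar) (hψ : MemLp ψ 2 cosetMeasure)
    (hf₂ : Integrable f₂ haar) :
    ∫⁻ g in fundDomain, (∫⁻ u, ‖ψ (coset (g * u⁻¹))‖ₑ * ‖f₂ u‖ₑ ∂haar) ∂haar < ∞ := by
  have h := lintegral_sq_convolution_lt_top hm hψ hf₂
  refine lt_of_le_of_lt (lintegral_mono fun g => ?_)
    ((lintegral_add_right _ measurable_const).trans_lt
      (ENNReal.add_lt_top.mpr ⟨h, (lintegral_const 1).trans_lt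
        (by rw [one_mul]; exact measure_lt_top _ _)⟩))
  rcases le_total (∫⁻ u, ‖ψ (coset (g * u⁻¹))‖ₑ * ‖f₂ u‖ₑ ∂haar) 1 with h1 | h1
  · exact h1.trans le_add_self
  · exact (le_self_pow h1 two_ne_zero).trans le_self_add

theorem integrable_mul_inv_mul
    (hm : AEStronglyMeasurable (fun g => ψ (coset g)) haar) (hψ : MemLp ψ 2 cosetMeasure)
    (hf₂ : Integrable f₂ haar) :
    Integrable (fun z : SE2 × SE2 => ψ (coset (z.1 * z.2⁻¹)) * f₂ z.2)
      ((haar.restrict fundDomain).prod haar) := by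
  have h := aestronglyMeasurable_mul_inv_mul_restrict hm hf₂
  refine ⟨h, ?_⟩
  rw [HasFiniteIntegral, lintegral_prod _ h.enorm]
  simpa only [enorm_mul] using lintegral_convolution_lt_top hm hψ hf₂

theorem integrable_comp_div_left_iff (ψ : CosetSpace → ℂ) (f₂ : SE2 → ℂ) (g : SE2) :
    Integrable (fun h => ψ (coset h) * f₂ (h⁻¹ * g)) haar ↔
      Integrable (fun u => ψ (coset (g * u⁻¹)) * f₂ u) haar := by
  have h := (Measure.measurePreserving_div_left haar g).integrable_comp_emb (measurableEmbedding_divLeft g)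
    (g := fun h => ψ (coset h) * f₂ (h⁻¹ * g))
  rw [← h]
  simp [Function.comp_def, div_eq_mul_inv]

theorem cosetConv_coset' (ψ : CosetSpace → ℂ) (f₂ : SE2 → ℂ) (g : SE2) :
    cosetConv ψ f₂ (coset g) = ∫ u, ψ (coset (g * u⁻¹)) * f₂ u ∂haar := by
  rw [cosetConv_coset, ← (Measure.measurePreserving_div_left haar g).integral_comp
    (measurableEmbedding_divLeft g)]
  simp [div_eq_mul_inv]

/-- Fubini gives the claim almost everywhere on the domain. The exceptional set is
lattice-invariant, hence null as soon as its part in the domain is. -/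
theorem ae_integrable_convolution
    (hm : AEStronglyMeasurable (fun g => ψ (coset g)) haar) (hψ : MemLp ψ 2 cosetMeasure)
    (hf₂ : Integrable f₂ haar) :
    ∀ᵐ g ∂haar, Integrable (fun h => ψ (coset h) * f₂ (h⁻¹ * g)) haar := by
  simp only [integrable_comp_div_left_iff]
  have h := (integrable_mul_inv_mul hm hψ hf₂).prod_right_ae
  rw [ae_restrict_iff'₀ measurableSet_fundDomain.nullMeasurableSet] at h
  refine isFundamentalDomain.measure_zero_of_invariant _ (fun γ => ?_) ?_
  · ext g
    rw [Set.mem_smul_set_iff_inv_smul_mem]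
    have e : ∀ u, coset ((γ⁻¹ • g) * u) = coset (g * u) := fun u => by
      rw [Subgroup.smul_def, smul_eq_mul, mul_assoc, coset_mul]
    simp only [Set.mem_compl_iff, Set.mem_ofPred_eq, e]
  · refine measure_mono_null ?_ h
    rintro g ⟨h1, h2⟩ h3
    exact h1 (h3 h2)

theorem memLp_cosetConv
    (hm : AEStronglyMeasurable (fun g => ψ (coset g)) haar) (hψ : MemLp ψ 2 cosetMeasure)
    (hf₂ : Integrable f₂ haar) : MemLp (cosetConv ψ f₂) 2 cosetMeasure := by
  rw [memLp_cosetMeasure_iff]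
  simp only [cosetConv_coset']
  refine ⟨(aestronglyMeasurable_mul_inv_mul_restrict hm hf₂).integral_prod_right', ?_⟩
  rw [eLpNorm_lt_top_iff_lintegral_rpow_enorm_lt_top (by norm_num) (by norm_num)]
  refine lt_of_le_of_lt (lintegral_mono fun g => ?_) (lintegral_sq_convolution_lt_top hm hψ hf₂)
  rw [ENNReal.toReal_ofNat, ENNReal.rpow_two]
  refine pow_le_pow_left' ((enorm_integral_le_lintegral_enorm _).trans (le_of_eq ?_)) 2
  simp only [enorm_mul]

/-- After Fubini, each inner integrand is lattice-invariant in g, so replacing g by gu leaves its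
integral over the domain unchanged and moves u into χ. -/
theorem setIntegral_cosetConv_mul {χ : SE2 → ℂ} (hχm : Measurable χ) {C : ℝ}
    (hχ : ∀ g, ‖χ g‖ ≤ C) (hχΓ : ∀ (γ : latticeΓ) g, χ (γ * g) = χ g)
    (hm : AEStronglyMeasurable (fun g => ψ (coset g)) haar) (hψ : MemLp ψ 2 cosetMeasure)
    (hf₂ : Integrable f₂ haar) :
    ∫ g in fundDomain, cosetConv ψ f₂ (coset g) * χ g ∂haar =
      ∫ u, (∫ g in fundDomain, ψ (coset g) * χ (g * u) ∂haar) * f₂ u ∂haar := by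
  simp only [cosetConv_coset', ← integral_mul_const]
  rw [integral_integral_swap]
  · refine integral_congr_ae (Eventually.of_forall fun u => ?_)
    beta_reduce
    rw [← setIntegral_mul_right (f := fun g => ψ (coset g) * χ (g * u) * f₂ u) _ u⁻¹]
    · refine integral_congr_ae (Eventually.of_forall fun g => ?_)
      beta_reduce
      rw [inv_mul_cancel_right]
      ring
    · intro γ g
      rw [coset_mul, mul_assoc (γ : SE2), hχΓ]
  · exact (integrable_mul_inv_mul hm hψ hf₂).mul_bdd (c := C)
      (hχm.comp measurable_fst).aestronglyMeasurable (Eventually.of_forall fun z => hχ _)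

end Convolution

/-- Unfolding: a lattice-invariant χ can be taken inside the periodization, and the translates of
the domain tile the group. Integrability of f₁χ justifies exchanging sum and integral. -/
theorem setIntegral_periodization_mul (hf₁ : Integrable f₁ haar) {χ : SE2 → ℂ}
    (hχm : Measurable χ) {C : ℝ} (hχ : ∀ g, ‖χ g‖ ≤ C)
    (hχΓ : ∀ (γ : latticeΓ) g, χ (γ * g) = χ g) :
    ∫ g in fundDomain, periodization f₁ (coset g) * χ g ∂haar = ∫ g, f₁ g * χ g ∂haar := by
  have hi : Integrable (fun g => f₁ g * χ g) haar :=
    hf₁.mul_bdd (c := C) hχm.aestronglyMeasurable (Eventually.of_forall hχ)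
  rw [isFundamentalDomain.integral_eq_tsum'' _ hi]
  simp only [Subgroup.smul_def, smul_eq_mul]
  rw [← integral_tsum]
  · refine integral_congr_ae (Eventually.of_forall fun g => ?_)
    simp only [periodization_coset, hχΓ, tsum_mul_right]
  · exact fun γ => (hi.1.comp_measurePreserving (measurePreserving_lattice_mul γ)).restrict
  · have h := hi.2
    rw [HasFiniteIntegral, isFundamentalDomain.lintegral_eq_tsum''] at h
    exact h.ne

/-- Moving f₂ out of the convolution and then unfolding the periodization leaves the double
integral, with the character evaluated at the product. -/
theorem setIntegral_cosetConv_latticeChar (hf₁ : Integrable f₁ haar) (hf₂ : Integrable f₂ haar)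
    (hper : MemLp (periodization fun g => ‖f₁ g‖) 2 cosetMeasure) (i j l : ℤ) :
    ∫ g in fundDomain, cosetConv (periodization f₁) f₂ (coset g) *
      (starRingEnd ℂ) (latticeChar i j l g) ∂haar = charIntegral f₁ f₂ i j l := by
  have hc : Measurable fun g => (starRingEnd ℂ) (latticeChar i j l g) :=
    Complex.continuous_conj.measurable.comp (measurable_latticeChar i j l)
  have hn : ∀ g, ‖(starRingEnd ℂ) (latticeChar i j l g)‖ ≤ 1 := fun g => by
    rw [RCLike.norm_conj, norm_latticeChar]
  rw [setIntegral_cosetConv_mul hc hn (fun γ g => by rw [latticeChar_coset])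
    (aestronglyMeasurable_periodization_coset hf₁) (memLp_periodization hf₁ hper) hf₂,
    charIntegral, integral_prod_symm]
  · refine integral_congr_ae (Eventually.of_forall fun u => ?_)
    beta_reduce
    rw [setIntegral_periodization_mul hf₁ (χ := fun g => (starRingEnd ℂ) (latticeChar i j l (g * u)))
      (hc.comp (measurable_mul_const u))
      (fun g => hn _) (fun γ g => by
        rw [mul_assoc, latticeChar_coset]),
      ← integral_mul_const]
    refine integral_congr_ae (Eventually.of_forall fun g => ?_)
    ring
  · exact integrable_mul_bounded hf₁ hf₂
      (hc.comp measurable_mul).aestronglyMeasurable fun z => hn _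

end SE2


/-! ### The terms of the second series and the final assembly -/

namespace SE2

variable {f₁ f₂ : SE2 → ℂ}

theorem latticeChar_polar (i j l : ℤ) (a φ α : ℝ) : latticeChar i j l (polar a φ α) =
    Complex.exp (Complex.I *
      ((2 * Real.pi * (i * (a * Real.cos φ) + j * (a * Real.sin φ)) : ℝ) : ℂ)) *
      Complex.exp (Complex.I * l * α) := by
  rw [latticeChar, polar, fourier_ang]

/-- The kernel is a finite sum over the lattice points of the circle, so the limit over n may be
taken at each point separately and the results added. -/
theorem tendsto_kernel_series (hf₁ : Integrable f₁ haar) (hf₂ : Integrable f₂ haar) (ρ k)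
    (a φ α : ℝ) :
    Tendsto (fun N : ℕ => ∑ n ∈ Finset.Icc (-(N : ℤ)) N, ∑' m : ℤ,
      (-1 : ℂ) ^ (k - n) * kernelK ρ (k - n) a φ * fourierCoef f₁ (2 * Real.pi * ρ) n m *
        fourierCoef f₂ (2 * Real.pi * ρ) m k * Complex.exp (-(Complex.I * k * α)))
      atTop (𝓝 (∑ κ ∈ latticeAt ρ, charIntegral f₁ f₂ κ.1 κ.2 (-k) *
        latticeChar κ.1 κ.2 (-k) (polar a φ α))) := by
  have h := tendsto_finsetSum (latticeAt ρ) fun κ hκ =>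
    (tendsto_sum_fourierCoef hf₁ hf₂ κ.1 κ.2 k).mul_const (latticeChar κ.1 κ.2 (-k) (polar a φ α))
  refine h.congr fun N => ?_
  simp_rw [Finset.sum_mul]
  rw [Finset.sum_comm]
  refine Finset.sum_congr rfl fun n _ => ?_
  simp_rw [mul_assoc _ (fourierCoef f₁ _ n _), mul_right_comm _ (_ * _) (Complex.exp _)]
  rw [tsum_mul_left, kernelK_eq, Finset.mul_sum, Finset.sum_mul, Finset.sum_mul]
  refine Finset.sum_congr rfl fun κ hκ => ?_
  rw [← mem_latticeAt.mp hκ, latticeChar_polar]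
  have e : Complex.I * ((-k : ℤ) : ℂ) * (α : ℂ) = -(Complex.I * k * α) := by push_cast; ring
  rw [e]
  ring

end SE2

end

theorem mainTheorem7 (f₁ f₂ : SE2 → ℂ)
    (hf₁ : Integrable f₁ SE2.haar) (hf₂ : Integrable f₂ SE2.haar)
    (hper : MemLp (SE2.periodization fun g => ‖f₁ g‖) 2 SE2.cosetMeasure) :
    -- the integral defining `f̃₁ ⊘ f₂` converges absolutely almost everywhere
    (∀ᵐ g ∂SE2.haar, Integrable
      (fun h => SE2.periodization f₁ (SE2.coset h) * f₂ (h⁻¹ * g)) SE2.haar) ∧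
    -- the innermost series, over `m`, converges absolutely
    (∀ (ρ : SE2.PosRadius) (n k : ℤ), Summable fun m : ℤ =>
      SE2.fourierCoef f₁ (2 * Real.pi * ρ) n m * SE2.fourierCoef f₂ (2 * Real.pi * ρ) m k) ∧
    ∃ (A : ℤ → SE2.CosetSpace → ℂ) (B : SE2.PosRadius × ℤ → SE2.CosetSpace → ℂ)
      (S T : SE2.CosetSpace → ℂ),
      -- the terms of the first series
      (∀ (k : ℤ) (a φ α : ℝ), A k (SE2.coset (SE2.polar a φ α)) =
        SE2.charCoef f₁ k * SE2.charCoef f₂ k * Complex.exp (Complex.I * k * α)) ∧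
      -- the terms of the second series: the sum over `n` of the sums over `m`
      (∀ (ρ : SE2.PosRadius) (k : ℤ) (a φ α : ℝ),
        Tendsto (fun N : ℕ => ∑ n ∈ Finset.Icc (-(N : ℤ)) N, ∑' m : ℤ,
          (-1 : ℂ) ^ (k - n) * SE2.kernelK ρ (k - n) a φ *
            SE2.fourierCoef f₁ (2 * Real.pi * ρ) n m *
            SE2.fourierCoef f₂ (2 * Real.pi * ρ) m k *
            Complex.exp (-(Complex.I * k * α)))
          atTop (𝓝 (B (ρ, k) (SE2.coset (SE2.polar a φ α))))) ∧
      SE2.HasSumL2 SE2.cosetMeasure A S ∧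
      SE2.HasSumL2 SE2.cosetMeasure B T ∧
      MemLp (SE2.cosetConv (SE2.periodization f₁) f₂) 2 SE2.cosetMeasure ∧
      SE2.cosetConv (SE2.periodization f₁) f₂ =ᵐ[SE2.cosetMeasure]
        fun q => 2 * Real.pi * (S q + T q) := by
  have hm := SE2.aestronglyMeasurable_periodization_coset hf₁
  have hψ := SE2.memLp_periodization hf₁ hper
  have hF := SE2.memLp_cosetConv hm hψ hf₂
  obtain ⟨S, T, hS, hT, hST⟩ := SE2.exists_hasSumL2 hF
    (SE2.setIntegral_cosetConv_latticeChar hf₁ hf₂ hper)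
  refine ⟨SE2.ae_integrable_convolution hm hψ hf₂,
    fun ρ n k => (SE2.hasSum_fourierCoef_mul hf₁ hf₂ _ n k).summable,
    -- The two families are determined by `hS` and `hT`: the Fourier blocks of the convolution,
    -- defined on cosets from the outset, so that the limits over n depend on the coset only.
    _, _, S, T, fun k a φ α => ?_, fun ρ k a φ α => ?_, hS, hT, hF, hST⟩
  · rw [SE2.cosetChar_coset, SE2.charIntegral_zero, SE2.latticeChar_polar]
    simp
  · simp only [SE2.cosetChar_coset]
    exact SE2.tendsto_kernel_series hf₁ hf₂ ρ k a φ α
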